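/- Let $f(x)=x^{12}-\tfrac{12}{11}x^{11}+1\in\mathbb{Q}[x]$ and let $K\subset\mathbb{C}$ be its splitting field. For $m,n\ge 1$ put $\beta_{m,n}(x)=\frac{(m+n)^{m+n}}{m^m n^n}x^m(1-x)^n$, a map of the Riemann sphere $\Sigma=\mathbb{C}\cup\{\infty\}$ to itself. A Belyĭ function on a compact Riemann surface $X$ is a non-constant meromorphic function $\beta:X\to\Sigma$ whose branch points lie in $\{0,1,\infty\}$; it is clean if every point above $1$ has ramification order exactly $2$. The dessin $\mathcal{D}(\beta)$ is the bipartite map on $X$ whose black and white vertices are the points above $0$ and $1$, whose edge segments are the connected components of $\beta^{-1}((0,1))$, and whose faces are the connected components of $X\setminus\beta^{-1}([0,1])$. Dessins $\mathcal{D}(\beta)$, $\mathcal{D}(\beta')$ on $X$, $X'$ are isomorphic if there is a homeomorphism $h:X\to X'$ with $\beta'\circ h=\beta$ (such an $h$ is biholomorphic and carries vertices, edge segments and faces of one dessin to those of the other). In $S_{12}$ let $$a=(2,3,4,5,6)(7,8,9,10,11),\qquad b=(1,2,3)(4,6,7)(5,11,8)(9,10,12),$$ and let $ab=(1,2)(3,6)(4,11)(5,7)(8,10)(9,12)$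 be their product (first $a$, then $b$). Then: 1. $f$ is irreducible over $\mathbb{Q}$ and has $12$ distinct complex roots. 2. $a^5=b^3=(ab)^2=1$, and there is an injective homomorphism $\theta:A_5\to S_{12}$ whose image is $\langle a,b\rangle$; for a suitable labelling of the faces of a regular dodecahedron by $1,\dots,12$, this image is exactly the group of permutations of the faces induced by the orientation preserving symmetries. The orbits of the unordered triple $(2,7,11)$ are $$\langle a\rangle:\ \{(2,7,11),(3,7,8),(4,8,9),(5,9,10),(6,10,11)\},$$ $$\langle b\rangle:\ \{(2,7,11),(3,4,8),(1,5,6)\},\qquad \langle ab\rangle:\ \{(2,7,11),(1,4,5)\}.$$ 3. Let $r_1,\dots,r_{12}$ be any labelling of the roots of $f$. The action on the roots, $\sigma(r_i)=r_{\sigma(i)}$, identifies $G=\mathrm{Gal}(K/\mathbb{Q})$ with $S_{12}$; through this identification $\theta$ becomes an embedding $A_5\to G$. 4. For distinct $i,j,k$ let $E_{i,j,k}\subset\mathbb{P}^2(\mathbb{C})$ be the curve $y^2z=(x-r_iz)(x-r_jz)(x-r_kz)$, let $\pi^{i,j,k}:E_{i,j,k}\to\Sigma$ be the projection $(x,y)\mapsto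 x$, $[0,1,0]\mapsto\infty$, and put $\beta^{i,j,k}=\beta_{1,1}\circ\beta_{10,1}\circ f\circ\pi^{i,j,k}$. Then $E_{i,j,k}$ is an elliptic curve and $\beta^{i,j,k}$ is a clean Belyĭ function on it. 5. Applying $\sigma\in G$ to the coefficients of the equation of $E_{i,j,k}$ and of the function $\beta^{i,j,k}$ gives the pair $(E_{\sigma(i),\sigma(j),\sigma(k)},\beta^{\sigma(i),\sigma(j),\sigma(k)})$. This induces a well-defined action of $G$ on the family of isomorphism classes of the dessins $\mathcal{D}(\beta^{i,j,k})$, with $i,j,k$ distinct, and $\sigma$ takes $\mathcal{D}(\beta^{i,j,k})$ to $\mathcal{D}(\beta^{\sigma(i),\sigma(j),\sigma(k)})$. 6. The resulting action of $A_5$ on this family is not trivial. The orbits of $\mathcal{D}(\beta^{2,7,11})$ under $\langle a\rangle$, $\langle b\rangle$ and $\langle ab\rangle$ consist of the dessins $\mathcal{D}(\beta^{i,j,k})$ for the triples $(i,j,k)$ in the three lists of part 2, and they contain exactly $5$, $3$ and $2$ isomorphism classes, respectively. -/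

import Mathlib

open Filter Topology Polynomial

noncomputable section

namespace EllipticDessins

/-! ### The Riemann sphere and the complex projective plane -/

/-- The Riemann sphere `ℂ ∪ {∞}`. -/
abbrev Sphere : Type := OnePoint ℂ

/-- A finite point of the sphere. -/
def fin (z : ℂ) : Sphere := (z : OnePoint ℂ)

/-- The point at infinity of the sphere. -/
def infty : Sphere := OnePoint.infty

/-- The complex projective plane. -/
abbrev P2 : Type := Projectivization ℂ (Fin 3 → ℂ)

/-- The quotient topology on the projective plane. -/
instance instTopologicalSpaceP2 : TopologicalSpace P2 :=
  inferInstanceAs (TopologicalSpace (Quotient (projectivizationSetoid ℂ (Fin 3 → ℂ))))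

/-! ### Ramification of functions on plane curves -/

/-- `γ`, restricted to a small disc around `0`, is a holomorphic local parametrization of `X` at `p`:
it is an immersion into the projective plane (it has an analytic lift `v` to `ℂ³` with `v 0` and
`v' 0` linearly independent), and it maps the neighbourhoods of `0` to the neighbourhoods of `p`
in `X`. -/
def IsLocalParameter {X : Set P2} (p : X) (γ : ℂ → X) : Prop :=
  γ 0 = p ∧ map γ (𝓝 0) = 𝓝 p ∧
    ∃ v : ℂ → (Fin 3 → ℂ), AnalyticAt ℂ v 0 ∧ LinearIndependent ℂ ![v 0, deriv v 0] ∧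
      ∀ᶠ t in 𝓝 (0 : ℂ), ∃ h : v t ≠ 0, (γ t : P2) = Projectivization.mk ℂ (v t) h

/-- `1 / z` as a point of the sphere. -/
def recip (z : ℂ) : Sphere := if z = 0 then infty else fin z⁻¹

/-- `X` is near `p` an embedded Riemann surface, `β` is meromorphic and non-constant near `p`, and
its ramification order at `p` is `e ≥ 1`: in a local parameter `t`, `β = c + u` (if `β p = c` is
finite) or `β = 1 / u` (if `β p = ∞`), where `u` vanishes at `t = 0` to order exactly `e`. -/
def HasRamificationOrder {X : Set P2} (β : X → Sphere) (p : X) (e : ℕ) : Prop :=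
  0 < e ∧ ∃ γ : ℂ → X, IsLocalParameter p γ ∧
    ∃ u : ℂ → ℂ, AnalyticAt ℂ u 0 ∧ analyticOrderAt u 0 = (e : ℕ∞) ∧
      ((∃ c : ℂ, ∀ᶠ t in 𝓝 (0 : ℂ), β (γ t) = fin (c + u t)) ∨
        ∀ᶠ t in 𝓝 (0 : ℂ), β (γ t) = recip (u t))

/-- `X` is a compact connected Riemann surface in the projective plane and `β` is a non-constant
meromorphic function on it, all of whose branch points lie in `{0, 1, ∞}`. -/
def IsBelyi (X : Set P2) (β : X → Sphere) : Prop :=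
  IsCompact X ∧ IsConnected X ∧
    ∀ p : X, ∃ e : ℕ, HasRamificationOrder β p e ∧
      (e ≠ 1 → β p = fin 0 ∨ β p = fin 1 ∨ β p = infty)

/-- A Belyi function is clean if all points above `1` have ramification order `2`. -/
def IsCleanBelyi (X : Set P2) (β : X → Sphere) : Prop :=
  IsBelyi X β ∧ ∀ p : X, β p = fin 1 → HasRamificationOrder β p 2

/-! ### Dessins -/

/-- A bipartite map on a surface in the projective plane, together with the map to the sphere
along which it is lifted. -/
structure Dessin where
  surface : Set P2
  proj : surface → Sphere
  black : Set surface
  white : Set surface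
  edgeSegments : Set (Set surface)
  faces : Set (Set surface)

/-- The set of connected components of a subset `S` of a space. -/
def components {T : Type} [TopologicalSpace T] (S : Set T) : Set (Set T) :=
  {c | ∃ x ∈ S, c = connectedComponentIn S x}

/-- The bipartite map `𝒟(β)` obtained by lifting the unit interval along `β`. -/
def dessin (X : Set P2) (β : X → Sphere) : Dessin where
  surface := X
  proj := β
  black := {p | β p = fin 0}
  white := {p | β p = fin 1}
  edgeSegments := components {p | ∃ t : ℝ, 0 < t ∧ t < 1 ∧ β p = fin t}
  faces := components {p | ¬ ∃ t : ℝ, 0 ≤ t ∧ t ≤ 1 ∧ β p = fin t}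

/-- Isomorphism of dessins: a homeomorphism of the surfaces which commutes with the maps to the
sphere (so that it is biholomorphic when these maps are Belyi functions) and takes the vertices of
each colour, the edge segments and the faces of one to those of the other. -/
def Dessin.Iso (D D' : Dessin) : Prop :=
  ∃ h : D.surface ≃ₜ D'.surface, (∀ p, D'.proj (h p) = D.proj p) ∧
    h '' D.black = D'.black ∧ h '' D.white = D'.white ∧
    (fun s => h '' s) '' D.edgeSegments = D'.edgeSegments ∧
    (fun s => h '' s) '' D.faces = D'.faces

theorem Dessin.Iso.refl (D : Dessin) : D.Iso D :=
  ⟨Homeomorph.refl _, by simp⟩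

theorem Dessin.Iso.symm {D D' : Dessin} (H : D.Iso D') : D'.Iso D := by
  obtain ⟨h, h1, h2, h3, h4, h5⟩ := H
  have key : ∀ s : Set D.surface, h.symm '' (h '' s) = s := fun s => by
    rw [Set.image_image]; simp
  refine ⟨h.symm, fun p => ?_, ?_, ?_, ?_, ?_⟩
  · rw [← h1, h.apply_symm_apply]
  · rw [← h2, key]
  · rw [← h3, key]
  · rw [← h4, Set.image_image]; simp only [key, Set.image_id']
  · rw [← h5, Set.image_image]; simp only [key, Set.image_id']

theorem Dessin.Iso.trans {D D' D'' : Dessin} (H : D.Iso D') (H' : D'.Iso D'') : D.Iso D'' := by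
  obtain ⟨h, h1, h2, h3, h4, h5⟩ := H
  obtain ⟨k, k1, k2, k3, k4, k5⟩ := H'
  have key : ∀ s : Set D.surface, (h.trans k) '' s = k '' (h '' s) := fun s => by
    rw [Set.image_image]; rfl
  refine ⟨h.trans k, fun p => ?_, ?_, ?_, ?_, ?_⟩
  · rw [← h1, ← k1]; rfl
  · rw [key, h2, k2]
  · rw [key, h3, k3]
  · rw [← k4, ← h4, Set.image_image]; simp only [key]
  · rw [← k5, ← h5, Set.image_image]; simp only [key]

instance dessinSetoid : Setoid Dessin :=
  ⟨Dessin.Iso, Dessin.Iso.refl, Dessin.Iso.symm, Dessin.Iso.trans⟩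

/-- Isomorphism classes of dessins. -/
def DessinClass : Type := Quotient dessinSetoid

/-- The isomorphism class of a dessin. -/
def Dessin.toClass (D : Dessin) : DessinClass := Quotient.mk dessinSetoid D

/-! ### Pairs (plane curve, function) over a field of algebraic numbers, and their conjugates -/

/-- A projective plane curve with homogeneous equation `curve` in `X 0, X 1, X 2`, together with a
rational function `num / den` on it, written in the affine coordinates `x = X 0 / X 2` and
`y = X 1 / X 2`; all coefficients lie in the subfield `L` of `ℂ`. -/
structure AlgebraicPair (L : IntermediateField ℚ ℂ) where
  curve : MvPolynomial (Fin 3) L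
  num : MvPolynomial (Fin 2) L
  den : MvPolynomial (Fin 2) L

/-- The conjugate pair: `σ` is applied to all coefficients. -/
def AlgebraicPair.conj {L : IntermediateField ℚ ℂ} (σ : L ≃ₐ[ℚ] L) (B : AlgebraicPair L) :
    AlgebraicPair L where
  curve := MvPolynomial.map (σ : L →+* L) B.curve
  num := MvPolynomial.map (σ : L →+* L) B.num
  den := MvPolynomial.map (σ : L →+* L) B.den

/-- The complex points of the curve. -/
def AlgebraicPair.points {L : IntermediateField ℚ ℂ} (B : AlgebraicPair L) : Set P2 :=
  {p | MvPolynomial.aeval p.rep B.curve = 0}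

/-- The affine coordinates `(x, y)` of a point `[x, y, 1]`. -/
def affineCoords (p : P2) : Fin 2 → ℂ := ![p.rep 0 / p.rep 2, p.rep 1 / p.rep 2]

/-- The function on the complex points: `num / den` where this makes sense in the affine plane,
extended by continuity to the remaining points of the curve. -/
def AlgebraicPair.function {L : IntermediateField ℚ ℂ} (B : AlgebraicPair L) : P2 → Sphere :=
  extendFrom
    {p | p ∈ B.points ∧ p.rep 2 ≠ 0 ∧ MvPolynomial.aeval (affineCoords p) B.den ≠ 0}
    (fun p => fin (MvPolynomial.aeval (affineCoords p) B.num /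
      MvPolynomial.aeval (affineCoords p) B.den))

/-- The dessin of the complex curve and function given by the pair. -/
def AlgebraicPair.dessin {L : IntermediateField ℚ ℂ} (B : AlgebraicPair L) : Dessin :=
  EllipticDessins.dessin B.points (fun p => B.function p)

/-! ### The polynomial `f` and the Belyi functions `β_{m,n}` -/

/-- `f = x¹² - (12/11) x¹¹ + 1`. -/
def f : ℚ[X] := X ^ 12 - C (12 / 11) * X ^ 11 + 1

/-- `β_{m,n} = ((m+n)^(m+n) / (m^m n^n)) x^m (1-x)^n`. -/
def betaPoly (m n : ℕ) : ℚ[X] :=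
  C (((m : ℚ) + n) ^ (m + n) / ((m : ℚ) ^ m * (n : ℚ) ^ n)) * X ^ m * (1 - X) ^ n

/-- The self-map of the sphere given by a non-constant polynomial. -/
def sphereMap (q : ℚ[X]) : Sphere → Sphere := OnePoint.map (fun z : ℂ => aeval z q)

/-- The splitting field of `f` in `ℂ`. -/
def K : IntermediateField ℚ ℂ := IntermediateField.adjoin ℚ (f.rootSet ℂ)

/-- The Galois group of `f` over `ℚ`. -/
abbrev G : Type := K ≃ₐ[ℚ] K

/-- A labelling `r_1, …, r_12` of the roots of `f`. Here and below the labels `1, …, 12` are read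
in `Fin 12`, where the numeral `12` denotes the same element as `0`. -/
abbrev Labelling : Type := Fin 12 ≃ f.rootSet ℂ

/-- The root `r_i` as an element of the splitting field. -/
def root (r : Labelling) (i : Fin 12) : K :=
  ⟨(r i : ℂ), IntermediateField.subset_adjoin ℚ _ (r i).2⟩

/-! ### The elliptic curves and the functions on them -/

/-- The curve `E_{i,j,k}`: `y² z = (x - r_i z) (x - r_j z) (x - r_k z)`. -/
def E (r : Labelling) (i j k : Fin 12) : Set P2 :=
  {p | p.rep 1 ^ 2 * p.rep 2 =
    (p.rep 0 - r i * p.rep 2) * (p.rep 0 - r j * p.rep 2) * (p.rep 0 - r k * p.rep 2)}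

/-- The projection `π^{i,j,k}`, `(x, y) ↦ x`, `∞ ↦ ∞`. -/
def proj (r : Labelling) (i j k : Fin 12) (p : E r i j k) : Sphere :=
  if (p : P2).rep 2 = 0 then infty else fin ((p : P2).rep 0 / (p : P2).rep 2)

/-- `β^{i,j,k} = β_{1,1} ∘ β_{10,1} ∘ f ∘ π^{i,j,k}`. -/
def beta (r : Labelling) (i j k : Fin 12) : E r i j k → Sphere :=
  sphereMap (betaPoly 1 1) ∘ sphereMap (betaPoly 10 1) ∘ sphereMap f ∘ proj r i j k

/-- The homogeneous equation of `E_{i,j,k}` and the polynomial `(β_{1,1} ∘ β_{10,1} ∘ f)(x)` as a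
pair over the splitting field of `f`. -/
def pair (r : Labelling) (i j k : Fin 12) : AlgebraicPair K where
  curve := MvPolynomial.X 1 ^ 2 * MvPolynomial.X 2 -
    (MvPolynomial.X 0 - MvPolynomial.C (root r i) * MvPolynomial.X 2) *
    (MvPolynomial.X 0 - MvPolynomial.C (root r j) * MvPolynomial.X 2) *
    (MvPolynomial.X 0 - MvPolynomial.C (root r k) * MvPolynomial.X 2)
  num := aeval (MvPolynomial.X 0) ((betaPoly 1 1).comp ((betaPoly 10 1).comp f))
  den := 1

/-- The isomorphism class of the dessin `𝒟(β^{i,j,k})`. -/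
def dessinClass (r : Labelling) (i j k : Fin 12) : DessinClass :=
  (dessin (E r i j k) (beta r i j k)).toClass

/-- `i, j, k` are distinct. -/
def Distinct (i j k : Fin 12) : Prop := i ≠ j ∧ i ≠ k ∧ j ≠ k

/-- The family of all dessins `𝒟(β^{i,j,k})`, `i, j, k` distinct, up to isomorphism. -/
def family (r : Labelling) : Set DessinClass :=
  {D | ∃ i j k : Fin 12, Distinct i j k ∧ D = dessinClass r i j k}

/-- `𝒟(β^{i,j,k})` as a member of the family. -/
def member (r : Labelling) (i j k : Fin 12) (h : Distinct i j k) : family r :=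
  ⟨dessinClass r i j k, i, j, k, h, rfl⟩

/-- The triple `2, 7, 11` is a triple of distinct labels. -/
theorem distinct_2_7_11 : Distinct 2 7 11 := by
  refine ⟨?_, ?_, ?_⟩ <;> decide

/-! ### The regular dodecahedron and its faces -/

/-- Normal vectors of the faces `12, 1, 2, …, 11` of a regular dodecahedron (`φ` is the golden
ratio; recall that the label `12` is `0` in `Fin 12`). -/
def faceNormal : Fin 12 → (Fin 3 → ℝ) :=
  let φ : ℝ := Real.goldenRatio
  ![![0, -1, -φ],
    ![0, 1, φ],
    ![1, φ, 0], ![-1, φ, 0], ![-φ, 0, 1], ![0, -1, φ], ![φ, 0, 1],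
    ![0, 1, -φ], ![-φ, 0, -1], ![-1, -φ, 0], ![1, -φ, 0], ![φ, 0, -1]]

/-- The faces of the regular dodecahedron `{x | ∀ j, ⟨n_j, x⟩ ≤ 1}`. -/
def face (i : Fin 12) : Set (Fin 3 → ℝ) :=
  {x | faceNormal i ⬝ᵥ x = 1 ∧ ∀ j, faceNormal j ⬝ᵥ x ≤ 1}

/-- `g` is the permutation of the faces induced by an orientation preserving symmetry of the
dodecahedron. -/
def IsFaceRotation (g : Equiv.Perm (Fin 12)) : Prop :=
  ∃ R ∈ Matrix.specialOrthogonalGroup (Fin 3) ℝ,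
    ∀ i, (fun x => Matrix.mulVec R x) '' face i = face (g i)

/-- `a = (2,3,4,5,6)(7,8,9,10,11)`. -/
def a : Equiv.Perm (Fin 12) :=
  List.formPerm [2, 3, 4, 5, 6] * List.formPerm [7, 8, 9, 10, 11]

/-- `b = (1,2,3)(4,6,7)(5,11,8)(9,10,12)`. -/
def b : Equiv.Perm (Fin 12) :=
  List.formPerm [1, 2, 3] * List.formPerm [4, 6, 7] * List.formPerm [5, 11, 8] *
    List.formPerm [9, 10, 12]

/-- `ab = (1,2)(3,6)(4,11)(5,7)(8,10)(9,12)`, that is, first `a`, then `b`. -/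
def ab : Equiv.Perm (Fin 12) :=
  List.formPerm [1, 2] * List.formPerm [3, 6] * List.formPerm [4, 11] *
    List.formPerm [5, 7] * List.formPerm [8, 10] * List.formPerm [9, 12]

/-- The orbit of the unordered triple `{2, 7, 11}` under the cyclic group generated by `g`. -/
def tripleOrbit (g : Equiv.Perm (Fin 12)) : Set (Finset (Fin 12)) :=
  {s | ∃ h ∈ Subgroup.zpowers g, s = Finset.image h {2, 7, 11}}

/-- The orbit of the dessin `𝒟(β^{2,7,11})` under the cyclic subgroup generated by `σ`, for a given
action of the Galois group on the family of dessins. -/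
def dessinOrbit (r : Labelling) [MulAction G (family r)] (σ : G) : Set DessinClass :=
  Subtype.val '' MulAction.orbit (Subgroup.zpowers σ) (member r 2 7 11 distinct_2_7_11)

end EllipticDessins

end

noncomputable section

namespace EllipticDessins

/-! ### Elementary properties of `f` -/

/-! Three facts, proved independently, carry the theorem.

The Galois group is S₁₂. The numbers `s = 11 r_i` are algebraic integers with `s^11 (12 - s) =
11^12`. At a prime above 11 that contains `s`, the factor `12 - s` is a unit, so 11 divides the
ramification index and G has an element of order 11 (`eleven_dvd_card`). At a prime above 5 the only
coincidence among the reduced roots is one double root, and the prime is ramified, so a nontrivial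
inertia element is a transposition (`exists_isSwap_galPerm`). Since `f` has no real root, no root is
rational and no label is fixed by G. An 11-cycle on twelve letters, a transposition and the absence
of a common fixed letter force the full symmetric group; irreducibility of `f` follows from
transitivity.

The functions are clean Belyi functions because critical values collapse. The critical values of `f`
are 1 and 10/11; `β_{10,1}` takes 0 and 1 to 0 and has its critical point 10/11 above 1; `β_{1,1} =
4x(1 - x)` takes 0 and 1 to 0 and folds simply over 1 at 1/2. The projection of the cubic ramifies
only over three roots of `f`, which end at 0, and over ∞. Explicit local parameters turn this into
ramification orders (`isBelyi_polyFun`, `analyticOrderAt_belyiC`).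

A dessin remembers its triple (`injOn_tripleClass`). Let `h` be an isomorphism and `P = β_{1,1} ∘
β_{10,1} ∘ f`. Then `F = x ∘ h` is continuous on the affine curve and satisfies `P(F) = P(x)`; hence
it grows at most linearly in `x` and is holomorphic off finitely many fibres. Removable
singularities and Cauchy estimates make its even and odd parts under `y ↦ -y` polynomial data, the
odd part vanishes, and `F` is affine in `x` (`exists_affine_of_eval_eq`). An affine map preserving
`P` preserves `f` up to an affine change of values, hence respects the critical points 0 and 1 with
their multiplicities 10 and 1, and is the identity (`eq_one_of_eval_belyiC`). So `h` commutes with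
the projections and matches their finite branch points.

Thus the family is the set of 3-element subsets of the labels, G acts on it through S₁₂, and the
orbits become finite computations. The group A₅ enters by conjugation on a class of twelve 5-cycles;
explicit rotation matrices for `a` and `b` and a count of flags identify its image with the rotation
group of the dodecahedron. -/

theorem aeval_f {A : Type*} [Field A] [Algebra ℚ A] (x : A) :
    aeval x f = x ^ 12 - 12 / 11 * x ^ 11 + 1 := by
  simp [f]

theorem derivative_f : derivative f = C 12 * X ^ 10 * (X - 1) := by
  have h : C (12 / 11 : ℚ) * C 11 = C 12 := by rw [← C_mul]; norm_num
  simp only [f, derivative_add, derivative_sub, derivative_X_pow, derivative_C_mul,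
    derivative_one]
  norm_num
  linear_combination -X ^ 10 * h

theorem natDegree_f : f.natDegree = 12 := by
  unfold f; compute_degree!

theorem monic_f : f.Monic := by
  unfold f; monicity!

theorem f_ne_zero : f ≠ 0 := monic_f.ne_zero

/-- The critical points of `f` are 0 and 1, where its values 1 and 10/11 do not vanish. -/
theorem separable_f : f.Separable := by
  rw [separable_def, derivative_f]
  have h0 : IsCoprime f X := by
    rw [isCoprime_comm, irreducible_X.coprime_iff_not_dvd, X_dvd_iff]
    simp [f, coeff_X_pow]
  have h1 : IsCoprime f (X - 1) := by
    rw [isCoprime_comm, ← C_1, (irreducible_X_sub_C _).coprime_iff_not_dvd, dvd_iff_isRoot]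
    simp [f]; norm_num
  refine IsCoprime.mul_right (IsCoprime.mul_right ?_ h0.pow_right) h1
  exact isCoprime_of_isUnit_right (isUnit_C.2 (by norm_num))
where
  isCoprime_of_isUnit_right {p q : ℚ[X]} (h : IsUnit q) : IsCoprime p q := by
    obtain ⟨u, rfl⟩ := h
    exact ⟨0, ↑u⁻¹, by simp⟩

theorem card_rootSet_f : (f.rootSet ℂ).ncard = 12 := by
  rw [← Nat.card_coe_set_eq, Nat.card_eq_fintype_card,
    card_rootSet_eq_natDegree separable_f (IsAlgClosed.splits _), natDegree_f]

theorem mem_rootSet_f {x : ℂ} : x ∈ f.rootSet ℂ ↔ x ^ 12 - 12 / 11 * x ^ 11 + 1 = 0 := by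
  rw [mem_rootSet_of_ne f_ne_zero, aeval_f]

/-- `f` has no real roots. -/
theorem f_pos (x : ℝ) : 0 < x ^ 12 - 12 / 11 * x ^ 11 + 1 := by
  rcases le_total x 0 with h | h
  · have : x ^ 11 ≤ 0 := Odd.pow_nonpos (by decide) h
    have : 0 ≤ x ^ 12 := Even.pow_nonneg (by decide) x
    linarith
  · have h1 : x ^ 12 - 12 / 11 * x ^ 11 + 1 / 11 =
        (x - 1) ^ 2 / 11 * (11 * x ^ 10 + 10 * x ^ 9 + 9 * x ^ 8 + 8 * x ^ 7 + 7 * x ^ 6 +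
          6 * x ^ 5 + 5 * x ^ 4 + 4 * x ^ 3 + 3 * x ^ 2 + 2 * x + 1) := by ring
    have h2 : 0 ≤ (x - 1) ^ 2 / 11 * (11 * x ^ 10 + 10 * x ^ 9 + 9 * x ^ 8 + 8 * x ^ 7 +
        7 * x ^ 6 + 6 * x ^ 5 + 5 * x ^ 4 + 4 * x ^ 3 + 3 * x ^ 2 + 2 * x + 1) := by positivity
    linarith

/-! ### The symmetric group on twelve letters -/

section Perm

open Equiv

/-- A group of permutations of `p + 1` letters without a common fixed point, which contains a
transposition and whose order is divisible by the prime `p`, is the full symmetric group. -/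
theorem eq_top_of_isSwap_of_prime_dvd_card {α : Type*} [Fintype α] [DecidableEq α] {p : ℕ}
    (hp : p.Prime) (hp2 : 2 < p) (hα : Fintype.card α = p + 1) (H : Subgroup (Perm α))
    (hH : p ∣ Nat.card H)
    (hswap : ∃ σ ∈ H, σ.IsSwap) (hfix : ∀ z, ∃ σ ∈ H, σ z ≠ z) : H = ⊤ := by
  have := Fact.mk hp
  obtain ⟨⟨g, hgH⟩, hg⟩ := exists_prime_orderOf_dvd_card' p hH
  rw [Subgroup.orderOf_mk] at hg
  -- Two disjoint `p`-cycles would need `2p > p + 1` letters, so `g` is one cycle and misses exactly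
  -- one letter `z`.
  have hcyc : g.IsCycle := Perm.isCycle_of_prime_order' (by rwa [hg]) (by omega)
  have hsupp : g.support.card = p := by rw [← hcyc.orderOf, hg]
  obtain ⟨z, hz⟩ : ∃ z, g.supportᶜ = {z} := by
    rw [← Finset.card_eq_one, Finset.card_compl]; omega
  have hne : ∀ x, x ≠ z → g x ≠ x := by
    intro x hx
    rw [← Perm.mem_support]
    by_contra h
    rw [← Finset.mem_compl, hz, Finset.mem_singleton] at h
    exact hx h
  have hgz : g z = z := by
    rw [← Perm.notMem_support, ← Finset.mem_compl, hz, Finset.mem_singleton]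
  have htr : ∀ x y, x ≠ z → y ≠ z → ∃ h ∈ H, h x = y ∧ h z = z := by
    intro x y hx hy
    obtain ⟨n, hn⟩ := hcyc.exists_pow_eq (hne x hx) (hne y hy)
    refine ⟨g ^ n, H.pow_mem hgH n, hn, ?_⟩
    exact Function.IsFixedPt.perm_pow hgz n
  have hconj : ∀ h ∈ H, ∀ x y, swap x y ∈ H → swap (h x) (h y) ∈ H := by
    intro h hh x y hxy
    rw [swap_apply_apply]
    exact H.mul_mem (H.mul_mem hh hxy) (H.inv_mem hh)
  -- Together with an element moving `z`, transitivity of the stabilizer off `z` makes `H` doubly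
  -- transitive. One transposition in `H` can therefore be conjugated to every `(z u)`, and these
  -- generate.
  obtain ⟨w, hwH, hw⟩ := hfix z
  have htz : ∀ x, ∃ h ∈ H, h x = z := by
    intro x
    by_cases hx : x = z
    · exact ⟨1, H.one_mem, hx⟩
    · obtain ⟨h, hh, h1, -⟩ := htr x (w z) hx hw
      refine ⟨w⁻¹ * h, H.mul_mem (H.inv_mem hwH) hh, ?_⟩
      rw [Perm.mul_apply, h1, ← Perm.mul_apply, inv_mul_cancel, Perm.one_apply]
  obtain ⟨_, hσ, x, y, hxy, rfl⟩ := hswap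
  -- From here on the distinguished letter `z` is written `h x`.
  obtain ⟨h, hh, rfl⟩ := htz x
  have h1 := hconj h hh x y hσ
  have h2 : h y ≠ h x := fun e => hxy (h.injective e).symm
  have h3 : ∀ u, swap (h x) u ∈ H := by
    intro u
    by_cases hu : u = h x
    · rw [hu, swap_self]; exact H.one_mem
    · obtain ⟨k, hk, k1, k2⟩ := htr (h y) u h2 hu
      have := hconj k hk _ _ h1
      rwa [k1, k2] at this
  rw [eq_top_iff, ← Perm.closure_isSwap, Subgroup.closure_le]
  rintro _ ⟨u, v, huv, rfl⟩
  exact SubmonoidClass.swap_mem_trans H (swap_comm u (h x) ▸ h3 u) (h3 v)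

end Perm

/-! ### The splitting field -/

instance : IsSplittingField ℚ K f :=
  IntermediateField.adjoin_rootSet_isSplittingField (IsAlgClosed.splits _)

instance : FiniteDimensional ℚ K := IsSplittingField.finiteDimensional K f

instance : NumberField K where

instance : IsGalois ℚ K := IsGalois.of_separable_splitting_field separable_f

theorem coe_root (r : Labelling) (i : Fin 12) : (root r i : ℂ) = r i := rfl

theorem root_injective (r : Labelling) : Function.Injective (root r) := by
  intro i j h
  apply r.injective
  apply Subtype.ext
  rw [← coe_root, h, coe_root]

theorem root_eq (r : Labelling) (i : Fin 12) :
    root r i ^ 12 - 12 / 11 * root r i ^ 11 + 1 = 0 := by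
  have h := mem_rootSet_f.1 (r i).2
  rw [← coe_root] at h
  apply Subtype.ext
  push_cast
  exact h

theorem eq_root (r : Labelling) {x : K} (hx : x ^ 12 - 12 / 11 * x ^ 11 + 1 = 0) :
    ∃ i, x = root r i := by
  have h : (x : ℂ) ∈ f.rootSet ℂ := by
    rw [mem_rootSet_f]
    have := congrArg (fun y : K => (y : ℂ)) hx
    push_cast at this
    exact this
  obtain ⟨i, hi⟩ := r.surjective ⟨x, h⟩
  refine ⟨i, Subtype.ext ?_⟩
  rw [coe_root, hi]

theorem exists_perm (r : Labelling) (σ : G) (i : Fin 12) : ∃ j, σ (root r i) = root r j := by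
  apply eq_root
  have := congrArg σ (root_eq r i)
  simpa only [map_add, map_sub, map_mul, map_pow, map_div₀, map_ofNat, map_one, map_zero] using this

/-- The action of the Galois group on the labels of the roots. -/
def galPerm (r : Labelling) : G →* Equiv.Perm (Fin 12) where
  toFun σ := Equiv.ofBijective (fun i => (exists_perm r σ i).choose) (by
    rw [← Finite.injective_iff_bijective]
    intro i j h
    apply root_injective r
    apply σ.injective
    rw [(exists_perm r σ i).choose_spec, (exists_perm r σ j).choose_spec]
    exact congrArg _ h)
  map_one' := by
    ext i
    have h := (exists_perm r 1 i).choose_spec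
    exact congrArg _ (root_injective r h.symm)
  map_mul' σ τ := by
    ext i
    have h := (exists_perm r (σ * τ) i).choose_spec
    refine congrArg _ (root_injective r ?_)
    rw [Equiv.Perm.mul_apply, Equiv.ofBijective_apply, ← h, AlgEquiv.mul_apply,
      Equiv.ofBijective_apply, Equiv.ofBijective_apply, ← (exists_perm r σ _).choose_spec,
      ← (exists_perm r τ _).choose_spec]

theorem apply_root (r : Labelling) (σ : G) (i : Fin 12) :
    σ (root r i) = root r (galPerm r σ i) := (exists_perm r σ i).choose_spec

theorem galPerm_injective (r : Labelling) : Function.Injective (galPerm r) := by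
  rw [injective_iff_map_eq_one]
  intro σ hσ
  have h : ((σ : K →ₐ[ℚ] K)) = AlgHom.id ℚ K := by
    refine AlgHom.ext_of_adjoin_eq_top (IsSplittingField.adjoin_rootSet K f) fun x hx => ?_
    rw [mem_rootSet_of_ne f_ne_zero, aeval_f] at hx
    obtain ⟨i, rfl⟩ := eq_root r hx
    refine (apply_root r σ i).trans ?_
    rw [hσ]
    rfl
  ext x
  exact congrArg Subtype.val (DFunLike.congr_fun h x)

/-- In a Galois extension a root fixed by the whole group is rational, hence real, and `f` is
positive on the real line. -/
theorem exists_apply_root_ne (r : Labelling) (i : Fin 12) : ∃ σ : G, σ (root r i) ≠ root r i := by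
  by_contra! h
  obtain ⟨q, hq⟩ := IntermediateField.mem_bot.1
    ((IsGalois.mem_bot_iff_fixed (F := ℚ) (root r i)).2 h)
  have h1 := root_eq r i
  have h2 : ((q : ℝ) ^ 12 - 12 / 11 * (q : ℝ) ^ 11 + 1) = 0 := by
    rw [← hq] at h1
    have : algebraMap ℚ K (q ^ 12 - 12 / 11 * q ^ 11 + 1) = 0 := by
      simpa only [map_add, map_sub, map_mul, map_pow, map_div₀, map_ofNat, map_one] using h1
    rw [map_eq_zero] at this
    have := congrArg (Rat.cast : ℚ → ℝ) this
    push_cast at this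
    exact this
  exact (f_pos q).ne' h2

section GaloisGroup

open NumberField

/-! ### The Galois group -/

theorem isIntegral_eleven_mul_root (r : Labelling) (i : Fin 12) :
    IsIntegral ℤ (11 * root r i) := by
  -- This polynomial is `11^12 f(X / 11)`; the scaling clears the denominator 11.
  refine ⟨X ^ 12 - C 12 * X ^ 11 + C (11 ^ 12), by monicity!, ?_⟩
  have h := root_eq r i
  rw [eval₂_add, eval₂_sub, eval₂_mul, eval₂_X_pow, eval₂_X_pow, eval₂_C, eval₂_C, map_pow,
    map_ofNat, map_ofNat]
  linear_combination 11 ^ 12 * h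

/-- The algebraic integer `11 r_i`. -/
def introot (r : Labelling) (i : Fin 12) : 𝓞 K := ⟨11 * root r i, isIntegral_eleven_mul_root r i⟩

theorem coe_introot (r : Labelling) (i : Fin 12) : (introot r i : K) = 11 * root r i := rfl

theorem introot_injective (r : Labelling) : Function.Injective (introot r) := by
  intro i j h
  have h := congrArg (fun x : 𝓞 K => (x : K)) h
  simp only [coe_introot] at h
  exact root_injective r (mul_left_cancel₀ (by norm_num) h)

theorem introot_eq (r : Labelling) (i : Fin 12) :
    introot r i ^ 12 - 12 * introot r i ^ 11 + 11 ^ 12 = 0 := by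
  apply RingOfIntegers.ext
  have h := root_eq r i
  simp only [map_add, map_sub, map_mul, map_pow, map_ofNat, map_zero, coe_introot]
  linear_combination 11 ^ 12 * h

theorem smul_introot (r : Labelling) (σ : G) (i : Fin 12) :
    σ • introot r i = introot r (galPerm r σ i) := by
  apply RingOfIntegers.ext
  change σ (11 * root r i) = 11 * root r (galPerm r σ i)
  rw [map_mul, apply_root, map_ofNat]

/-- The monic integral polynomial with roots `11 r_i`. -/
def intPoly (R : Type*) [CommRing R] : R[X] := X ^ 12 - C 12 * X ^ 11 + C (11 ^ 12)

theorem intPoly_monic (R : Type*) [CommRing R] : (intPoly R).Monic := by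
  nontriviality R
  unfold intPoly; monicity!

theorem map_intPoly {R S : Type*} [CommRing R] [CommRing S] (φ : R →+* S) :
    (intPoly R).map φ = intPoly S := by
  simp only [intPoly, Polynomial.map_add, Polynomial.map_sub, Polynomial.map_mul,
    Polynomial.map_pow, map_X, map_C, map_pow, map_ofNat, Polynomial.map_ofNat]

theorem eval_intPoly {R : Type*} [CommRing R] (x : R) :
    eval x (intPoly R) = x ^ 12 - 12 * x ^ 11 + 11 ^ 12 := by
  rw [intPoly, eval_add, eval_sub, eval_mul, eval_pow, eval_pow, eval_X, eval_C, eval_C]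

theorem derivative_intPoly (R : Type*) [CommRing R] :
    derivative (intPoly R) = 12 * X ^ 11 - 132 * X ^ 10 := by
  rw [intPoly, derivative_add, derivative_sub, derivative_C_mul, derivative_C, derivative_X_pow,
    derivative_X_pow]
  simp only [map_ofNat, map_natCast]
  push_cast
  ring

theorem derivative_derivative_intPoly (R : Type*) [CommRing R] :
    derivative (derivative (intPoly R)) = 132 * X ^ 10 - 1320 * X ^ 9 := by
  rw [derivative_intPoly, derivative_sub, derivative_mul, derivative_mul,
    derivative_X_pow, derivative_X_pow, derivative_ofNat, derivative_ofNat]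
  simp only [map_ofNat, map_natCast]
  push_cast
  ring

theorem intPoly_eq_prod (r : Labelling) :
    intPoly (𝓞 K) = ∏ i, (X - C (introot r i)) := by
  refine eq_of_monic_of_dvd_of_natDegree_le
    (monic_prod_of_monic _ _ fun i _ => monic_X_sub_C _) (intPoly_monic _) ?_ ?_
  · have h : Multiset.map (introot r) Finset.univ.val ≤ (intPoly (𝓞 K)).roots := by
      rw [Multiset.le_iff_subset ((Multiset.nodup_map_iff_of_injective (introot_injective r)).2
        Finset.univ.nodup)]
      intro x hx
      obtain ⟨i, -, rfl⟩ := Multiset.mem_map.1 hx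
      rw [mem_roots (intPoly_monic _).ne_zero]
      exact (eval_intPoly _).trans (introot_eq r i)
    rw [← Multiset.prod_X_sub_C_dvd_iff_le_roots (intPoly_monic _).ne_zero, Multiset.map_map] at h
    exact h
  · rw [natDegree_prod_of_monic _ _ fun i _ => monic_X_sub_C _]
    simp only [natDegree_X_sub_C, Finset.sum_const, Finset.card_univ, Fintype.card_fin,
      smul_eq_mul, mul_one]
    unfold intPoly
    compute_degree

theorem intPoly_eq_prod_map (r : Labelling) {k : Type*} [CommRing k] (φ : 𝓞 K →+* k) :
    intPoly k = ∏ i, (X - C (φ (introot r i))) := by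
  rw [← map_intPoly φ, intPoly_eq_prod r, Polynomial.map_prod]
  simp

/-! ### Inertia groups and ramification indices at primes of the splitting field -/

section Inertia

variable (p : ℕ) [Fact p.Prime] (Q : Ideal (𝓞 K)) [Q.IsPrime]
  [Q.LiesOver (Ideal.span {(p : ℤ)})]

/-- For a Galois extension the order of the inertia group is the ramification index, which in a
Dedekind domain is the exponent of `Q` in `(p)`. Divisibility in the ideal group thereby yields
elements of the Galois group. -/
theorem card_inertia_eq_multiplicity :
    Nat.card (Q.inertia G) = multiplicity Q (Ideal.span {(p : 𝓞 K)}) := by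
  have hp : p.Prime := Fact.out
  have : (Ideal.span {(p : ℤ)}).IsPrime :=
    (Ideal.span_singleton_prime (by exact_mod_cast hp.ne_zero)).2
      (Nat.prime_iff_prime_int.1 hp)
  have hmap : Ideal.map (algebraMap ℤ (𝓞 K)) (Ideal.span {(p : ℤ)}) = Ideal.span {(p : 𝓞 K)} := by
    rw [Ideal.map_span, Set.image_singleton, map_natCast]
  rw [Ideal.card_inertia_eq_ramificationIdxIn (Ideal.span {(p : ℤ)}),
    Ideal.ramificationIdxIn_eq_ramificationIdx (Ideal.span {(p : ℤ)}) Q G,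
    Ideal.IsDedekindDomain.ramificationIdx_eq_multiplicity (Ideal.span {(p : ℤ)}), hmap]
  rw [hmap, Ne, Ideal.span_singleton_eq_bot]
  exact_mod_cast hp.ne_zero

omit [Fact p.Prime] [Q.IsPrime] in
theorem natCast_mem_of_liesOver : (p : 𝓞 K) ∈ Q := by
  have h : (p : ℤ) ∈ Q.under ℤ := by
    rw [← Ideal.over_def Q (Ideal.span {(p : ℤ)})]
    exact Ideal.mem_span_singleton_self _
  simpa [Ideal.mem_comap] using h

theorem charP_quotient_of_liesOver : CharP (𝓞 K ⧸ Q) p := by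
  have hp : p.Prime := Fact.out
  have : Nontrivial (𝓞 K ⧸ Q) := inferInstance
  refine (CharP.charP_iff_prime_eq_zero hp).2 ?_
  rw [← map_natCast (Ideal.Quotient.mk Q), Ideal.Quotient.eq_zero_iff_mem]
  exact natCast_mem_of_liesOver p Q

include p in
omit [Q.IsPrime] in
theorem ne_bot_of_liesOver : Q ≠ ⊥ := by
  rintro rfl
  have := natCast_mem_of_liesOver p (⊥ : Ideal (𝓞 K))
  rw [Ideal.mem_bot, Nat.cast_eq_zero] at this
  exact (Fact.out : p.Prime).ne_zero this

end Inertia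

theorem exists_liesOver (p : ℕ) [Fact p.Prime] :
    ∃ Q : Ideal (𝓞 K), Q.IsPrime ∧ Q.LiesOver (Ideal.span {(p : ℤ)}) := by
  have hp : Prime (p : ℤ) := Nat.prime_iff_prime_int.1 Fact.out
  have : (Ideal.span {(p : ℤ)}).IsMaximal :=
    PrincipalIdealRing.isMaximal_of_irreducible hp.irreducible
  obtain ⟨Q, h1, h2⟩ := Ideal.exists_maximal_ideal_liesOver_of_isIntegral (S := 𝓞 K)
    (Ideal.span {(p : ℤ)})
  exact ⟨Q, h1.isPrime, h2⟩

theorem nonempty_labelling : Nonempty Labelling :=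
  ⟨Fintype.equivOfCardEq (by
    rw [Fintype.card_fin, ← Nat.card_eq_fintype_card, Nat.card_coe_set_eq, card_rootSet_f])⟩

/-- The Newton polygon at 11 has a segment of slope with denominator 11: comparing exponents of `Q`
in `s^11 (12 - s) = 11^12` gives `11 v(s) = 12 e`, hence 11 divides `e`, the order of inertia. -/
theorem eleven_dvd_card : 11 ∣ Nat.card G := by
  have : Fact (Nat.Prime 11) := ⟨by norm_num⟩
  obtain ⟨r⟩ := nonempty_labelling
  obtain ⟨Q, hQ, hQ'⟩ := exists_liesOver 11
  have hQp : Prime Q := Ideal.prime_of_isPrime (ne_bot_of_liesOver 11 Q) hQ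
  have h11 := natCast_mem_of_liesOver 11 Q
  have hchar := charP_quotient_of_liesOver 11 Q
  obtain ⟨i, hi⟩ : ∃ i, introot r i ∈ Q := by
    have h := congrArg (eval 0) (intPoly_eq_prod r)
    have h1 : ∏ i, (0 - introot r i) ∈ Q := by
      have : eval 0 (intPoly (𝓞 K)) ∈ Q := by
        rw [eval_intPoly]
        simpa using Ideal.pow_mem_of_mem Q h11 12 (by norm_num)
      rw [h, eval_prod] at this
      simpa using this
    obtain ⟨i, -, hi⟩ := (Ideal.IsPrime.prod_mem_iff).1 h1
    exact ⟨i, by simpa using hi⟩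
  set s := introot r i with hs
  -- Otherwise `(12 - s) + s - 11 = 1` would lie in `Q`.
  have h12 : 12 - s ∉ Q := by
    intro h
    have h2 : (1 : 𝓞 K) ∈ Q := by
      have := Q.sub_mem (Q.add_mem h hi) h11
      norm_num at this
      exact (Ideal.ne_top_iff_one Q).1 hQ.ne_top this |>.elim
    exact (Ideal.ne_top_iff_one Q).1 hQ.ne_top h2
  have hmul : Ideal.span {s} ^ 11 * Ideal.span {12 - s} = Ideal.span {((11 : ℕ) : 𝓞 K)} ^ 12 := by
    rw [Ideal.span_singleton_pow, Ideal.span_singleton_mul_span_singleton,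
      Ideal.span_singleton_pow]
    congr 2
    have := introot_eq r i
    push_cast
    linear_combination -this
  have hne : Ideal.span {((11 : ℕ) : 𝓞 K)} ≠ 0 := by
    rw [Ne, Ideal.zero_eq_bot, Ideal.span_singleton_eq_bot]
    norm_num
  have hne2 : Ideal.span {((11 : ℕ) : 𝓞 K)} ^ 12 ≠ 0 := pow_ne_zero _ hne
  have hs0 : Ideal.span {s} ≠ 0 := by
    intro h
    rw [← hmul, h] at hne2
    simp at hne2
  have key := congrArg (multiplicity Q) hmul
  rw [multiplicity_mul hQp (FiniteMultiplicity.of_prime_left hQp (hmul ▸ hne2)),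
    FiniteMultiplicity.multiplicity_pow hQp (FiniteMultiplicity.of_prime_left hQp hs0),
    FiniteMultiplicity.multiplicity_pow hQp (FiniteMultiplicity.of_prime_left hQp hne),
    multiplicity_eq_zero.2 (fun h => h12 (Ideal.dvd_span_singleton.1 h)), add_zero,
    ← card_inertia_eq_multiplicity 11 Q] at key
  have h1 : 11 ∣ Nat.card (Q.inertia G) :=
    (Nat.Coprime.dvd_mul_left (by norm_num : Nat.Coprime 11 12)).1 ⟨_, key.symm⟩
  exact h1.trans (Subgroup.card_subgroup_dvd_card _)

/-! ### The roots modulo a prime above 5, and the transposition -/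

section Five

variable {k : Type*} [Field k] [CharP k 5] {s : Fin 12 → k}

theorem natCast_ne_zero_of_not_five_dvd {n : ℕ} (h : ¬ 5 ∣ n) : (n : k) ≠ 0 := by
  rwa [Ne, CharP.cast_eq_zero_iff k 5]

/-- The point 11 is always critical, and the value there is `10 * 11^11`, which vanishes modulo 5.
Removing the factor of one root equal to 11, the derivative at 11 is the value of the remaining
product, so a second factor vanishes. -/
theorem exists_two_roots_mod_five (hs : intPoly k = ∏ i, (X - C (s i))) :
    ∃ i j, i ≠ j ∧ s i = 11 ∧ s j = 11 := by
  have h5 : (5 : k) = 0 := by exact_mod_cast CharP.cast_eq_zero k 5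
  have h0 : eval 11 (intPoly k) = 0 := by
    rw [eval_intPoly]
    linear_combination 2 * 11 ^ 11 * h5
  rw [hs, eval_prod, Finset.prod_eq_zero_iff] at h0
  obtain ⟨i, -, hi⟩ := h0
  have hi : s i = 11 := by
    rw [eval_sub, eval_X, eval_C, sub_eq_zero] at hi
    exact hi.symm
  have h1 : eval 11 (derivative (intPoly k)) = 0 := by
    rw [derivative_intPoly]
    simp only [eval_sub, eval_mul, eval_pow, eval_X, eval_ofNat]
    ring
  rw [hs, ← Finset.mul_prod_erase _ _ (Finset.mem_univ i), derivative_mul] at h1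
  simp only [hi, derivative_sub, derivative_X, derivative_C, sub_zero, one_mul, eval_add, eval_mul,
    eval_sub, eval_X, eval_C, sub_self, zero_mul, add_zero, eval_prod] at h1
  obtain ⟨j, hj, hj'⟩ := Finset.prod_eq_zero_iff.1 h1
  exact ⟨i, j, (Finset.ne_of_mem_erase hj).symm, hi, (sub_eq_zero.1 hj').symm⟩

/-- A multiple root is a zero of `12 x^10 (x - 11)`; in characteristic 5 the constant 12 is nonzero,
and 0 is not a root because the constant term is `11^12`. -/
theorem eq_eleven_of_double_root (hs : intPoly k = ∏ i, (X - C (s i))) {i j : Fin 12}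
    (hij : i ≠ j) (h : s i = s j) : s i = 11 := by
  have h0 : eval (s i) (intPoly k) = 0 := by
    rw [hs, eval_prod]
    exact Finset.prod_eq_zero (Finset.mem_univ i) (by simp)
  have h1 : eval (s i) (derivative (intPoly k)) = 0 := by
    rw [hs, ← Finset.mul_prod_erase _ _ (Finset.mem_univ i), derivative_mul]
    simp only [derivative_sub, derivative_X, derivative_C, sub_zero, one_mul, eval_add, eval_mul,
      eval_sub, eval_X, eval_C, sub_self, zero_mul, add_zero, eval_prod]
    exact Finset.prod_eq_zero (Finset.mem_erase.2 ⟨hij.symm, Finset.mem_univ j⟩) (by simp [h])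
  have h2 : ((12 : ℕ) : k) * s i ^ 10 * (s i - 11) = 0 := by
    rw [derivative_intPoly] at h1
    simp only [eval_sub, eval_mul, eval_pow, eval_X, eval_ofNat] at h1
    push_cast
    linear_combination h1
  have h3 : s i ≠ 0 := by
    intro h
    rw [h] at h0
    have h11 : ((11 : ℕ) : k) = 0 := by simpa [eval_intPoly] using h0
    exact natCast_ne_zero_of_not_five_dvd (by norm_num) h11
  have h4 : ((12 : ℕ) : k) ≠ 0 := natCast_ne_zero_of_not_five_dvd (by norm_num)
  rw [mul_eq_zero, mul_eq_zero, pow_eq_zero_iff (by norm_num)] at h2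
  exact sub_eq_zero.1 ((h2.resolve_left fun h => h.elim h4 h3))

/-- The second derivative at 11 is `12 * 11^10`, nonzero in characteristic 5. -/
theorem not_triple_root (hs : intPoly k = ∏ i, (X - C (s i))) {i j l : Fin 12}
    (hij : i ≠ j) (hil : i ≠ l) (hjl : j ≠ l) (hi : s i = 11) (hj : s j = 11) : s l ≠ 11 := by
  intro hl
  have h1 : eval 11 (derivative (derivative (intPoly k))) = 0 := by
    have h2 : (X - C 11) ^ 3 ∣ intPoly k := by
      rw [hs, ← Finset.mul_prod_erase _ _ (Finset.mem_univ i),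
        ← Finset.mul_prod_erase _ _ (Finset.mem_erase.2 ⟨hij.symm, Finset.mem_univ j⟩),
        ← Finset.mul_prod_erase _ _ (Finset.mem_erase.2 ⟨hjl.symm, Finset.mem_erase.2
          ⟨hil.symm, Finset.mem_univ l⟩⟩), hi, hj, hl]
      exact ⟨_, by rw [pow_three, mul_assoc, mul_assoc]⟩
    obtain ⟨R, hR⟩ := h2
    rw [hR]
    simp [derivative_mul, derivative_pow]
  have h2 : ((12 * 11 ^ 10 : ℕ) : k) = 0 := by
    rw [derivative_derivative_intPoly] at h1
    simp only [eval_sub, eval_mul, eval_pow, eval_X, eval_ofNat] at h1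
    push_cast
    linear_combination h1
  exact natCast_ne_zero_of_not_five_dvd (by norm_num) h2

end Five

/-- An inertia element does not change roots modulo `Q`, so it can only move roots which collide
with another one, and exactly two do. A nontrivial one exists because two factors of `∏ (11 - 11
r_i) = 5 * 2 * 11^11` lie in `Q`, so that `Q²` divides 5. -/
theorem exists_isSwap_galPerm (r : Labelling) : ∃ σ : G, (galPerm r σ).IsSwap := by
  have : Fact (Nat.Prime 5) := ⟨by norm_num⟩
  obtain ⟨Q, hQ, hQ'⟩ := exists_liesOver 5
  have hQ0 := ne_bot_of_liesOver 5 Q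
  have hQp : Prime Q := Ideal.prime_of_isPrime hQ0 hQ
  have hmax : Q.IsMaximal := hQ.isMaximal hQ0
  have hchar := charP_quotient_of_liesOver 5 Q
  let _ : Field (𝓞 K ⧸ Q) := Ideal.Quotient.field Q
  set s : Fin 12 → 𝓞 K ⧸ Q := fun i => Ideal.Quotient.mk Q (introot r i) with hs
  have hprod : intPoly (𝓞 K ⧸ Q) = ∏ i, (X - C (s i)) := intPoly_eq_prod_map r _
  have hcard : Nat.card (Q.inertia G) ≠ 1 := by
    obtain ⟨i, j, hij, hi, hj⟩ := exists_two_roots_mod_five hprod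
    have hmem : ∀ i, s i = 11 → 11 - introot r i ∈ Q := by
      intro i hi
      rw [← Ideal.Quotient.eq_zero_iff_mem, map_sub, map_ofNat]
      exact sub_eq_zero.2 hi.symm
    have hprod2 : Ideal.span {((5 : ℕ) : 𝓞 K)} * Ideal.span {((2 * 11 ^ 11 : ℕ) : 𝓞 K)} =
        ∏ i, Ideal.span {11 - introot r i} := by
      rw [Ideal.span_singleton_mul_span_singleton, Ideal.prod_span_singleton]
      congr 2
      have := congrArg (eval 11) (intPoly_eq_prod r)
      rw [eval_prod] at this
      simp only [eval_sub, eval_X, eval_C] at this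
      rw [← this, eval_intPoly]
      norm_num
    have hdvd : Q ^ 2 ∣ Ideal.span {((5 : ℕ) : 𝓞 K)} * Ideal.span {((2 * 11 ^ 11 : ℕ) : 𝓞 K)} := by
      rw [hprod2, ← Finset.mul_prod_erase _ _ (Finset.mem_univ i),
        ← Finset.mul_prod_erase _ _ (Finset.mem_erase.2 ⟨hij.symm, Finset.mem_univ j⟩),
        ← mul_assoc, pow_two]
      exact Dvd.dvd.mul_right (mul_dvd_mul (Ideal.dvd_span_singleton.2 (hmem i hi))
        (Ideal.dvd_span_singleton.2 (hmem j hj))) _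
    -- The cofactor `2 * 11^11` is prime to 5, so both powers of `Q` divide 5 itself.
    have h2 := hQp.pow_dvd_of_dvd_mul_right 2 (by
      rw [Ideal.dvd_span_singleton, ← Ideal.Quotient.eq_zero_iff_mem, map_natCast]
      exact natCast_ne_zero_of_not_five_dvd (by norm_num)) hdvd
    have hfin : FiniteMultiplicity Q (Ideal.span {((5 : ℕ) : 𝓞 K)}) :=
      FiniteMultiplicity.of_prime_left hQp (by
        rw [Ne, Ideal.zero_eq_bot, Ideal.span_singleton_eq_bot]
        norm_num)
    have := hfin.le_multiplicity_of_pow_dvd h2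
    rw [← card_inertia_eq_multiplicity 5 Q] at this
    omega
  obtain ⟨σ, hσQ, hσ⟩ : ∃ σ ∈ Q.inertia G, σ ≠ 1 := by
    by_contra! h
    exact hcard (Subgroup.card_eq_one.2 ((Subgroup.eq_bot_iff_forall _).2 h))
  have hsσ : ∀ l, s (galPerm r σ l) = s l := by
    intro l
    have := hσQ (introot r l)
    rw [smul_introot] at this
    exact Ideal.Quotient.eq.2 this
  set π := galPerm r σ with hπ
  have hmoved : ∀ l, π l ≠ l → s l = 11 := fun l hl =>
    eq_eleven_of_double_root hprod hl.symm (hsσ l).symm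
  obtain ⟨i, hi⟩ : ∃ i, π i ≠ i := by
    by_contra! h
    exact hσ (galPerm_injective r (by rw [map_one]; exact Equiv.ext h))
  have hi' := hmoved i hi
  have hπi : s (π i) = 11 := (hsσ i).trans hi'
  have honly : ∀ l, π l ≠ l → l = i ∨ l = π i := by
    intro l hl
    by_contra! h
    exact not_triple_root hprod hi.symm h.1.symm h.2.symm hi' hπi (hmoved l hl)
  have hππ : π (π i) = i := by
    have h1 : π (π i) ≠ π i := fun h => hi (π.injective h)
    rcases honly (π (π i)) (fun h => h1 (π.injective h)) with h | h
    · exact h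
    · exact (h1 h).elim
  refine ⟨σ, i, π i, hi.symm, Equiv.ext fun l => ?_⟩
  by_cases h1 : l = i
  · rw [h1, Equiv.swap_apply_left]
  by_cases h2 : l = π i
  · rw [h2, Equiv.swap_apply_right, hππ]
  rw [Equiv.swap_apply_of_ne_of_ne h1 h2]
  by_contra h
  exact (honly l h).elim h1 h2

theorem galPerm_surjective (r : Labelling) : Function.Surjective (galPerm r) := by
  rw [← MonoidHom.range_eq_top]
  refine eq_top_of_isSwap_of_prime_dvd_card (p := 11) (by norm_num) (by norm_num) rfl _ ?_ ?_ ?_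
  · rw [← Nat.card_congr (MonoidHom.ofInjective (galPerm_injective r)).toEquiv]
    exact eleven_dvd_card
  · obtain ⟨σ, hσ⟩ := exists_isSwap_galPerm r
    exact ⟨_, ⟨σ, rfl⟩, hσ⟩
  · intro z
    obtain ⟨σ, hσ⟩ := exists_apply_root_ne r z
    refine ⟨_, ⟨σ, rfl⟩, fun h => hσ ?_⟩
    rw [apply_root, h]

/-- The Galois group of `f` is the full group of permutations of its roots. -/
def galEquiv (r : Labelling) : G ≃* Equiv.Perm (Fin 12) :=
  MulEquiv.ofBijective (galPerm r) ⟨galPerm_injective r, galPerm_surjective r⟩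

theorem galEquiv_apply (r : Labelling) (σ : G) (i : Fin 12) :
    σ (root r i) = root r (galEquiv r σ i) := apply_root r σ i

/-- All twelve roots are Galois conjugate to one of them, so its minimal polynomial has degree at
least 12. -/
theorem irreducible_f : Irreducible f := by
  obtain ⟨r⟩ := nonempty_labelling
  have hint : IsIntegral ℚ (root r 0) := IsIntegral.of_finite ℚ _
  have hroot : ∀ i, root r i ∈ (minpoly ℚ (root r 0)).rootSet K := by
    intro i
    rw [mem_rootSet_of_ne (minpoly.ne_zero hint)]
    have h := apply_root r ((galEquiv r).symm (Equiv.swap 0 i)) 0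
    have h2 : galPerm r ((galEquiv r).symm (Equiv.swap 0 i)) = Equiv.swap 0 i :=
      (galEquiv r).apply_symm_apply _
    rw [h2, Equiv.swap_apply_left] at h
    rw [← h, ← AlgEquiv.coe_toAlgHom, aeval_algHom_apply, minpoly.aeval, map_zero]
  have hdeg : 12 ≤ (minpoly ℚ (root r 0)).natDegree := by
    calc 12 = (Finset.univ.map ⟨root r, root_injective r⟩).card := by simp
      _ ≤ ((minpoly ℚ (root r 0)).rootSet K).ncard := by
        rw [← Set.ncard_coe_finset]
        refine Set.ncard_le_ncard ?_ (rootSet_finite _ _)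
        intro x hx
        simp only [Finset.coe_map, Function.Embedding.coeFn_mk, Finset.coe_univ,
          Set.image_univ, Set.mem_range] at hx
        obtain ⟨i, rfl⟩ := hx
        exact hroot i
      _ ≤ _ := by
        exact ncard_rootSet_le _ _
  have h : f = minpoly ℚ (root r 0) :=
    eq_of_monic_of_dvd_of_natDegree_le (minpoly.monic hint) monic_f
      (minpoly.dvd ℚ _ (by rw [aeval_f, root_eq])) (by rw [natDegree_f]; exact hdeg)
  rw [h]
  exact minpoly.irreducible hint

end GaloisGroup

/-! ### The permutations `a`, `b`, `ab` -/

theorem a_pow_five : a ^ 5 = 1 := by decide +kernel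
theorem b_pow_three : b ^ 3 = 1 := by decide +kernel
theorem ab_pow_two : ab ^ 2 = 1 := by decide +kernel
theorem ab_eq : ab = b * a := by decide +kernel

theorem mem_zpowers_iff_exists_lt {H : Type*} [Group H] {g h : H} {k : ℕ} (hk : 0 < k)
    (hg : g ^ k = 1) : h ∈ Subgroup.zpowers g ↔ ∃ n < k, h = g ^ n := by
  constructor
  · intro hh
    have hfin : IsOfFinOrder g := isOfFinOrder_iff_pow_eq_one.2 ⟨k, hk, hg⟩
    obtain ⟨n, hn⟩ := (hfin.mem_powers_iff_mem_zpowers).2 hh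
    refine ⟨n % k, Nat.mod_lt _ hk, ?_⟩
    rw [← hn]
    conv_lhs => rw [← Nat.mod_add_div n k]
    simp only [pow_add, pow_mul, hg, one_pow, mul_one]
  · rintro ⟨n, -, rfl⟩
    exact Subgroup.pow_mem _ (Subgroup.mem_zpowers g) n

/-- Replaces the cyclic group by finitely many powers, so that the orbit lists can be checked by
evaluation. -/
theorem tripleOrbit_eq {g : Equiv.Perm (Fin 12)} {k : ℕ} (hk : 0 < k) (hg : g ^ k = 1) :
    tripleOrbit g =
      (((Finset.range k).image fun n => Finset.image (⇑(g ^ n)) {2, 7, 11} :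
        Finset (Finset (Fin 12))) : Set (Finset (Fin 12))) := by
  ext s
  simp only [tripleOrbit, Set.mem_ofPred_eq, mem_zpowers_iff_exists_lt hk hg, Finset.coe_image,
    Finset.coe_range, Set.mem_image, Set.mem_Iio]
  constructor
  · rintro ⟨_, ⟨n, hn, rfl⟩, rfl⟩
    exact ⟨n, hn, rfl⟩
  · rintro ⟨n, hn, rfl⟩
    exact ⟨_, ⟨n, hn, rfl⟩, rfl⟩

theorem tripleOrbit_a :
    tripleOrbit a = {{2, 7, 11}, {3, 7, 8}, {4, 8, 9}, {5, 9, 10}, {6, 10, 11}} := by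
  rw [tripleOrbit_eq (by norm_num) a_pow_five]
  have h : ((Finset.range 5).image fun n => Finset.image (⇑(a ^ n)) ({2, 7, 11} : Finset (Fin 12))) =
    {{2, 7, 11}, {3, 7, 8}, {4, 8, 9}, {5, 9, 10}, {6, 10, 11}} := by decide +kernel
  rw [h]
  simp

theorem tripleOrbit_b : tripleOrbit b = {{2, 7, 11}, {3, 4, 8}, {1, 5, 6}} := by
  rw [tripleOrbit_eq (by norm_num) b_pow_three]
  have h : ((Finset.range 3).image fun n => Finset.image (⇑(b ^ n)) ({2, 7, 11} : Finset (Fin 12))) =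
    {{2, 7, 11}, {3, 4, 8}, {1, 5, 6}} := by decide +kernel
  rw [h]
  simp

theorem tripleOrbit_ab : tripleOrbit ab = {{2, 7, 11}, {1, 4, 5}} := by
  rw [tripleOrbit_eq (by norm_num) ab_pow_two]
  have h : ((Finset.range 2).image fun n => Finset.image (⇑(ab ^ n)) ({2, 7, 11} : Finset (Fin 12))) =
    {{2, 7, 11}, {1, 4, 5}} := by decide +kernel
  rw [h]
  simp

/-! ### The embedding of `A₅` -/

/-- A conjugacy class of `5`-cycles in `A₅`, labelled by the faces of the dodecahedron. -/
def fiveCycle : Fin 12 → Equiv.Perm (Fin 5) :=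
  ![List.formPerm [0, 4, 3, 2, 1], List.formPerm [0, 1, 2, 3, 4], List.formPerm [0, 4, 1, 3, 2],
    List.formPerm [0, 2, 4, 3, 1], List.formPerm [0, 4, 2, 1, 3], List.formPerm [0, 3, 2, 4, 1],
    List.formPerm [0, 2, 1, 4, 3], List.formPerm [0, 1, 4, 2, 3], List.formPerm [0, 3, 4, 1, 2],
    List.formPerm [0, 2, 3, 1, 4], List.formPerm [0, 1, 3, 4, 2], List.formPerm [0, 3, 1, 2, 4]]

theorem fiveCycle_injective : Function.Injective fiveCycle := by
  unfold Function.Injective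
  decide +kernel

/-- The 24 five-cycles of A₅ fall into two conjugacy classes of twelve; the table lists one of them.
A five-cycle stands for the rotation by a fixed angle about the outward axis of its face, so
opposite faces carry inverse cycles. -/
theorem exists_conj_fiveCycle : ∀ g : alternatingGroup (Fin 5), ∀ i, ∃ j,
    (g : Equiv.Perm (Fin 5)) * fiveCycle i * (g : Equiv.Perm (Fin 5))⁻¹ = fiveCycle j := by
  have h : ∀ g : Equiv.Perm (Fin 5), Equiv.Perm.sign g = 1 → ∀ i, ∃ j,
      g * fiveCycle i * g⁻¹ = fiveCycle j := by decide +kernel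
  exact fun g => h g (Equiv.Perm.mem_alternatingGroup.1 g.2)

/-- The action of `A₅` on a conjugacy class of `5`-cycles. -/
def theta : alternatingGroup (Fin 5) →* Equiv.Perm (Fin 12) where
  toFun g := Equiv.ofBijective (fun i => (exists_conj_fiveCycle g i).choose) (by
    rw [← Finite.injective_iff_bijective]
    intro i j h
    apply fiveCycle_injective
    have h' : fiveCycle (exists_conj_fiveCycle g i).choose =
      fiveCycle (exists_conj_fiveCycle g j).choose := congrArg _ h
    rw [← (exists_conj_fiveCycle g i).choose_spec, ← (exists_conj_fiveCycle g j).choose_spec] at h'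
    exact mul_left_cancel (mul_right_cancel h'))
  map_one' := by
    ext i
    have h := (exists_conj_fiveCycle 1 i).choose_spec
    refine congrArg _ (fiveCycle_injective (h.symm.trans ?_))
    simp
  map_mul' g h := by
    ext i
    refine congrArg _ (fiveCycle_injective ?_)
    rw [Equiv.Perm.mul_apply, Equiv.ofBijective_apply,
      ← (exists_conj_fiveCycle (g * h) i).choose_spec, Equiv.ofBijective_apply,
      Equiv.ofBijective_apply, ← (exists_conj_fiveCycle g _).choose_spec,
      ← (exists_conj_fiveCycle h i).choose_spec]
    simp [mul_assoc]

theorem conj_fiveCycle (g : alternatingGroup (Fin 5)) (i : Fin 12) :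
    (g : Equiv.Perm (Fin 5)) * fiveCycle i * (g : Equiv.Perm (Fin 5))⁻¹ = fiveCycle (theta g i) :=
  (exists_conj_fiveCycle g i).choose_spec

theorem theta_injective : Function.Injective theta := by
  rw [injective_iff_map_eq_one]
  intro g hg
  -- The two cycles generate different subgroups of order 5, each its own centralizer, and these
  -- meet trivially.
  have h : ∀ g : Equiv.Perm (Fin 5), g * fiveCycle 1 = fiveCycle 1 * g →
      g * fiveCycle 2 = fiveCycle 2 * g → g = 1 := by decide +kernel
  have key : ∀ i, (g : Equiv.Perm (Fin 5)) * fiveCycle i = fiveCycle i * g := by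
    intro i
    have := conj_fiveCycle g i
    rw [hg, Equiv.Perm.one_apply] at this
    exact mul_inv_eq_iff_eq_mul.1 this
  exact Subtype.ext (h g (key 1) (key 2))

/-- The element of `A₅` corresponding to `a`. -/
def alpha : alternatingGroup (Fin 5) :=
  ⟨List.formPerm [0, 1, 2, 3, 4], Equiv.Perm.mem_alternatingGroup.2 (by decide +kernel)⟩

/-- The element of `A₅` corresponding to `b`. -/
def beta₃ : alternatingGroup (Fin 5) :=
  ⟨List.formPerm [1, 4, 2], Equiv.Perm.mem_alternatingGroup.2 (by decide +kernel)⟩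

theorem theta_alpha : theta alpha = a := by
  ext i
  refine congrArg _ (fiveCycle_injective ?_)
  -- `theta` is defined by choice; comparing conjugated cycles instead gives a statement that can be
  -- evaluated.
  rw [← conj_fiveCycle]
  revert i
  decide +kernel

theorem theta_beta₃ : theta beta₃ = b := by
  ext i
  refine congrArg _ (fiveCycle_injective ?_)
  rw [← conj_fiveCycle]
  revert i
  decide +kernel

/-- The subgroup has elements of orders 5, 3 and 2, so 30 divides its order and its index in A₅ is
at most 2. Index 2 would make it normal, against simplicity. -/
theorem closure_alpha_beta₃ : Subgroup.closure {alpha, beta₃} = ⊤ := by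
  set H := Subgroup.closure {alpha, beta₃} with hH
  have ha : alpha ∈ H := Subgroup.subset_closure (by simp)
  have hb : beta₃ ∈ H := Subgroup.subset_closure (by simp)
  have hdvd : ∀ (p : ℕ) [Fact p.Prime] (g : alternatingGroup (Fin 5)), g ∈ H → g ^ p = 1 →
      g ≠ 1 → p ∣ Nat.card H := by
    intro p _ g hg hgp hg1
    rw [← orderOf_eq_prime hgp hg1, ← Subgroup.orderOf_mk g hg]
    exact orderOf_dvd_natCard _
  have : Fact (Nat.Prime 5) := ⟨by norm_num⟩
  have : Fact (Nat.Prime 3) := ⟨by norm_num⟩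
  have h5 := hdvd 5 alpha ha (by decide +kernel) (by decide +kernel)
  have h3 := hdvd 3 beta₃ hb (by decide +kernel) (by decide +kernel)
  have h2 := hdvd 2 (beta₃ * alpha) (H.mul_mem hb ha) (by decide +kernel) (by decide +kernel)
  have hcard : Nat.card (alternatingGroup (Fin 5)) = 60 := by
    rw [Nat.card_eq_fintype_card, ← Nat.mul_left_cancel_iff (show 0 < 2 by norm_num),
      two_mul_card_alternatingGroup, Fintype.card_perm, Fintype.card_fin]
    rfl
  have h30 : 30 ∣ Nat.card H := by omega
  have hmul := H.card_mul_index
  rw [hcard] at hmul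
  obtain ⟨k, hk⟩ := h30
  rw [hk, mul_assoc] at hmul
  have hk2 : k * H.index = 2 := by omega
  have hidx : H.index = 1 ∨ H.index = 2 :=
    (Nat.dvd_prime Nat.prime_two).1 ⟨k, by rw [mul_comm, hk2]⟩
  rcases hidx with h | h
  · exact Subgroup.index_eq_one.1 h
  · have hn := Subgroup.normal_of_index_eq_two h
    have : IsSimpleGroup (alternatingGroup (Fin 5)) := inferInstance
    rcases hn.eq_bot_or_eq_top with h' | h'
    · rw [h', Subgroup.mem_bot] at ha
      exact absurd ha (by decide +kernel)
    · exact h'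

theorem range_theta : theta.range = Subgroup.closure {a, b} := by
  rw [MonoidHom.range_eq_map, ← closure_alpha_beta₃, MonoidHom.map_closure, Set.image_pair,
    theta_alpha, theta_beta₃]

/-! ### The rotations of the dodecahedron -/

section Dodecahedron

open Matrix

local notation "φ" => Real.goldenRatio

theorem phi_sq : φ * φ = φ + 1 := by rw [← sq, Real.goldenRatio_sq]

theorem faceNormal_dot_self (i : Fin 12) : faceNormal i ⬝ᵥ faceNormal i = φ + 2 := by
  fin_cases i <;> simp [faceNormal, dotProduct, Fin.sum_univ_three, phi_sq] <;> ring

theorem faceNormal_injective : Function.Injective faceNormal := by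
  have h0 : (0 : ℝ) < φ := Real.goldenRatio_pos
  have h1 : (1 : ℝ) < φ := Real.one_lt_goldenRatio
  intro i j h
  have e0 := congrFun h 0
  have e1 := congrFun h 1
  have e2 := congrFun h 2
  clear h
  fin_cases i <;> fin_cases j <;> first
    | rfl
    | (exfalso
       simp only [faceNormal, Fin.zero_eta, Fin.mk_one, Fin.reduceFinMk, cons_val] at e0 e1 e2
       linarith)

theorem dot_self_pos {v : Fin 3 → ℝ} (hv : v ≠ 0) : 0 < v ⬝ᵥ v := by
  have h : v ⬝ᵥ v ≠ 0 := fun h => hv (dotProduct_self_eq_zero.1 h)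
  refine lt_of_le_of_ne ?_ h.symm
  rw [dotProduct, Fin.sum_univ_three]
  nlinarith [mul_self_nonneg (v 0), mul_self_nonneg (v 1), mul_self_nonneg (v 2)]

/-- All normals have the same length, so this is `|n_i - n_j|² > 0`. It makes the centre of a face a
point where no other face inequality is tight. -/
theorem faceNormal_dot_lt {i j : Fin 12} (h : i ≠ j) :
    faceNormal i ⬝ᵥ faceNormal j < φ + 2 := by
  have h1 := dot_self_pos (sub_ne_zero.2 (faceNormal_injective.ne h))
  rw [sub_dotProduct, dotProduct_sub, dotProduct_sub, faceNormal_dot_self, faceNormal_dot_self,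
    dotProduct_comm (faceNormal j)] at h1
  linarith

/-- The centre of a face. -/
theorem center_mem_face (i : Fin 12) : (φ + 2)⁻¹ • faceNormal i ∈ face i := by
  have h0 : (0 : ℝ) < φ + 2 := by linarith [Real.goldenRatio_pos]
  constructor
  · rw [dotProduct_smul, faceNormal_dot_self, smul_eq_mul, inv_mul_cancel₀ h0.ne']
  · intro j
    rw [dotProduct_smul, smul_eq_mul, inv_mul_le_iff₀ h0, mul_one]
    by_cases h : j = i
    · rw [h, faceNormal_dot_self]
    · exact (faceNormal_dot_lt h).le

/-- A face spans the space. As `w` is orthogonal to the centre, moving the centre by a small `ε w`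
stays in the face; pairing with `w` leaves `ε |w|² = 0`. -/
theorem eq_zero_of_dot_face_eq_zero {i : Fin 12} {w : Fin 3 → ℝ}
    (hw : ∀ x ∈ face i, w ⬝ᵥ x = 0) : w = 0 := by
  have h0 : (0 : ℝ) < φ + 2 := by linarith [Real.goldenRatio_pos]
  have h1 := hw _ (center_mem_face i)
  have h2 : faceNormal i ⬝ᵥ w = 0 := by
    rw [dotProduct_smul, smul_eq_mul, mul_eq_zero] at h1
    rw [dotProduct_comm]
    exact h1.resolve_left (inv_pos.2 h0).ne'
  have h3 : ∀ᶠ ε in 𝓝[>] (0 : ℝ), ∀ j, j ≠ i →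
      faceNormal j ⬝ᵥ ((φ + 2)⁻¹ • faceNormal i + ε • w) < 1 := by
    rw [eventually_all]
    intro j
    by_cases hj : j = i
    · exact Eventually.of_forall fun _ h => (h hj).elim
    have hc : Tendsto (fun ε : ℝ => faceNormal j ⬝ᵥ ((φ + 2)⁻¹ • faceNormal i + ε • w)) (𝓝[>] 0)
        (𝓝 ((φ + 2)⁻¹ * (faceNormal j ⬝ᵥ faceNormal i) + 0 * (faceNormal j ⬝ᵥ w))) := by
      simp only [dotProduct_add, dotProduct_smul, smul_eq_mul]
      exact ((continuous_const.add (continuous_id.mul continuous_const)).tendsto 0).mono_left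
        nhdsWithin_le_nhds
    refine (hc.eventually_lt_const ?_).mono fun ε h _ => h
    rw [zero_mul, add_zero, inv_mul_lt_iff₀ h0, mul_one]
    exact faceNormal_dot_lt hj
  obtain ⟨ε, h4, h5⟩ := (h3.and self_mem_nhdsWithin).exists
  have hmem : (φ + 2)⁻¹ • faceNormal i + ε • w ∈ face i := by
    have h6 : faceNormal i ⬝ᵥ ((φ + 2)⁻¹ • faceNormal i + ε • w) = 1 := by
      rw [dotProduct_add, dotProduct_smul _ _ w, h2, smul_zero, add_zero]
      exact (center_mem_face i).1
    refine ⟨h6, fun j => ?_⟩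
    by_cases hj : j = i
    · rw [hj, h6]
    · exact (h4 j hj).le
  have h7 := hw _ hmem
  rw [dotProduct_add, h1, zero_add, dotProduct_smul, smul_eq_mul, mul_eq_zero] at h7
  exact dotProduct_self_eq_zero.1 (h7.resolve_left (ne_of_gt h5))

theorem mulVec_dot_mulVec {R : Matrix (Fin 3) (Fin 3) ℝ}
    (hR : R ∈ specialOrthogonalGroup (Fin 3) ℝ) (u v : Fin 3 → ℝ) :
    (R *ᵥ u) ⬝ᵥ (R *ᵥ v) = u ⬝ᵥ v := by
  have h : Rᵀ * R = 1 := (mem_orthogonalGroup_iff' (Fin 3) ℝ).1 (mem_specialOrthogonalGroup_iff.1 hR).1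
  rw [dotProduct_mulVec, ← mulVec_transpose, mulVec_mulVec, h, one_mulVec]

theorem mulVec_surjective {R : Matrix (Fin 3) (Fin 3) ℝ}
    (hR : R ∈ specialOrthogonalGroup (Fin 3) ℝ) (u : Fin 3 → ℝ) : ∃ v, R *ᵥ v = u := by
  have h : R * Rᵀ = 1 := (mem_orthogonalGroup_iff (Fin 3) ℝ).1 (mem_specialOrthogonalGroup_iff.1 hR).1
  exact ⟨Rᵀ *ᵥ u, by rw [mulVec_mulVec, h, one_mulVec]⟩

/-- A rotation permutes the faces in the same way as their normal vectors. -/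
theorem isFaceRotation_iff (g : Equiv.Perm (Fin 12)) :
    IsFaceRotation g ↔ ∃ R ∈ specialOrthogonalGroup (Fin 3) ℝ,
      ∀ i, R *ᵥ faceNormal i = faceNormal (g i) := by
  constructor
  · rintro ⟨R, hR, h⟩
    refine ⟨R, hR, fun i => ?_⟩
    rw [← sub_eq_zero]
    apply eq_zero_of_dot_face_eq_zero (i := g i)
    intro y hy
    have hy' := hy
    rw [← h i] at hy'
    obtain ⟨x, hx, rfl⟩ := hy'
    rw [sub_dotProduct, hy.1]
    change (R *ᵥ faceNormal i) ⬝ᵥ (R *ᵥ x) - 1 = 0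
    rw [mulVec_dot_mulVec hR, hx.1, sub_self]
  · rintro ⟨R, hR, h⟩
    refine ⟨R, hR, fun i => ?_⟩
    have key : ∀ x, R *ᵥ x ∈ face (g i) ↔ x ∈ face i := by
      intro x
      simp only [face, Set.mem_ofPred_eq, ← h i, mulVec_dot_mulVec hR]
      refine and_congr_right fun _ => ⟨fun H j => ?_, fun H j => ?_⟩
      · have := H (g j)
        rwa [← h j, mulVec_dot_mulVec hR] at this
      · have := H (g.symm j)
        rwa [← mulVec_dot_mulVec hR, h, g.apply_symm_apply] at this
    ext y
    constructor
    · rintro ⟨x, hx, rfl⟩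
      exact (key x).2 hx
    · intro hy
      obtain ⟨x, rfl⟩ := mulVec_surjective hR y
      exact ⟨x, (key x).1 hy, rfl⟩

theorem IsFaceRotation.mul {g h : Equiv.Perm (Fin 12)} (hg : IsFaceRotation g)
    (hh : IsFaceRotation h) : IsFaceRotation (g * h) := by
  rw [isFaceRotation_iff] at *
  obtain ⟨R, hR, h1⟩ := hg
  obtain ⟨S, hS, h2⟩ := hh
  exact ⟨R * S, mul_mem hR hS, fun i => by rw [← mulVec_mulVec, h2, h1, Equiv.Perm.mul_apply]⟩

theorem IsFaceRotation.one : IsFaceRotation 1 := by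
  rw [isFaceRotation_iff]
  exact ⟨1, one_mem _, fun i => by rw [one_mulVec, Equiv.Perm.one_apply]⟩

theorem isFaceRotation_a : IsFaceRotation a := by
  rw [isFaceRotation_iff]
  have h := phi_sq
  -- The rotation of order 5 about the normal of face 1; its trace is `φ = 1 + 2 cos(2π/5)`.
  refine ⟨!![(φ - 1) / 2, -φ / 2, 1 / 2; φ / 2, 1 / 2, (φ - 1) / 2; -1 / 2, (φ - 1) / 2, φ / 2],
    ?_, fun i => ?_⟩
  · rw [mem_specialOrthogonalGroup_iff]
    constructor
    · rw [mem_orthogonalGroup_iff]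
      ext i j
      fin_cases i <;> fin_cases j <;> simp [mul_apply, Fin.sum_univ_three] <;> linarith
    · rw [det_fin_three]
      simp
      nlinarith
  · have ha : a 0 = 0 ∧ a 1 = 1 ∧ a 2 = 3 ∧ a 3 = 4 ∧ a 4 = 5 ∧ a 5 = 6 ∧ a 6 = 2 ∧ a 7 = 8 ∧
      a 8 = 9 ∧ a 9 = 10 ∧ a 10 = 11 ∧ a 11 = 7 := by decide +kernel
    obtain ⟨a0, a1, a2, a3, a4, a5, a6, a7, a8, a9, a10, a11⟩ := ha
    ext k
    fin_cases i <;> fin_cases k <;>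
      simp [a0, a1, a2, a3, a4, a5, a6, a7, a8, a9, a10, a11, faceNormal, mulVec, dotProduct,
        Fin.sum_univ_three] <;> linarith

theorem isFaceRotation_b : IsFaceRotation b := by
  rw [isFaceRotation_iff]
  have h := phi_sq
  -- The rotation of order 3 about the vertex shared by faces 1, 2, 3; its trace is 0.
  refine ⟨!![-1 / 2, -(φ - 1) / 2, φ / 2; (φ - 1) / 2, φ / 2, 1 / 2; -φ / 2, 1 / 2, -(φ - 1) / 2],
    ?_, fun i => ?_⟩
  · rw [mem_specialOrthogonalGroup_iff]
    constructor
    · rw [mem_orthogonalGroup_iff]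
      ext i j
      fin_cases i <;> fin_cases j <;> simp [mul_apply, Fin.sum_univ_three] <;> linarith
    · rw [det_fin_three]
      simp
      nlinarith
  · have hb : b 0 = 9 ∧ b 1 = 2 ∧ b 2 = 3 ∧ b 3 = 1 ∧ b 4 = 6 ∧ b 5 = 11 ∧ b 6 = 7 ∧ b 7 = 4 ∧
      b 8 = 5 ∧ b 9 = 10 ∧ b 10 = 0 ∧ b 11 = 8 := by decide +kernel
    obtain ⟨b0, b1, b2, b3, b4, b5, b6, b7, b8, b9, b10, b11⟩ := hb
    ext k
    fin_cases i <;> fin_cases k <;>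
      simp [b0, b1, b2, b3, b4, b5, b6, b7, b8, b9, b10, b11, faceNormal, mulVec, dotProduct,
        Fin.sum_univ_three] <;> linarith

theorem isFaceRotation_of_mem_closure {g : Equiv.Perm (Fin 12)}
    (hg : g ∈ Subgroup.closure {a, b}) : IsFaceRotation g := by
  rw [← SetLike.mem_coe, ← Subgroup.coe_toSubmonoid, Subgroup.closure_toSubmonoid_of_finite] at hg
  refine Submonoid.closure_induction ?_ IsFaceRotation.one (fun _ _ _ _ => IsFaceRotation.mul) hg
  rintro x (rfl | rfl)
  · exact isFaceRotation_a
  · exact isFaceRotation_b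

/-- Inner product `φ` characterizes the neighbours of a face, and the powers of `a` permute the five
neighbours of face 1 transitively. -/
theorem adjacent_one {j : Fin 12} (h : faceNormal 1 ⬝ᵥ faceNormal j = φ) :
    ∃ n < 5, (a ^ n) j = 2 := by
  have h1 := phi_sq
  have h0 : (0 : ℝ) < φ := Real.goldenRatio_pos
  have key : j ∈ ({2, 3, 4, 5, 6} : Finset (Fin 12)) → ∃ n < 5, (a ^ n) j = 2 := by
    clear h; revert j; decide +kernel
  apply key
  fin_cases j <;> first
    | decide
    | (exfalso
       simp [faceNormal, dotProduct, Fin.sum_univ_three] at h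
       linarith)

theorem adjacent_one_two {j : Fin 12} (h : faceNormal 1 ⬝ᵥ faceNormal j = φ)
    (h2 : faceNormal 2 ⬝ᵥ faceNormal j = φ) : j = 3 ∨ j = 6 := by
  have h1 := phi_sq
  have h0 : (0 : ℝ) < φ := Real.goldenRatio_pos
  fin_cases j <;> first
    | decide
    | (exfalso
       simp [faceNormal, dotProduct, Fin.sum_univ_three] at h h2
       linarith)

/-- Face 3 must go to a common neighbour of faces 1 and 2, that is to 3 or 6. The normals 1, 2, 3
form a basis, so the first case gives the identity; the triples 1, 2, 3 and 1, 2, 6 have opposite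
orientation, which excludes the second. -/
theorem eq_one_of_fixes {g : Equiv.Perm (Fin 12)} (hg : IsFaceRotation g) (h1 : g 1 = 1)
    (h2 : g 2 = 2) : g = 1 := by
  obtain ⟨R, hR, h⟩ := (isFaceRotation_iff g).1 hg
  have hφ := phi_sq
  have h0 : (0 : ℝ) < φ := Real.goldenRatio_pos
  have e12 : faceNormal 1 ⬝ᵥ faceNormal 3 = φ ∧ faceNormal 2 ⬝ᵥ faceNormal 3 = φ := by
    constructor <;> simp [faceNormal, dotProduct, Fin.sum_univ_three] <;> linarith
  have h3 := adjacent_one_two (j := g 3)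
    (by rw [← h1, ← h, ← h, mulVec_dot_mulVec hR, e12.1])
    (by rw [← h2, ← h, ← h, mulVec_dot_mulVec hR, e12.2])
  have hmul : R * !![0, 1, -1; 1, φ, φ; φ, 0, 0] =
      !![0, 1, faceNormal (g 3) 0; 1, φ, faceNormal (g 3) 1; φ, 0, faceNormal (g 3) 2] := by
    have r1 := h 1
    have r2 := h 2
    have r3 := h 3
    rw [h1] at r1
    rw [h2] at r2
    ext i j
    have r1 := congrFun r1 i
    have r2 := congrFun r2 i
    have r3 := congrFun r3 i
    fin_cases i <;> fin_cases j <;>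
      simp [faceNormal, mulVec, dotProduct, Fin.sum_univ_three, mul_apply] at r1 r2 r3 ⊢ <;>
      linarith
  have hdet : R.det = 1 := (mem_specialOrthogonalGroup_iff.1 hR).2
  have hM : (!![0, 1, -1; 1, φ, φ; φ, 0, 0] : Matrix (Fin 3) (Fin 3) ℝ).det = 2 * (φ + 1) := by
    rw [det_fin_three]; simp; linarith
  rcases h3 with h3 | h3
  · have hR1 : R = 1 := by
      have hu : IsUnit (!![0, 1, -1; 1, φ, φ; φ, 0, 0] : Matrix (Fin 3) (Fin 3) ℝ) := by
        rw [isUnit_iff_isUnit_det, hM, isUnit_iff_ne_zero]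
        positivity
      have : R * !![0, 1, -1; 1, φ, φ; φ, 0, 0] = 1 * !![0, 1, -1; 1, φ, φ; φ, 0, 0] := by
        rw [hmul, h3, one_mul]
        simp [faceNormal]
      exact hu.mul_right_cancel this
    refine Equiv.ext fun i => faceNormal_injective ?_
    rw [← h, hR1, one_mulVec, Equiv.Perm.one_apply]
  · exfalso
    have := congrArg det hmul
    rw [det_mul, hdet, hM, h3, det_fin_three] at this
    simp [faceNormal] at this
    nlinarith

/-- A rotation is determined by the images of the adjacent faces 1 and 2. The group generated by `a`
and `b` is transitive on faces and contains the turns about face 1, so any rotation can be corrected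
to the identity inside it. -/
theorem isFaceRotation_iff_mem_closure (g : Equiv.Perm (Fin 12)) :
    IsFaceRotation g ↔ g ∈ Subgroup.closure {a, b} := by
  refine ⟨fun hg => ?_, isFaceRotation_of_mem_closure⟩
  set Γ := Subgroup.closure {a, b} with hΓ
  have ha : a ∈ Γ := Subgroup.subset_closure (by simp)
  have hb : b ∈ Γ := Subgroup.subset_closure (by simp)
  -- Words of this bounded shape already bring every face to face 1, which makes transitivity a
  -- finite check.
  have htr : ∀ i : Fin 12, ∃ p < 5, ∃ q < 3, ∃ r < 5, ∃ s < 3, ∃ t < 3,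
      (b ^ s * a ^ r * b ^ q * a ^ p * b ^ t) i = 1 := by decide +kernel
  obtain ⟨h, hh, h1⟩ : ∃ h ∈ Γ, (h * g) 1 = 1 := by
    obtain ⟨p, -, q, -, r, -, s, -, t, -, h⟩ := htr (g 1)
    exact ⟨_, Γ.mul_mem (Γ.mul_mem (Γ.mul_mem (Γ.mul_mem (Γ.pow_mem hb s) (Γ.pow_mem ha r))
      (Γ.pow_mem hb q)) (Γ.pow_mem ha p)) (Γ.pow_mem hb t), h⟩
  have hhg := (isFaceRotation_of_mem_closure hh).mul hg
  obtain ⟨R, hR, hRn⟩ := (isFaceRotation_iff _).1 hhg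
  obtain ⟨n, -, h2⟩ := adjacent_one (j := (h * g) 2) (by
    rw [← h1, ← hRn, ← hRn, mulVec_dot_mulVec hR]
    simp [faceNormal, dotProduct, Fin.sum_univ_three])
  have ha1 : ∀ n : ℕ, (a ^ n) 1 = 1 := fun n =>
    Function.IsFixedPt.perm_pow (show a 1 = 1 by decide +kernel) n
  have han : a ^ n ∈ Γ := Γ.pow_mem ha n
  have key := eq_one_of_fixes ((isFaceRotation_of_mem_closure han).mul hhg)
    (by rw [Equiv.Perm.mul_apply, h1, ha1]) (by rw [Equiv.Perm.mul_apply, h2])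
  rw [← mul_assoc, mul_eq_one_iff_inv_eq] at key
  rw [← key]
  exact Γ.inv_mem (Γ.mul_mem han hh)

end Dodecahedron

/-! ### The topology of the projective plane -/

theorem isQuotientMap_mk' : IsQuotientMap (Projectivization.mk' ℂ : {v : Fin 3 → ℂ // v ≠ 0} → P2) :=
  isQuotientMap_quotient_mk'

theorem exists_rep_mk (v : Fin 3 → ℂ) (hv : v ≠ 0) :
    ∃ c : ℂ, c ≠ 0 ∧ ∀ i, (Projectivization.mk ℂ v hv).rep i = c * v i := by
  obtain ⟨a, ha⟩ := Projectivization.exists_smul_eq_mk_rep ℂ v hv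
  exact ⟨a, a.ne_zero, fun i => by rw [← ha]; rfl⟩

theorem rep_mk_eq_zero_iff {v : Fin 3 → ℂ} {hv : v ≠ 0} {i : Fin 3} :
    (Projectivization.mk ℂ v hv).rep i = 0 ↔ v i = 0 := by
  obtain ⟨c, hc, h⟩ := exists_rep_mk v hv
  rw [h, mul_eq_zero, or_iff_right hc]

/-- The quotient of two homogeneous coordinates. -/
def ratio (i j : Fin 3) (p : P2) : ℂ := p.rep i / p.rep j

theorem ratio_mk (i j : Fin 3) (v : Fin 3 → ℂ) (hv : v ≠ 0) :
    ratio i j (Projectivization.mk ℂ v hv) = v i / v j := by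
  obtain ⟨c, hc, h⟩ := exists_rep_mk v hv
  rw [ratio, h, h, mul_div_mul_left _ _ hc]

theorem isOpen_rep_ne_zero (j : Fin 3) : IsOpen {p : P2 | p.rep j ≠ 0} := by
  rw [← isQuotientMap_mk'.isOpen_preimage]
  have h : Projectivization.mk' ℂ ⁻¹' {p : P2 | p.rep j ≠ 0} =
      {v : {v : Fin 3 → ℂ // v ≠ 0} | v.1 j ≠ 0} := by
    ext v
    exact not_congr (rep_mk_eq_zero_iff (hv := v.2))
  rw [h]
  exact isOpen_ne_fun ((continuous_apply j).comp continuous_subtype_val) continuous_const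

theorem continuousOn_ratio (i j : Fin 3) : ContinuousOn (ratio i j) {p : P2 | p.rep j ≠ 0} := by
  rw [isQuotientMap_mk'.continuousOn_isOpen_iff (isOpen_rep_ne_zero j)]
  have h : ratio i j ∘ Projectivization.mk' ℂ =
      fun v : {v : Fin 3 → ℂ // v ≠ 0} => v.1 i / v.1 j :=
    funext fun v => ratio_mk i j v.1 v.2
  rw [h]
  refine ContinuousOn.div ?_ ?_ ?_
  · exact ((continuous_apply i).comp continuous_subtype_val).continuousOn
  · exact ((continuous_apply j).comp continuous_subtype_val).continuousOn
  · exact fun v hv => fun h => hv ((rep_mk_eq_zero_iff (hv := v.2)).2 h)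

theorem continuousAt_ratio {i j : Fin 3} {p : P2} (hp : p.rep j ≠ 0) :
    ContinuousAt (ratio i j) p :=
  (continuousOn_ratio i j).continuousAt ((isOpen_rep_ne_zero j).mem_nhds hp)

theorem continuousAt_mk {T : Type*} [TopologicalSpace T] {v : T → Fin 3 → ℂ} {t₀ : T} {γ : T → P2}
    (hv : ContinuousAt v t₀) (hv0 : v t₀ ≠ 0)
    (hγ : ∀ᶠ t in 𝓝 t₀, ∃ h, γ t = Projectivization.mk ℂ (v t) h) : ContinuousAt γ t₀ := by
  classical
  let ψ : (Fin 3 → ℂ) → P2 := fun w =>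
    if h : w ≠ 0 then Projectivization.mk ℂ w h else γ t₀
  have hψ : ContinuousAt ψ (v t₀) := by
    refine ContinuousOn.continuousAt (s := {w | w ≠ 0}) ?_ (isOpen_ne.mem_nhds hv0)
    rw [continuousOn_iff_continuous_domRestrict]
    refine isQuotientMap_mk'.continuous.congr fun w => ?_
    have h : ψ w.1 = Projectivization.mk ℂ w.1 w.2 := dif_pos (c := w.1 ≠ 0) w.2
    exact h.symm
  refine (hψ.comp hv).congr ?_
  filter_upwards [hγ] with t ht
  obtain ⟨h, ht⟩ := ht
  rw [ht]
  exact dif_pos h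

instance : CompactSpace P2 := by
  have h : IsCompact (Metric.sphere (0 : Fin 3 → ℂ) 1) := isCompact_sphere _ _
  have hne : ∀ v : Metric.sphere (0 : Fin 3 → ℂ) 1, (v : Fin 3 → ℂ) ≠ 0 :=
    fun v => ne_zero_of_mem_unit_sphere v
  let φ : Metric.sphere (0 : Fin 3 → ℂ) 1 → P2 := fun v => Projectivization.mk ℂ v.1 (hne v)
  have hφ : Continuous φ := isQuotientMap_mk'.continuous.comp
    (continuous_subtype_val.subtype_mk hne)
  have hsurj : Function.Surjective φ := by
    intro p
    have hp := norm_ne_zero_iff.2 p.rep_nonzero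
    refine ⟨⟨((‖p.rep‖⁻¹ : ℝ) : ℂ) • p.rep, ?_⟩, ?_⟩
    · rw [mem_sphere_zero_iff_norm, norm_smul, Complex.norm_real, norm_inv, norm_norm,
        inv_mul_cancel₀ hp]
    · conv_rhs => rw [← p.mk_rep]
      rw [Projectivization.mk_eq_mk_iff']
      exact ⟨_, rfl⟩
  have : CompactSpace (Metric.sphere (0 : Fin 3 → ℂ) 1) := isCompact_iff_compactSpace.1 h
  rw [← isCompact_univ_iff, ← hsurj.range_eq]
  exact isCompact_range hφ

/-- A local parametrization with a continuous local inverse is a local parameter. -/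
theorem exists_isLocalParameter {X : Set P2} {p : X} {v : ℂ → Fin 3 → ℂ}
    (hv : AnalyticAt ℂ v 0) (hli : LinearIndependent ℂ ![v 0, deriv v 0])
    (hX : ∀ᶠ t in 𝓝 0, ∀ h : v t ≠ 0, Projectivization.mk ℂ (v t) h ∈ X)
    (hp : ∃ h, (p : P2) = Projectivization.mk ℂ (v 0) h) {τ : X → ℂ} (hτ : ContinuousAt τ p)
    (hτp : τ p = 0)
    (hinv : ∀ᶠ q : X in 𝓝 p, ∃ h, (q : P2) = Projectivization.mk ℂ (v (τ q)) h) :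
    ∃ γ : ℂ → X, IsLocalParameter p γ ∧
      ∀ᶠ t in 𝓝 0, ∃ h, (γ t : P2) = Projectivization.mk ℂ (v t) h := by
  classical
  obtain ⟨hv0, hp⟩ := hp
  -- Only values near 0 matter; `p` is a filler where the lift vanishes or leaves `X`.
  let γ : ℂ → X := fun t =>
    if h : ∃ h : v t ≠ 0, Projectivization.mk ℂ (v t) h ∈ X then ⟨_, h.choose_spec⟩ else p
  have hγ : ∀ t, ∀ h : v t ≠ 0, Projectivization.mk ℂ (v t) h ∈ X →
      (γ t : P2) = Projectivization.mk ℂ (v t) h := by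
    intro t h h'
    have : ∃ h : v t ≠ 0, Projectivization.mk ℂ (v t) h ∈ X := ⟨h, h'⟩
    simp only [γ, dif_pos this]
  have hev : ∀ᶠ t in 𝓝 0, ∃ h, (γ t : P2) = Projectivization.mk ℂ (v t) h := by
    filter_upwards [hX, hv.continuousAt.eventually_ne hv0] with t h1 h2
    exact ⟨h2, hγ t h2 (h1 h2)⟩
  have hγ0 : γ 0 = p := Subtype.ext (by
    rw [hγ 0 hv0 (by rw [← hp]; exact p.2), hp])
  have hcont : ContinuousAt γ 0 := by
    refine IsInducing.subtypeVal.continuousAt_iff.2 ?_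
    exact continuousAt_mk hv.continuousAt hv0 hev
  refine ⟨γ, ⟨hγ0, le_antisymm ?_ ?_, v, hv, hli, hev⟩, hev⟩
  · have := hcont.tendsto
    rwa [hγ0] at this
  -- Points near `p` have the form `γ (τ q)` with `τ q` near 0, so images of neighbourhoods of 0 are
  -- neighbourhoods of `p`.
  · intro s hs
    rw [mem_map] at hs
    have hτ' : Tendsto τ (𝓝 p) (𝓝 0) := by
      have := hτ.tendsto
      rwa [hτp] at this
    filter_upwards [hτ' hs, hinv] with q h1 h2
    obtain ⟨h2, h3⟩ := h2
    have h4 : γ (τ q) = q := Subtype.ext (by rw [hγ _ h2 (by rw [← h3]; exact q.2), h3])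
    rw [← h4]
    exact h1

/-! ### Functions with ramification orders -/

theorem recip_zero : recip 0 = infty := if_pos rfl

theorem recip_of_ne {z : ℂ} (hz : z ≠ 0) : recip z = fin z⁻¹ := if_neg hz

theorem fin_injective : Function.Injective fin := OnePoint.coe_injective

theorem fin_ne_infty (z : ℂ) : fin z ≠ infty := OnePoint.coe_ne_infty z

theorem nhds_fin (z : ℂ) : 𝓝 (fin z) = map fin (𝓝 z) := OnePoint.nhds_coe_eq z

theorem nhds_infty : 𝓝 infty = map fin (Bornology.cobounded ℂ) ⊔ pure infty := by
  rw [Metric.cobounded_eq_cocompact, ← coclosedCompact_eq_cocompact]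
  exact OnePoint.nhds_infty_eq

theorem map_recip_nhds_zero : map recip (𝓝 0) = 𝓝 infty := by
  have h : map recip (𝓝[≠] 0) = map (fin ∘ Inv.inv) (𝓝[≠] 0) := by
    refine Filter.map_congr ?_
    filter_upwards [self_mem_nhdsWithin] with z hz
    exact recip_of_ne hz
  rw [← pure_sup_nhdsNE, Filter.map_sup, Filter.map_pure, recip_zero, nhds_infty, sup_comm, h,
    ← Filter.map_map, Filter.map_inv, inv_nhdsNE_zero]

/-- In a local parameter the function is a nonconstant analytic germ, to which the open mapping
theorem applies. This gives both continuity and openness. -/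
theorem HasRamificationOrder.map_nhds {X : Set P2} {β : X → Sphere} {p : X} {e : ℕ}
    (h : HasRamificationOrder β p e) : map β (𝓝 p) = 𝓝 (β p) := by
  obtain ⟨he, γ, ⟨hγ0, hγ, -⟩, u, hu, hord, h⟩ := h
  have hu0 : u 0 = 0 := apply_eq_zero_of_analyticOrderAt_ne_zero (by
    rw [hord]; exact_mod_cast he.ne')
  have hopen : map u (𝓝 0) = 𝓝 0 := by
    refine le_antisymm ?_ ?_
    · have := hu.continuousAt.tendsto
      rwa [hu0] at this
    · rcases hu.eventually_constant_or_nhds_le_map_nhds with h' | h'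
      · rw [hu0, ← analyticOrderAt_eq_top, hord] at h'
        exact absurd h' (ENat.natCast_ne_top e)
      · rwa [hu0] at h'
  rw [← hγ, map_map, ← hγ0]
  rcases h with ⟨c, h⟩ | h
  · have h0 : β (γ 0) = fin c := by rw [h.self_of_nhds, hu0, add_zero]
    rw [h0, nhds_fin, Filter.map_congr (m₁ := β ∘ γ) (m₂ := fin ∘ (fun z => c + z) ∘ u) h, ← map_map, ← map_map, hopen,
      map_add_left_nhds, add_zero]
  · have h0 : β (γ 0) = infty := by rw [h.self_of_nhds, hu0, recip_zero]
    rw [h0, Filter.map_congr (m₁ := β ∘ γ) (m₂ := recip ∘ u) h, ← map_map, hopen, map_recip_nhds_zero]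

/-- A compact surface with a meromorphic function that has exactly one pole is connected. -/
theorem isConnected_of_hasRamificationOrder {X : Set P2} (hX : IsCompact X) {β : X → Sphere}
    (hβ : ∀ p, ∃ e, HasRamificationOrder β p e) (hne : X.Nonempty)
    (hpole : ∀ p q, β p = infty → β q = infty → p = q) : IsConnected X := by
  have hmap : ∀ p, map β (𝓝 p) = 𝓝 (β p) := fun p => (hβ p).choose_spec.map_nhds
  have hcont : Continuous β := continuous_iff_continuousAt.2 fun p => (hmap p).le
  have hopen : IsOpenMap β := IsOpenMap.of_nhds_le fun p => (hmap p).ge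
  have hcomp : CompactSpace X := isCompact_iff_compactSpace.1 hX
  refine ⟨hne, isPreconnected_iff_preconnectedSpace.2 (preconnectedSpace_iff_clopen.2 ?_)⟩
  -- The image of a clopen set is open and compact, hence the whole connected sphere. Both halves of
  -- a separation would contain the unique pole.
  have key : ∀ s : Set X, IsClopen s → s.Nonempty → ∃ p ∈ s, β p = infty := by
    intro s hs hs'
    have h1 : IsClopen (β '' s) := ⟨(hs.1.isCompact.image hcont).isClosed, hopen s hs.2⟩
    rcases isClopen_iff.1 h1 with h2 | h2
    · exact absurd h2 (hs'.image β).ne_empty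
    · have h3 : infty ∈ β '' s := by rw [h2]; trivial
      exact h3
  intro s hs
  by_contra! h
  obtain ⟨p, hp, hp'⟩ := key s hs h.1
  obtain ⟨q, hq, hq'⟩ := key sᶜ hs.compl (Set.nonempty_compl.2 h.2)
  exact hq (hpole p q hp' hq' ▸ hp)

/-! ### Cubic curves in Legendre form -/

/-- The cubic polynomial function `(x - e₁) (x - e₂) (x - e₃)`. -/
def cubic (e₁ e₂ e₃ x : ℂ) : ℂ := (x - e₁) * (x - e₂) * (x - e₃)

/-- The projective curve `y² z = (x - e₁ z) (x - e₂ z) (x - e₃ z)`. -/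
def curve (e₁ e₂ e₃ : ℂ) : Set P2 :=
  {p | p.rep 1 ^ 2 * p.rep 2 =
    (p.rep 0 - e₁ * p.rep 2) * (p.rep 0 - e₂ * p.rep 2) * (p.rep 0 - e₃ * p.rep 2)}

/-- The function `P(x)` on a cubic curve. -/
def polyFun {X : Set P2} (P : ℂ[X]) (p : X) : Sphere :=
  if (p : P2).rep 2 = 0 then infty else fin (P.eval (ratio 0 2 p))

theorem affine_ne_zero (x y : ℂ) : (![x, y, 1] : Fin 3 → ℂ) ≠ 0 :=
  fun h => one_ne_zero (congrFun h 2)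

theorem chart_infty_ne_zero (u w : ℂ) : (![u, 1, w] : Fin 3 → ℂ) ≠ 0 :=
  fun h => one_ne_zero (congrFun h 1)

/-- The point `[x, y, 1]`. -/
def affinePoint (x y : ℂ) : P2 := Projectivization.mk ℂ ![x, y, 1] (affine_ne_zero x y)

/-- The point `[0, 1, 0]`. -/
def inftyPoint : P2 := Projectivization.mk ℂ ![0, 1, 0] (chart_infty_ne_zero 0 0)

theorem eq_affinePoint {p : P2} (hp : p.rep 2 ≠ 0) : p = affinePoint (ratio 0 2 p) (ratio 1 2 p) := by
  conv_lhs => rw [← p.mk_rep]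
  rw [affinePoint, Projectivization.mk_eq_mk_iff']
  refine ⟨p.rep 2, funext fun i => ?_⟩
  fin_cases i <;> simp [ratio, mul_div_cancel₀ _ hp]

theorem eq_mk_of_rep_one_ne_zero {p : P2} (hp : p.rep 1 ≠ 0) :
    p = Projectivization.mk ℂ ![ratio 0 1 p, 1, ratio 2 1 p] (chart_infty_ne_zero _ _) := by
  conv_lhs => rw [← p.mk_rep]
  rw [Projectivization.mk_eq_mk_iff']
  refine ⟨p.rep 1, funext fun i => ?_⟩
  fin_cases i <;> simp [ratio, mul_div_cancel₀ _ hp]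

theorem ratio_affinePoint_zero (x y : ℂ) : ratio 0 2 (affinePoint x y) = x := by
  rw [affinePoint, ratio_mk]; simp

theorem ratio_affinePoint_one (x y : ℂ) : ratio 1 2 (affinePoint x y) = y := by
  rw [affinePoint, ratio_mk]; simp

theorem rep_affinePoint (x y : ℂ) : (affinePoint x y).rep 2 ≠ 0 := by
  rw [affinePoint, Ne, rep_mk_eq_zero_iff]; simp

section Curve

variable {e₁ e₂ e₃ : ℂ}

theorem mk_mem_curve {v : Fin 3 → ℂ} {hv : v ≠ 0} :
    Projectivization.mk ℂ v hv ∈ curve e₁ e₂ e₃ ↔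
      v 1 ^ 2 * v 2 = (v 0 - e₁ * v 2) * (v 0 - e₂ * v 2) * (v 0 - e₃ * v 2) := by
  obtain ⟨c, hc, h⟩ := exists_rep_mk v hv
  change _ = _ ↔ _
  rw [h, h, h]
  constructor
  · intro h
    apply mul_left_cancel₀ (pow_ne_zero 3 hc)
    linear_combination h
  · intro h
    linear_combination c ^ 3 * h

theorem affinePoint_mem_curve {x y : ℂ} :
    affinePoint x y ∈ curve e₁ e₂ e₃ ↔ y ^ 2 = cubic e₁ e₂ e₃ x := by
  rw [affinePoint, mk_mem_curve]
  simp [cubic]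

theorem inftyPoint_mem_curve : inftyPoint ∈ curve e₁ e₂ e₃ := by
  rw [inftyPoint, mk_mem_curve]; simp

theorem eq_inftyPoint {p : P2} (hp : p ∈ curve e₁ e₂ e₃) (h2 : p.rep 2 = 0) : p = inftyPoint := by
  have h0 : p.rep 0 = 0 := by
    have h : p.rep 1 ^ 2 * p.rep 2 = _ := hp
    rw [h2] at h
    simpa using h.symm
  have h1 : p.rep 1 ≠ 0 := by
    intro h1
    apply p.rep_nonzero
    funext i
    fin_cases i <;> assumption
  rw [eq_mk_of_rep_one_ne_zero h1, inftyPoint]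
  congr 1
  simp [ratio, h0, h2]

theorem sq_eq_cubic {p : P2} (hp : p ∈ curve e₁ e₂ e₃) (h2 : p.rep 2 ≠ 0) :
    ratio 1 2 p ^ 2 = cubic e₁ e₂ e₃ (ratio 0 2 p) := by
  rw [← affinePoint_mem_curve, ← eq_affinePoint h2]
  exact hp

theorem isClosed_curve : IsClosed (curve e₁ e₂ e₃) := by
  rw [← isQuotientMap_mk'.isClosed_preimage]
  have h : Projectivization.mk' ℂ ⁻¹' curve e₁ e₂ e₃ = {v : {v : Fin 3 → ℂ // v ≠ 0} |
      v.1 1 ^ 2 * v.1 2 =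
        (v.1 0 - e₁ * v.1 2) * (v.1 0 - e₂ * v.1 2) * (v.1 0 - e₃ * v.1 2)} := by
    ext v
    exact mk_mem_curve (hv := v.2)
  rw [h]
  have hc : ∀ i, Continuous fun v : {v : Fin 3 → ℂ // v ≠ 0} => v.1 i :=
    fun i => (continuous_apply i).comp continuous_subtype_val
  exact isClosed_eq (((hc 1).pow 2).mul (hc 2))
    ((((hc 0).sub (continuous_const.mul (hc 2))).mul ((hc 0).sub (continuous_const.mul (hc 2)))).mul
      ((hc 0).sub (continuous_const.mul (hc 2))))

theorem isCompact_curve : IsCompact (curve e₁ e₂ e₃) := isClosed_curve.isCompact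

/-- The minor of rows `i`, `j` is triangular with nonzero diagonal. -/
theorem linearIndependent_of_components {v : ℂ → Fin 3 → ℂ} (hv : AnalyticAt ℂ v 0) {i j : Fin 3}
    (h1 : v 0 i ≠ 0) (h2 : v 0 j = 0 ∨ deriv (fun t => v t i) 0 = 0)
    (h3 : deriv (fun t => v t j) 0 ≠ 0) :
    LinearIndependent ℂ ![v 0, deriv v 0] := by
  have hd : ∀ k, deriv v 0 k = deriv (fun t => v t k) 0 := fun k => by
    rw [deriv_pi fun k => ((analyticAt_pi_iff.1 hv) k).differentiableAt]
  rw [LinearIndependent.pair_iff]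
  intro s t hst
  have hi := congrFun hst i
  have hj := congrFun hst j
  simp only [Pi.add_apply, Pi.smul_apply, smul_eq_mul, Pi.zero_apply, hd] at hi hj
  rcases h2 with h2 | h2
  · rw [h2, mul_zero, zero_add, mul_eq_zero, or_iff_left h3] at hj
    rw [hj, zero_mul, add_zero, mul_eq_zero, or_iff_left h1] at hi
    exact ⟨hi, hj⟩
  · rw [h2, mul_zero, add_zero, mul_eq_zero, or_iff_left h1] at hi
    rw [hi, zero_mul, zero_add, mul_eq_zero, or_iff_left h3] at hj
    exact ⟨hi, hj⟩

theorem hasDerivAt_cubic (x : ℂ) : HasDerivAt (cubic e₁ e₂ e₃)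
    ((x - e₂) * (x - e₃) + (x - e₁) * (x - e₃) + (x - e₁) * (x - e₂)) x := by
  have h := (((hasDerivAt_id x).sub_const e₁).mul ((hasDerivAt_id x).sub_const e₂)).mul
    ((hasDerivAt_id x).sub_const e₃)
  refine (h.congr_deriv ?_)
  simp only [id, Pi.mul_apply]
  ring

theorem continuousAt_ratio_val {X : Set P2} {i j : Fin 3} {p : X} (hp : (p : P2).rep j ≠ 0) :
    ContinuousAt (fun q : X => ratio i j q) p :=
  ContinuousAt.comp (g := ratio i j) (continuousAt_ratio hp) continuousAt_subtype_val

theorem eventually_rep_ne_zero {X : Set P2} {j : Fin 3} {p : X} (hp : (p : P2).rep j ≠ 0) :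
    ∀ᶠ q : X in 𝓝 p, (q : P2).rep j ≠ 0 :=
  continuousAt_subtype_val.eventually ((isOpen_rep_ne_zero j).mem_nhds hp)

theorem analyticAt_vec {a b c : ℂ → ℂ} {z : ℂ} (ha : AnalyticAt ℂ a z) (hb : AnalyticAt ℂ b z)
    (hc : AnalyticAt ℂ c z) : AnalyticAt ℂ (fun t => (![a t, b t, c t] : Fin 3 → ℂ)) z := by
  rw [analyticAt_pi_iff]
  intro i
  fin_cases i <;> assumption

/-- A holomorphic square root of an analytic function with value `1`. -/
theorem exists_analytic_sqrt {g : ℂ → ℂ} {z : ℂ} (hg : AnalyticAt ℂ g z) (h1 : g z = 1) :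
    ∃ s : ℂ → ℂ, AnalyticAt ℂ s z ∧ s z = 1 ∧ ∀ t, s t ^ 2 = g t := by
  refine ⟨fun t => g t ^ (((2 : ℕ) : ℂ)⁻¹), ?_, ?_, fun t => Complex.cpow_nat_inv_pow _ two_ne_zero⟩
  · exact hg.cpow analyticAt_const (by rw [h1]; exact Complex.one_mem_slitPlane)
  · simp only [h1, Complex.one_cpow]

theorem analyticAt_cubic (x : ℂ) : AnalyticAt ℂ (cubic e₁ e₂ e₃) x := by
  unfold cubic; fun_prop

/-- Away from the branch points `x - x₀` is a parameter, with `y = y₀ √(cubic(x) / cubic(x₀))`. -/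
theorem exists_parameter_of_cubic_ne_zero (p : curve e₁ e₂ e₃) (hp : (p : P2).rep 2 ≠ 0)
    (hy : cubic e₁ e₂ e₃ (ratio 0 2 p) ≠ 0) :
    ∃ γ : ℂ → curve e₁ e₂ e₃, IsLocalParameter p γ ∧ ∃ x : ℂ → ℂ, AnalyticAt ℂ x 0 ∧
      x 0 = ratio 0 2 p ∧ analyticOrderAt (fun t => x t - x 0) 0 = (1 : ℕ) ∧
      ∀ᶠ t in 𝓝 0, (γ t : P2).rep 2 ≠ 0 ∧ ratio 0 2 (γ t) = x t := by
  set x₀ := ratio 0 2 p with hx₀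
  set y₀ := ratio 1 2 p with hy₀
  have hxy : y₀ ^ 2 = cubic e₁ e₂ e₃ x₀ := sq_eq_cubic p.2 hp
  have hy0 : y₀ ≠ 0 := by
    intro h
    rw [← hxy, h] at hy
    norm_num at hy
  obtain ⟨s, hs, hs0, hs2⟩ := exists_analytic_sqrt (z := 0)
    (g := fun t => cubic e₁ e₂ e₃ (x₀ + t) / cubic e₁ e₂ e₃ x₀)
    (by unfold cubic; fun_prop (disch := exact hy)) (by rw [add_zero, div_self hy])
  let v : ℂ → Fin 3 → ℂ := fun t => ![x₀ + t, y₀ * s t, 1]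
  have hv : AnalyticAt ℂ v 0 :=
    analyticAt_vec (by fun_prop) (analyticAt_const.mul hs) analyticAt_const
  have hd : deriv (fun t => x₀ + t) 0 = 1 := by
    rw [deriv_const_add, deriv_id'']
  obtain ⟨γ, hγ, hγv⟩ := exists_isLocalParameter (p := p) (τ := fun q => ratio 0 2 q - x₀) hv
    (linearIndependent_of_components hv (i := 2) (j := 0) one_ne_zero
      (Or.inr (deriv_const _ _)) (by change deriv (fun t => x₀ + t) 0 ≠ 0; rw [hd]; exact one_ne_zero))
    (Eventually.of_forall fun t h => by
      change affinePoint _ _ ∈ _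
      rw [affinePoint_mem_curve, mul_pow, hs2, hxy, mul_div_cancel₀ _ hy])
    ⟨affine_ne_zero _ _, by
      refine (eq_affinePoint hp).trans ?_
      simp only [v, add_zero, hs0, mul_one]
      rfl⟩
    ((continuousAt_ratio_val hp).sub continuousAt_const) (sub_self _) (by
      have h1 : ContinuousAt (fun q : curve e₁ e₂ e₃ =>
          ratio 1 2 q + y₀ * s (ratio 0 2 q - x₀)) p := by
        refine (continuousAt_ratio_val hp).add (continuousAt_const.mul ?_)
        refine ContinuousAt.comp (g := s) (f := fun q : curve e₁ e₂ e₃ => ratio 0 2 q - x₀) ?_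
          ((continuousAt_ratio_val hp).sub continuousAt_const)
        rw [sub_self]
        exact hs.continuousAt
      -- Selects the sign of the square root: near `p` the sum is close to `2 y₀ ≠ 0`, so the
      -- difference must vanish.
      have h2 : ∀ᶠ q : curve e₁ e₂ e₃ in 𝓝 p, ratio 1 2 q + y₀ * s (ratio 0 2 q - x₀) ≠ 0 :=
        h1.eventually_ne (by
          rw [sub_self, hs0, mul_one, ← hy₀, ← two_mul]
          exact mul_ne_zero two_ne_zero hy0)
      filter_upwards [h2, eventually_rep_ne_zero hp] with q hq hq2
      refine ⟨affine_ne_zero _ _, (eq_affinePoint hq2).trans ?_⟩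
      have h3 := sq_eq_cubic q.2 hq2
      have h4 : (ratio 1 2 q - y₀ * s (ratio 0 2 q - x₀)) *
          (ratio 1 2 q + y₀ * s (ratio 0 2 q - x₀)) = 0 := by
        have h5 := hs2 (ratio 0 2 q - x₀)
        rw [add_sub_cancel, eq_div_iff hy] at h5
        linear_combination h3 - h5 - s (ratio 0 2 q - x₀) ^ 2 * hxy
      rw [mul_eq_zero, or_iff_left hq, sub_eq_zero] at h4
      simp only [v, ← h4, add_sub_cancel]
      rfl)
  refine ⟨γ, hγ, fun t => x₀ + t, by fun_prop, add_zero _, ?_, ?_⟩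
  · simp only [add_zero, add_sub_cancel_left]
    exact analyticOrderAt_id
  · filter_upwards [hγv] with t ht
    obtain ⟨h, ht⟩ := ht
    rw [ht]
    exact ⟨rep_affinePoint _ _, ratio_affinePoint_zero _ _⟩

/-- At a simple zero of the cubic the parameter is `y`; inverting the cubic locally gives `x =
φ(y²)`, whence the order 2. -/
theorem exists_parameter_of_cubic_eq_zero (h12 : e₁ ≠ e₂) (h13 : e₁ ≠ e₃) (h23 : e₂ ≠ e₃)
    (p : curve e₁ e₂ e₃) (hp : (p : P2).rep 2 ≠ 0) (hy : cubic e₁ e₂ e₃ (ratio 0 2 p) = 0) :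
    ∃ γ : ℂ → curve e₁ e₂ e₃, IsLocalParameter p γ ∧ ∃ x : ℂ → ℂ, AnalyticAt ℂ x 0 ∧
      x 0 = ratio 0 2 p ∧ analyticOrderAt (fun t => x t - x 0) 0 = (2 : ℕ) ∧
      ∀ᶠ t in 𝓝 0, (γ t : P2).rep 2 ≠ 0 ∧ ratio 0 2 (γ t) = x t := by
  set x₀ := ratio 0 2 p with hx₀
  have hxy : ratio 1 2 p ^ 2 = cubic e₁ e₂ e₃ x₀ := sq_eq_cubic p.2 hp
  have hy0 : ratio 1 2 p = 0 := by rw [hy] at hxy; exact pow_eq_zero_iff two_ne_zero |>.1 hxy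
  have hderiv : deriv (cubic e₁ e₂ e₃) x₀ ≠ 0 := by
    rw [(hasDerivAt_cubic x₀).deriv]
    have hy' := hy
    rw [cubic, mul_eq_zero, mul_eq_zero, sub_eq_zero, sub_eq_zero, sub_eq_zero] at hy'
    have a1 := sub_ne_zero.2 h12
    have a2 := sub_ne_zero.2 h13
    have a3 := sub_ne_zero.2 h23
    have a4 := sub_ne_zero.2 h12.symm
    have a5 := sub_ne_zero.2 h13.symm
    have a6 := sub_ne_zero.2 h23.symm
    rcases hy' with (h | h) | h <;> rw [h] <;> simp [*]
  have han := analyticAt_cubic (e₁ := e₁) (e₂ := e₂) (e₃ := e₃) x₀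
  have hstrict : HasStrictDerivAt (cubic e₁ e₂ e₃) (deriv (cubic e₁ e₂ e₃) x₀) x₀ :=
    han.hasStrictDerivAt
  set φ := hstrict.localInverse _ _ _ hderiv with hφ
  have hφan : AnalyticAt ℂ φ 0 := by
    rw [← hy]
    exact han.analyticAt_localInverse hderiv
  have hφ0 : φ 0 = x₀ := by
    rw [← hy]
    exact (hstrict.hasStrictFDerivAt_equiv hderiv).localInverse_apply_image
  have hφr : ∀ᶠ t in 𝓝 0, cubic e₁ e₂ e₃ (φ t) = t := by
    have := (hstrict.hasStrictFDerivAt_equiv hderiv).eventually_right_inverse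
    rwa [hy] at this
  have hφl : ∀ᶠ x in 𝓝 x₀, φ (cubic e₁ e₂ e₃ x) = x :=
    (hstrict.hasStrictFDerivAt_equiv hderiv).eventually_left_inverse
  have hφ' : deriv φ 0 ≠ 0 := by
    have := hstrict.to_localInverse hderiv
    rw [hy] at this
    rw [this.hasDerivAt.deriv]
    exact inv_ne_zero hderiv
  have hsq : AnalyticAt ℂ (fun t : ℂ => t ^ 2) 0 := by fun_prop
  have hφsq : AnalyticAt ℂ (fun t => φ (t ^ 2)) 0 :=
    AnalyticAt.fun_comp (g := φ) (f := fun t : ℂ => t ^ 2) (by simpa using hφan) hsq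
  let v : ℂ → Fin 3 → ℂ := fun t => ![φ (t ^ 2), t, 1]
  have hv : AnalyticAt ℂ v 0 := analyticAt_vec hφsq analyticAt_id analyticAt_const
  have htend : Tendsto (fun t : ℂ => t ^ 2) (𝓝 0) (𝓝 0) := by
    have := hsq.continuousAt.tendsto
    rwa [zero_pow two_ne_zero] at this
  obtain ⟨γ, hγ, hγv⟩ := exists_isLocalParameter (p := p) (τ := fun q => ratio 1 2 q) hv
    (linearIndependent_of_components hv (i := 2) (j := 1) one_ne_zero
      (Or.inr (deriv_const _ _))
      (by change deriv (fun t => t) 0 ≠ 0; rw [deriv_id'']; exact one_ne_zero))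
    (by
      filter_upwards [htend.eventually hφr] with t ht h
      change affinePoint _ _ ∈ _
      rw [affinePoint_mem_curve, ht])
    ⟨affine_ne_zero _ _, by
      refine (eq_affinePoint hp).trans ?_
      simp only [v, zero_pow two_ne_zero, hφ0, hy0]
      rfl⟩
    (continuousAt_ratio_val hp) hy0 (by
      filter_upwards [(continuousAt_ratio_val hp).eventually hφl, eventually_rep_ne_zero hp]
        with q hq hq2
      refine ⟨affine_ne_zero _ _, (eq_affinePoint hq2).trans ?_⟩
      simp only [v, sq_eq_cubic q.2 hq2, hq]
      rfl)
  refine ⟨γ, hγ, fun t => φ (t ^ 2), hφsq, by simp only [zero_pow two_ne_zero, hφ0], ?_, ?_⟩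
  · have h := AnalyticAt.analyticOrderAt_comp (f := fun s => φ s - φ 0)
      (g := fun t : ℂ => t ^ 2) (z₀ := 0) (by
        rw [zero_pow two_ne_zero]; exact hφan.sub analyticAt_const) hsq
    rw [zero_pow two_ne_zero, hφan.analyticOrderAt_sub_eq_one_of_deriv_ne_zero hφ', one_mul] at h
    simp only [zero_pow two_ne_zero, sub_zero] at h ⊢
    refine h.trans ?_
    have h2 := analyticOrderAt_pow (𝕜 := ℂ) (analyticAt_id (𝕜 := ℂ) (z := (0 : ℂ))) 2
    rw [analyticOrderAt_id] at h2
    rw [nsmul_one] at h2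
    exact h2
  · filter_upwards [hγv] with t ht
    obtain ⟨h, ht⟩ := ht
    rw [ht]
    exact ⟨rep_affinePoint _ _, ratio_affinePoint_zero _ _⟩

/-- Put `x = t⁻²` and `y = t⁻³ H(t²)` with `H(s)² = (1 - e₁ s)(1 - e₂ s)(1 - e₃ s)`; after
multiplication by `t³` the point is `[t, H(t²), t³]`, regular at `t = 0`. -/
theorem exists_parameter_infty (p : curve e₁ e₂ e₃) (hp : (p : P2).rep 2 = 0) :
    ∃ γ : ℂ → curve e₁ e₂ e₃, IsLocalParameter p γ ∧
      ∀ᶠ t in 𝓝 0, ((γ t : P2).rep 2 = 0 ↔ t = 0) ∧ ratio 0 2 (γ t) = (t ^ 2)⁻¹ := by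
  have hp' : (p : P2) = inftyPoint := eq_inftyPoint p.2 hp
  have hp1 : (p : P2).rep 1 ≠ 0 := by
    rw [hp', inftyPoint, Ne, rep_mk_eq_zero_iff]; simp
  obtain ⟨H, hH, hH0, hH2⟩ := exists_analytic_sqrt (z := 0)
    (g := fun s : ℂ => (1 - e₁ * s) * (1 - e₂ * s) * (1 - e₃ * s)) (by fun_prop) (by simp)
  have hsq : AnalyticAt ℂ (fun t : ℂ => t ^ 2) 0 := by fun_prop
  have hHsq : AnalyticAt ℂ (fun t => H (t ^ 2)) 0 :=
    AnalyticAt.fun_comp (g := H) (f := fun t : ℂ => t ^ 2) (by simpa using hH) hsq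
  let v : ℂ → Fin 3 → ℂ := fun t => ![t, H (t ^ 2), t ^ 3]
  have hv : AnalyticAt ℂ v 0 := analyticAt_vec analyticAt_id hHsq (by fun_prop)
  -- With `u = x/y` and `w = 1/y` the curve reads `w D(u, w) = u³`. Hence `S = u² / D` extends `1/x
  -- = w/u = t²` continuously across the point at infinity, and `t = u H(S)` is recovered from it.
  let D : ℂ → ℂ → ℂ := fun u w => 1 + (e₁ + e₂ + e₃) * u ^ 2 -
    (e₁ * e₂ + e₁ * e₃ + e₂ * e₃) * u * w + e₁ * e₂ * e₃ * w ^ 2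
  let S : curve e₁ e₂ e₃ → ℂ := fun q => ratio 0 1 q ^ 2 / D (ratio 0 1 q) (ratio 2 1 q)
  have hu : ContinuousAt (fun q : curve e₁ e₂ e₃ => ratio 0 1 q) p := continuousAt_ratio_val hp1
  have hw : ContinuousAt (fun q : curve e₁ e₂ e₃ => ratio 2 1 q) p := continuousAt_ratio_val hp1
  have hu0 : ratio 0 1 p = 0 := by rw [hp', inftyPoint, ratio_mk]; simp
  have hw0 : ratio 2 1 p = 0 := by rw [hp', inftyPoint, ratio_mk]; simp
  have hD : ContinuousAt (fun q : curve e₁ e₂ e₃ => D (ratio 0 1 q) (ratio 2 1 q)) p :=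
    ((continuousAt_const.add (continuousAt_const.mul (hu.pow 2))).sub
      ((continuousAt_const.mul hu).mul hw)).add (continuousAt_const.mul (hw.pow 2))
  have hD0 : D (ratio 0 1 p) (ratio 2 1 p) = 1 := by simp [D, hu0, hw0]
  have hS : ContinuousAt S p := (hu.pow 2).div hD (by rw [hD0]; exact one_ne_zero)
  have hS0 : S p = 0 := by simp [S, hu0]
  have hHS : ContinuousAt (fun q => H (S q)) p := by
    refine ContinuousAt.comp (g := H) ?_ hS
    rw [hS0]
    exact hH.continuousAt
  obtain ⟨γ, hγ, hγv⟩ := exists_isLocalParameter (p := p)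
    (τ := fun q => ratio 0 1 q * H (S q)) hv
    (linearIndependent_of_components hv (i := 1) (j := 0)
      (by simp [v, hH0]) (Or.inl rfl)
      (by change deriv (fun t => t) 0 ≠ 0; rw [deriv_id'']; exact one_ne_zero))
    (Eventually.of_forall fun t h => by
      rw [mk_mem_curve]
      simp only [v, Matrix.cons_val_zero, Matrix.cons_val_one, Matrix.cons_val]
      rw [hH2]
      ring)
    ⟨fun h => by simpa [v, hH0] using congrFun h 1, by
      rw [hp', inftyPoint]
      congr 1
      simp [v, hH0]⟩
    (hu.mul hHS) (by simp [hu0]) (by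
      have hHne : ∀ᶠ q in 𝓝 p, H (S q) ≠ 0 := hHS.eventually_ne (by simp [hS0, hH0])
      have hDne : ∀ᶠ q : curve e₁ e₂ e₃ in 𝓝 p, D (ratio 0 1 q) (ratio 2 1 q) ≠ 0 :=
        hD.eventually_ne (by rw [hD0]; exact one_ne_zero)
      filter_upwards [eventually_rep_ne_zero hp1, hHne, hDne] with q hq1 hq2 hq3
      have hqmem := q.2
      rw [eq_mk_of_rep_one_ne_zero hq1, mk_mem_curve] at hqmem
      simp only [Matrix.cons_val_zero, Matrix.cons_val_one, Matrix.cons_val, one_pow,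
        one_mul] at hqmem
      set u := ratio 0 1 q
      set w := ratio 2 1 q
      have h1 : w = u * S q := by
        simp only [S]
        rw [← mul_div_assoc, eq_div_iff hq3]
        simp only [D]
        linear_combination hqmem
      have h2 : (u * H (S q)) ^ 2 = S q := by
        by_cases h0 : u = 0
        · simp [S, u, h0]
        · rw [mul_pow, hH2]
          apply mul_left_cancel₀ h0
          rw [← h1]
          conv_rhs => rw [hqmem, h1]
          ring
      have hne : v (u * H (S q)) ≠ 0 := fun h => hq2 (by
        have := congrFun h 1
        simpa [v, h2] using this)
      refine ⟨hne, (eq_mk_of_rep_one_ne_zero hq1).trans ?_⟩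
      rw [Projectivization.mk_eq_mk_iff']
      refine ⟨(H (S q))⁻¹, funext fun i => ?_⟩
      fin_cases i
      · simp [v]
        field_simp
        rfl
      · simp [v, h2, hq2]
      · simp only [v, Fin.reduceFinMk, Pi.smul_apply, Matrix.cons_val, smul_eq_mul]
        rw [pow_succ, h2]
        change _ = w
        rw [h1]
        field_simp)
  refine ⟨γ, hγ, ?_⟩
  filter_upwards [hγv] with t ht
  obtain ⟨h, ht⟩ := ht
  rw [ht, rep_mk_eq_zero_iff, ratio_mk]
  refine ⟨by simp [v], ?_⟩
  simp only [v, Matrix.cons_val_zero, Matrix.cons_val]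
  by_cases h0 : t = 0
  · simp [h0]
  · field_simp

end Curve

/-! ### Ramification of polynomials on cubic curves -/

section Curve

variable {e₁ e₂ e₃ : ℂ}

theorem polyFun_of_ne {X : Set P2} (P : ℂ[X]) {p : X} (hp : (p : P2).rep 2 ≠ 0) :
    polyFun P p = fin (P.eval (ratio 0 2 p)) := if_neg hp

theorem polyFun_of_eq {X : Set P2} (P : ℂ[X]) {p : X} (hp : (p : P2).rep 2 = 0) :
    polyFun P p = infty := if_pos hp

theorem analyticAt_eval (P : ℂ[X]) (x : ℂ) : AnalyticAt ℂ (fun z => P.eval z) x :=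
  P.differentiable.analyticAt x

theorem analyticAt_eval_sub (P : ℂ[X]) (x c : ℂ) : AnalyticAt ℂ (fun z => P.eval z - c) x :=
  (analyticAt_eval P x).sub analyticAt_const

theorem hasRamificationOrder_of_parameter {X : Set P2} {P : ℂ[X]} {p : X}
    {m n : ℕ} (hm : m ≠ 0) (hn : n ≠ 0)
    (hP : analyticOrderAt (fun z => P.eval z - P.eval (ratio 0 2 p)) (ratio 0 2 p) = m)
    (h : ∃ γ : ℂ → X, IsLocalParameter p γ ∧ ∃ x : ℂ → ℂ, AnalyticAt ℂ x 0 ∧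
      x 0 = ratio 0 2 p ∧ analyticOrderAt (fun t => x t - x 0) 0 = n ∧
      ∀ᶠ t in 𝓝 0, (γ t : P2).rep 2 ≠ 0 ∧ ratio 0 2 (γ t) = x t) :
    HasRamificationOrder (polyFun P) p (m * n) := by
  obtain ⟨γ, hγ, x, hx, hx0, hord, hγx⟩ := h
  have hPan : AnalyticAt ℂ (fun z => P.eval z - P.eval (ratio 0 2 p)) (x 0) :=
    analyticAt_eval_sub P _ _
  refine ⟨Nat.pos_of_ne_zero (mul_ne_zero hm hn), γ, hγ,
    fun t => P.eval (x t) - P.eval (ratio 0 2 p), hPan.fun_comp hx, ?_,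
    Or.inl ⟨P.eval (ratio 0 2 p), ?_⟩⟩
  · have h := AnalyticAt.analyticOrderAt_comp (f := fun z => P.eval z - P.eval (ratio 0 2 p))
      (g := x) hPan hx
    rw [hord, hx0, hP] at h
    exact h.trans (by push_cast; rfl)
  · filter_upwards [hγx] with t ht
    rw [polyFun_of_ne P ht.1, ht.2, add_sub_cancel]

/-- At `x = t⁻²` the reciprocal of `P` is `t^(2 deg P)` divided by the reversed polynomial at `t²`,
whose value at 0 is the leading coefficient. -/
theorem hasRamificationOrder_infty {P : ℂ[X]} (hP : P.natDegree ≠ 0) (p : curve e₁ e₂ e₃)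
    (hp : (p : P2).rep 2 = 0) :
    HasRamificationOrder (polyFun P) p (2 * P.natDegree) := by
  obtain ⟨γ, hγ, hγt⟩ := exists_parameter_infty p hp
  have hrev : (P.reverse.eval ((0 : ℂ) ^ 2)) ≠ 0 := by
    rw [zero_pow two_ne_zero, ← coeff_zero_eq_eval_zero, coeff_zero_reverse, Ne,
      leadingCoeff_eq_zero]
    rintro rfl
    simp at hP
  have hden : AnalyticAt ℂ (fun t : ℂ => P.reverse.eval (t ^ 2)) 0 :=
    (analyticAt_eval P.reverse _).fun_comp (f := fun t : ℂ => t ^ 2) (by fun_prop)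
  have hnum : AnalyticAt ℂ (fun t : ℂ => t ^ (2 * P.natDegree)) 0 := by fun_prop
  have hinv : AnalyticAt ℂ (fun t : ℂ => (P.reverse.eval (t ^ 2))⁻¹) 0 := hden.inv hrev
  have hne : ∀ᶠ t in 𝓝 (0 : ℂ), P.reverse.eval (t ^ 2) ≠ 0 := hden.continuousAt.eventually_ne hrev
  refine ⟨by positivity, γ, hγ,
    fun t => t ^ (2 * P.natDegree) * (P.reverse.eval (t ^ 2))⁻¹, hnum.mul hinv, ?_, Or.inr ?_⟩
  · have h := analyticOrderAt_mul hnum hinv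
    have h2 := analyticOrderAt_pow (𝕜 := ℂ) (analyticAt_id (𝕜 := ℂ) (z := (0 : ℂ)))
      (2 * P.natDegree)
    rw [analyticOrderAt_id, nsmul_one] at h2
    rw [hinv.analyticOrderAt_eq_zero.2 (inv_ne_zero hrev), add_zero] at h
    exact h.trans h2
  · filter_upwards [hγt, hne] with t ht h
    by_cases h0 : t = 0
    · rw [polyFun_of_eq P (ht.1.2 h0), h0, zero_pow (by positivity), zero_mul, recip_zero]
    · rw [polyFun_of_ne P (mt ht.1.1 h0), ht.2, recip_of_ne
        (mul_ne_zero (pow_ne_zero _ h0) (inv_ne_zero h))]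
      congr 1
      let _ : Invertible (t ^ 2)⁻¹ := invertibleOfNonzero (inv_ne_zero (pow_ne_zero 2 h0))
      have := eval₂_reverse_mul_pow (RingHom.id ℂ) ((t ^ 2)⁻¹) P
      rw [invOf_eq_inv, inv_inv, eval₂_id, eval₂_id] at this
      rw [← this, mul_inv, inv_inv, pow_mul, inv_pow, mul_comm]

theorem analyticOrderAt_eval_sub {P : ℂ[X]} (hP : P.natDegree ≠ 0) (x : ℂ) :
    ∃ m : ℕ, m ≠ 0 ∧ analyticOrderAt (fun z => P.eval z - P.eval x) x = m := by
  have han : AnalyticAt ℂ (fun z => P.eval z - P.eval x) x := analyticAt_eval_sub P _ _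
  have htop : analyticOrderAt (fun z => P.eval z - P.eval x) x ≠ ⊤ := by
    intro h
    rw [analyticOrderAt_eq_top] at h
    have hinf : ((P - C (P.eval x)).rootSet ℂ).Infinite := by
      refine (infinite_of_mem_nhds x (h.mono fun z hz => ?_))
      change z ∈ (P - C (P.eval x)).rootSet ℂ
      rw [mem_rootSet_of_ne]
      · simpa using hz
      · intro h'
        rw [sub_eq_zero] at h'
        exact hP (by rw [h', natDegree_C])
    exact hinf (rootSet_finite _ _)
  obtain ⟨m, hm⟩ := ENat.ne_top_iff_exists.1 htop
  refine ⟨m, ?_, hm.symm⟩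
  rintro rfl
  exact (han.analyticOrderAt_ne_zero.2 (sub_self _)) hm.symm

theorem analyticOrderAt_eval_sub_eq_one {P : ℂ[X]} {x : ℂ} (h : P.derivative.eval x ≠ 0) :
    analyticOrderAt (fun z => P.eval z - P.eval x) x = 1 :=
  AnalyticAt.analyticOrderAt_sub_eq_one_of_deriv_ne_zero (analyticAt_eval P x)
    (by rwa [Polynomial.deriv])

/-- Ramification comes from the projection, over the `e_i` (where `P = 0`) and over ∞, or from a
critical point of `P`. The only pole is the point at infinity, which yields connectedness. -/
theorem isBelyi_polyFun (h12 : e₁ ≠ e₂) (h13 : e₁ ≠ e₃) (h23 : e₂ ≠ e₃) {P : ℂ[X]}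
    (hP : P.natDegree ≠ 0) (h1 : P.eval e₁ = 0) (h2 : P.eval e₂ = 0) (h3 : P.eval e₃ = 0)
    (hcrit : ∀ x, P.derivative.eval x = 0 → P.eval x = 0 ∨ P.eval x = 1) :
    IsBelyi (curve e₁ e₂ e₃) (polyFun P) := by
  have key : ∀ p : curve e₁ e₂ e₃, ∃ e : ℕ, HasRamificationOrder (polyFun P) p e ∧
      (e ≠ 1 → polyFun P p = fin 0 ∨ polyFun P p = fin 1 ∨ polyFun P p = infty) := by
    intro p
    by_cases hp : (p : P2).rep 2 = 0
    · exact ⟨_, hasRamificationOrder_infty hP p hp, fun _ => Or.inr (Or.inr (polyFun_of_eq P hp))⟩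
    obtain ⟨m, hm, hord⟩ := analyticOrderAt_eval_sub hP (ratio 0 2 p)
    by_cases hy : cubic e₁ e₂ e₃ (ratio 0 2 p) = 0
    · refine ⟨_, hasRamificationOrder_of_parameter hm two_ne_zero hord
        (exists_parameter_of_cubic_eq_zero h12 h13 h23 p hp hy), fun _ => Or.inl ?_⟩
      rw [polyFun_of_ne P hp]
      rw [cubic, mul_eq_zero, mul_eq_zero, sub_eq_zero, sub_eq_zero, sub_eq_zero] at hy
      rcases hy with (h | h) | h <;> rw [h] <;> simp [*]
    · refine ⟨_, hasRamificationOrder_of_parameter hm one_ne_zero hord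
        (exists_parameter_of_cubic_ne_zero p hp hy), fun he => ?_⟩
      have hd : P.derivative.eval (ratio 0 2 p) = 0 := by
        by_contra hd
        rw [analyticOrderAt_eval_sub_eq_one hd] at hord
        exact he (by rw [mul_one]; exact_mod_cast hord.symm)
      rw [polyFun_of_ne P hp]
      rcases hcrit _ hd with h | h
      · exact Or.inl (by rw [h])
      · exact Or.inr (Or.inl (by rw [h]))
  refine ⟨isCompact_curve, isConnected_of_hasRamificationOrder isCompact_curve
    (fun p => ⟨_, (key p).choose_spec.1⟩) ⟨_, inftyPoint_mem_curve⟩ ?_, key⟩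
  have : ∀ p : curve e₁ e₂ e₃, polyFun P p = infty → (p : P2) = inftyPoint := by
    intro p hp
    refine eq_inftyPoint p.2 (by_contra fun h => ?_)
    rw [polyFun_of_ne P h] at hp
    exact fin_ne_infty _ hp
  exact fun p q hp hq => Subtype.ext ((this p hp).trans (this q hq).symm)

theorem continuous_of_isBelyi {X : Set P2} {β : X → Sphere} (h : IsBelyi X β) : Continuous β :=
  continuous_iff_continuousAt.2 fun p => ((h.2.2 p).choose_spec.1.map_nhds).le

end Curve

/-! ### The Belyi polynomial -/

/-- The polynomial `β_{1,1} ∘ β_{10,1} ∘ f`. -/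
def belyiPoly : ℚ[X] := (betaPoly 1 1).comp ((betaPoly 10 1).comp f)

/-- The polynomial `β_{10,1} ∘ f`. -/
def innerPoly : ℚ[X] := (betaPoly 10 1).comp f

theorem innerPoly_eq : innerPoly = C (11 ^ 11 / 10 ^ 10) * f ^ 10 * (1 - f) := by
  simp only [innerPoly, betaPoly, mul_comp, C_comp, pow_comp, X_comp, sub_comp, one_comp, pow_one]
  norm_num

theorem belyiPoly_eq : belyiPoly = C 4 * innerPoly * (1 - innerPoly) := by
  rw [belyiPoly, ← innerPoly]
  simp only [betaPoly, mul_comp, C_comp, X_comp, sub_comp, one_comp, pow_one]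
  norm_num

theorem derivative_innerPoly :
    derivative innerPoly =
      C (11 ^ 11 / 10 ^ 10) * f ^ 9 * (C 10 - C 11 * f) * (C 12 * X ^ 10 * (X - 1)) := by
  rw [← derivative_f, innerPoly_eq]
  simp only [derivative_mul, derivative_C, derivative_pow, derivative_sub, derivative_one,
    map_ofNat, map_natCast]
  push_cast
  ring

theorem derivative_belyiPoly :
    derivative belyiPoly = C 4 * (1 - C 2 * innerPoly) * derivative innerPoly := by
  rw [belyiPoly_eq]
  simp only [derivative_mul, derivative_C, derivative_sub, derivative_one]
  simp only [map_ofNat]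
  ring

theorem natDegree_betaPoly {m n : ℕ} (hm : m ≠ 0) (hn : n ≠ 0) :
    (betaPoly m n).natDegree = m + n := by
  have h1 : (1 - X : ℚ[X]).natDegree = 1 := by
    rw [← neg_sub, natDegree_neg, ← C_1, natDegree_X_sub_C]
  have hc : ((m : ℚ) + n) ^ (m + n) / ((m : ℚ) ^ m * (n : ℚ) ^ n) ≠ 0 := by positivity
  rw [betaPoly, mul_assoc, natDegree_C_mul hc, natDegree_mul, natDegree_pow, natDegree_X, mul_one,
    natDegree_pow, h1, mul_one]
  · exact pow_ne_zero _ X_ne_zero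
  · exact pow_ne_zero _ fun h => by simp [h] at h1

theorem natDegree_belyiPoly : belyiPoly.natDegree ≠ 0 := by
  rw [belyiPoly, natDegree_comp, natDegree_comp, natDegree_f, natDegree_betaPoly, natDegree_betaPoly]
    <;> norm_num

/-- `β_{1,1} ∘ β_{10,1} ∘ f` as a complex polynomial. -/
def belyiC : ℂ[X] := belyiPoly.map (algebraMap ℚ ℂ)

theorem natDegree_belyiC : belyiC.natDegree ≠ 0 := by
  rw [belyiC, natDegree_map]
  exact natDegree_belyiPoly

/-- The function `f` on the complex numbers. -/
def fC (x : ℂ) : ℂ := x ^ 12 - 12 / 11 * x ^ 11 + 1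

/-- The function `β_{10,1} ∘ f` on the complex numbers. -/
def innerC (x : ℂ) : ℂ := 11 ^ 11 / 10 ^ 10 * fC x ^ 10 * (1 - fC x)

theorem aeval_innerPoly (x : ℂ) : aeval x innerPoly = innerC x := by
  rw [innerPoly_eq, innerC, fC, ← aeval_f]
  simp

theorem eval_belyiC (x : ℂ) : belyiC.eval x = 4 * innerC x * (1 - innerC x) := by
  rw [belyiC, eval_map_algebraMap, belyiPoly_eq, ← aeval_innerPoly]
  simp

theorem eval_derivative_belyiC (x : ℂ) :
    belyiC.derivative.eval x = 4 * (1 - 2 * innerC x) *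
      (11 ^ 11 / 10 ^ 10 * fC x ^ 9 * (10 - 11 * fC x) * (12 * x ^ 10 * (x - 1))) := by
  rw [belyiC, derivative_map, eval_map_algebraMap, derivative_belyiPoly, derivative_innerPoly,
    ← aeval_innerPoly, fC, ← aeval_f]
  simp

theorem innerC_of_fC_eq_zero {x : ℂ} (h : fC x = 0) : innerC x = 0 := by
  rw [innerC, h]; norm_num

theorem innerC_of_fC_eq {x : ℂ} (h : 10 - 11 * fC x = 0) : innerC x = 1 := by
  have : fC x = 10 / 11 := by linear_combination -h / 11
  rw [innerC, this]; norm_num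

theorem innerC_zero : innerC 0 = 0 := by
  norm_num [innerC, fC]

theorem innerC_one : innerC 1 = 1 := by
  norm_num [innerC, fC]

theorem belyiC_root {x : ℂ} (hx : x ∈ f.rootSet ℂ) : belyiC.eval x = 0 := by
  rw [eval_belyiC, innerC_of_fC_eq_zero (mem_rootSet_f.1 hx)]; ring

theorem belyiC_critical (x : ℂ) (hx : belyiC.derivative.eval x = 0) :
    innerC x = 0 ∨ innerC x = 1 ∨ innerC x = 1 / 2 := by
  rw [eval_derivative_belyiC] at hx
  simp only [mul_eq_zero, pow_eq_zero_iff, ne_eq, OfNat.ofNat_ne_zero, not_false_eq_true,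
    div_eq_zero_iff, false_or, or_self] at hx
  rcases hx with h | (h | h) | h | h
  · exact Or.inr (Or.inr (by linear_combination -h / 2))
  · exact Or.inl (innerC_of_fC_eq_zero h)
  · exact Or.inr (Or.inl (innerC_of_fC_eq h))
  · rw [h]; exact Or.inl innerC_zero
  · rw [sub_eq_zero.1 h]; exact Or.inr (Or.inl innerC_one)

theorem belyiC_critical_value (x : ℂ) (hx : belyiC.derivative.eval x = 0) :
    belyiC.eval x = 0 ∨ belyiC.eval x = 1 := by
  rw [eval_belyiC]
  rcases belyiC_critical x hx with h | h | h <;> rw [h] <;> norm_num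

/-- With `q` the inner polynomial, `4q(1 - q) - 1 = -4 (q - 1/2)²`. The value 1/2 is not critical
for `q`, so `q - 1/2` has a simple zero. -/
theorem analyticOrderAt_belyiC {x : ℂ} (hx : belyiC.eval x = 1) :
    analyticOrderAt (fun z => belyiC.eval z - belyiC.eval x) x = (2 : ℕ) := by
  have hhalf : innerC x = 1 / 2 := by
    rw [eval_belyiC] at hx
    have : (1 - 2 * innerC x) ^ 2 = 0 := by linear_combination -hx
    rw [pow_eq_zero_iff two_ne_zero] at this
    linear_combination -this / 2
  have hinner : ∀ z, (innerPoly.map (algebraMap ℚ ℂ)).eval z = innerC z := fun z => by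
    rw [eval_map_algebraMap, aeval_innerPoly]
  set Q := innerPoly.map (algebraMap ℚ ℂ) with hQ
  have hQ' : Q.derivative.eval x ≠ 0 := by
    rw [hQ, derivative_map, eval_map_algebraMap, derivative_innerPoly]
    simp only [map_mul, aeval_C, map_pow, map_sub, aeval_X, map_one, map_div₀, map_ofNat, aeval_f]
    rw [← fC]
    intro h
    simp only [mul_eq_zero, pow_eq_zero_iff, ne_eq, OfNat.ofNat_ne_zero, not_false_eq_true,
      div_eq_zero_iff, false_or, or_self] at h
    rcases h with (h | h) | h | h
    · rw [innerC_of_fC_eq_zero h] at hhalf; norm_num at hhalf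
    · rw [innerC_of_fC_eq h] at hhalf; norm_num at hhalf
    · rw [h, innerC_zero] at hhalf; norm_num at hhalf
    · rw [sub_eq_zero.1 h, innerC_one] at hhalf; norm_num at hhalf
  have h1 := analyticOrderAt_eval_sub_eq_one hQ'
  have han : AnalyticAt ℂ (fun z => Q.eval z - Q.eval x) x := analyticAt_eval_sub Q _ _
  have h2 := analyticOrderAt_mul (analyticAt_const (v := (-4 : ℂ)) (x := x)) (han.pow 2)
  rw [analyticOrderAt_pow han, h1, nsmul_one,
    (analyticAt_const (v := (-4 : ℂ)) (x := x)).analyticOrderAt_eq_zero.2 (by norm_num),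
    zero_add] at h2
  rw [← h2]
  congr 1
  funext z
  simp only [Pi.mul_apply, Pi.pow_apply, hinner, hhalf, hx, eval_belyiC]
  ring

theorem isCleanBelyi_belyiC {e₁ e₂ e₃ : ℂ} (h12 : e₁ ≠ e₂) (h13 : e₁ ≠ e₃) (h23 : e₂ ≠ e₃)
    (h1 : e₁ ∈ f.rootSet ℂ) (h2 : e₂ ∈ f.rootSet ℂ) (h3 : e₃ ∈ f.rootSet ℂ) :
    IsCleanBelyi (curve e₁ e₂ e₃) (polyFun belyiC) := by
  refine ⟨isBelyi_polyFun h12 h13 h23 natDegree_belyiC (belyiC_root h1) (belyiC_root h2)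
    (belyiC_root h3) belyiC_critical_value, fun p hp => ?_⟩
  have hp2 : (p : P2).rep 2 ≠ 0 := by
    intro h
    rw [polyFun_of_eq _ h] at hp
    exact fin_ne_infty _ hp.symm
  rw [polyFun_of_ne _ hp2] at hp
  have hx := fin_injective hp
  have hy : cubic e₁ e₂ e₃ (ratio 0 2 p) ≠ 0 := by
    intro hy
    rw [cubic, mul_eq_zero, mul_eq_zero, sub_eq_zero, sub_eq_zero, sub_eq_zero] at hy
    rcases hy with (h | h) | h <;> rw [h] at hx
    · rw [belyiC_root h1] at hx; exact zero_ne_one hx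
    · rw [belyiC_root h2] at hx; exact zero_ne_one hx
    · rw [belyiC_root h3] at hx; exact zero_ne_one hx
  exact hasRamificationOrder_of_parameter two_ne_zero one_ne_zero (analyticOrderAt_belyiC hx)
    (exists_parameter_of_cubic_ne_zero p hp2 hy)

/-! ### The pairs `(E, β)` -/

theorem beta_eq_polyFun (r : Labelling) (i j k : Fin 12) (p : E r i j k) :
    beta r i j k p = polyFun belyiC p := by
  by_cases hp : (p : P2).rep 2 = 0
  · rw [polyFun_of_eq _ hp]
    simp only [beta, proj, Function.comp, if_pos hp]
    rfl
  · rw [polyFun_of_ne _ hp]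
    simp only [beta, proj, Function.comp, if_neg hp]
    change fin _ = _
    rw [belyiC, eval_map_algebraMap, belyiPoly, aeval_comp, aeval_comp]
    rfl

theorem labelling_ne (r : Labelling) {i j : Fin 12} (h : i ≠ j) : (r i : ℂ) ≠ r j :=
  fun h' => h (r.injective (Subtype.ext h'))

theorem isCleanBelyi_beta (r : Labelling) {i j k : Fin 12} (h : Distinct i j k) :
    IsCleanBelyi (E r i j k) (beta r i j k) := by
  have hβ : beta r i j k = polyFun belyiC := funext (beta_eq_polyFun r i j k)
  rw [hβ]
  exact isCleanBelyi_belyiC (labelling_ne r h.1) (labelling_ne r h.2.1) (labelling_ne r h.2.2)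
    (r i).2 (r j).2 (r k).2

theorem points_pair (r : Labelling) (i j k : Fin 12) : (pair r i j k).points = E r i j k := by
  ext p
  change MvPolynomial.aeval p.rep (pair r i j k).curve = 0 ↔ _ = _
  have h : ∀ i, algebraMap K ℂ (root r i) = r i := fun i => rfl
  simp only [pair, map_sub, map_mul, map_pow, MvPolynomial.aeval_X, MvPolynomial.aeval_C, h]
  exact sub_eq_zero

theorem polyFun_continuousOn {X : Set P2} {P : ℂ[X]} (h : Continuous (polyFun (X := X) P)) :
    ContinuousOn (fun p : P2 => if p.rep 2 = 0 then infty else fin (P.eval (ratio 0 2 p))) X :=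
  continuousOn_iff_continuous_domRestrict.2 h

theorem aeval_num_pair (r : Labelling) (i j k : Fin 12) (p : P2) :
    MvPolynomial.aeval (affineCoords p) (pair r i j k).num = belyiC.eval (ratio 0 2 p) := by
  rw [belyiC, eval_map_algebraMap]
  change MvPolynomial.aeval (affineCoords p)
    (aeval (MvPolynomial.X 0 : MvPolynomial (Fin 2) K) belyiPoly) = _
  have h := aeval_algHom_apply ((MvPolynomial.aeval (R := K) (affineCoords p)).restrictScalars ℚ)
    (MvPolynomial.X 0 : MvPolynomial (Fin 2) K) belyiPoly
  refine h.symm.trans ?_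
  simp [affineCoords, ratio]

theorem function_pair (r : Labelling) {i j k : Fin 12} (hd : Distinct i j k) (p : E r i j k) :
    (pair r i j k).function p = beta r i j k p := by
  rw [beta_eq_polyFun]
  have hβ : beta r i j k = polyFun belyiC := funext (beta_eq_polyFun r i j k)
  have hcont : Continuous (polyFun (X := E r i j k) belyiC) := by
    rw [← hβ]
    exact continuous_of_isBelyi (isCleanBelyi_beta r hd).1
  have hcon := polyFun_continuousOn hcont
  have hA : {p | p ∈ (pair r i j k).points ∧ p.rep 2 ≠ 0 ∧
      MvPolynomial.aeval (affineCoords p) (pair r i j k).den ≠ 0} =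
      {p | p ∈ E r i j k ∧ p.rep 2 ≠ 0} := by
    ext p
    rw [points_pair]
    simp [pair]
  rw [AlgebraicPair.function, hA]
  apply extendFrom_eq
  · by_cases hp : (p : P2).rep 2 = 0
    · obtain ⟨γ, ⟨hγ0, hγ, -⟩, hγt⟩ := exists_parameter_infty (e₁ := r i) (e₂ := r j) (e₃ := r k)
        p hp
      have h1 : Tendsto (fun t => (γ t : P2)) (𝓝[≠] 0) (𝓝 p) :=
        (continuous_subtype_val.tendsto p).comp ((show Tendsto γ (𝓝 0) (𝓝 p) from hγ.le).mono_left
          nhdsWithin_le_nhds)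
      refine mem_closure_of_tendsto h1 ?_
      filter_upwards [hγt.filter_mono nhdsWithin_le_nhds, self_mem_nhdsWithin] with t ht h0
      exact ⟨(γ t).2, mt ht.1.1 h0⟩
    · exact subset_closure ⟨p.2, hp⟩
  · refine ((hcon p p.2).mono_left (nhdsWithin_mono _ fun q hq => hq.1)).congr' ?_
    filter_upwards [self_mem_nhdsWithin] with q hq
    rw [if_neg hq.2, aeval_num_pair]
    simp [pair]

theorem exists_isElliptic (r : Labelling) {i j k : Fin 12} (hd : Distinct i j k) :
    ∃ W : WeierstrassCurve K, W.IsElliptic ∧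
      WeierstrassCurve.Projective.polynomial W = (pair r i j k).curve := by
  set x := root r i with hx
  set y := root r j with hy
  set z := root r k with hz
  refine ⟨⟨0, -(x + y + z), 0, x * y + x * z + y * z, -(x * y * z)⟩, ⟨?_⟩, ?_⟩
  · rw [isUnit_iff_ne_zero]
    have h : (⟨0, -(x + y + z), 0, x * y + x * z + y * z, -(x * y * z)⟩ : WeierstrassCurve K).Δ =
        16 * ((x - y) * (x - z) * (y - z)) ^ 2 := by
      simp only [WeierstrassCurve.Δ, WeierstrassCurve.b₂, WeierstrassCurve.b₄,
        WeierstrassCurve.b₆, WeierstrassCurve.b₈]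
      ring
    rw [h]
    have h1 : x - y ≠ 0 := sub_ne_zero.2 ((root_injective r).ne hd.1)
    have h2 : x - z ≠ 0 := sub_ne_zero.2 ((root_injective r).ne hd.2.1)
    have h3 : y - z ≠ 0 := sub_ne_zero.2 ((root_injective r).ne hd.2.2)
    exact mul_ne_zero (by norm_num) (pow_ne_zero 2 (mul_ne_zero (mul_ne_zero h1 h2) h3))
  · simp only [WeierstrassCurve.Projective.polynomial, pair, ← hx, ← hy, ← hz, map_zero, map_neg,
      map_add, map_mul]
    ring

/-- The function has rational coefficients and is fixed; only the roots in the equation of the curve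
move. -/
theorem conj_pair (r : Labelling) (σ : G) (i j k : Fin 12) :
    (pair r i j k).conj σ =
      pair r (galEquiv r σ i) (galEquiv r σ j) (galEquiv r σ k) := by
  have h : ∀ i, (σ : K →+* K) (root r i) = root r (galEquiv r σ i) := galEquiv_apply r σ
  have hnum : MvPolynomial.map (σ : K →+* K) (pair r i j k).num = (pair r i j k).num := by
    change MvPolynomial.map (σ : K →+* K)
      (aeval (MvPolynomial.X 0 : MvPolynomial (Fin 2) K) belyiPoly) =
      aeval (MvPolynomial.X 0 : MvPolynomial (Fin 2) K) belyiPoly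
    rw [aeval_def, hom_eval₂, MvPolynomial.map_X]
    congr 1
    exact RingHom.ext_rat _ _
  rw [AlgebraicPair.conj, hnum]
  simp only [pair, map_sub, map_mul, map_pow, MvPolynomial.map_X, MvPolynomial.map_C, h, map_one]

theorem dessin_congr {X Y : Set P2} (h : X = Y) {β : P2 → Sphere} {β' : Y → Sphere}
    (hβ : ∀ p : Y, β p = β' p) : dessin X (fun p => β p) = dessin Y β' := by
  subst h
  rw [show (fun p : X => β p) = β' from funext hβ]

theorem toClass_dessin_pair (r : Labelling) {i j k : Fin 12} (hd : Distinct i j k) :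
    (pair r i j k).dessin.toClass = dessinClass r i j k := by
  rw [AlgebraicPair.dessin, dessin_congr (points_pair r i j k) (function_pair r hd)]
  rfl

/-! ### Growth of holomorphic functions -/

theorem norm_eval_le (P : ℂ[X]) {d : ℕ} (hd : P.natDegree ≤ d) {w : ℂ} {s : ℝ} (hs : 1 ≤ s)
    (hw : ‖w‖ ≤ s) : ‖P.eval w‖ ≤ (∑ i ∈ P.support, ‖P.coeff i‖) * s ^ d := by
  rw [eval_eq_sum, Polynomial.sum, Finset.sum_mul]
  refine (norm_sum_le _ _).trans (Finset.sum_le_sum fun i hi => ?_)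
  rw [norm_mul, norm_pow]
  gcongr ?_ * ?_
  calc ‖w‖ ^ i ≤ s ^ i := by gcongr
    _ ≤ s ^ d := pow_le_pow_right₀ hs ((le_natDegree_of_mem_supp i hi).trans hd)

/-- If `|w|` exceeds `1 + |x|`, the leading term of `P(w) = P(x)` is bounded by a constant times `(1
+ |x|) |w|^(d)` with `d = deg P - 1`. -/
theorem exists_norm_le_of_eval_eq {P : ℂ[X]} (hP : P.natDegree ≠ 0) :
    ∃ C : ℝ, 0 ≤ C ∧ ∀ w x, P.eval w = P.eval x → ‖w‖ ≤ C * (1 + ‖x‖) := by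
  obtain ⟨d, hd⟩ := Nat.exists_eq_succ_of_ne_zero hP
  set A := ∑ i ∈ P.support, ‖P.coeff i‖
  set A' := ∑ i ∈ P.eraseLead.support, ‖P.eraseLead.coeff i‖
  have hA : 0 ≤ A := Finset.sum_nonneg fun i _ => norm_nonneg _
  have hA' : 0 ≤ A' := Finset.sum_nonneg fun i _ => norm_nonneg _
  have hl : 0 < ‖P.leadingCoeff‖ := norm_pos_iff.2 (leadingCoeff_ne_zero.2 (by
    rintro rfl; simp at hP))
  refine ⟨1 + (A + A') / ‖P.leadingCoeff‖, by positivity, fun w x h => ?_⟩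
  have hx : 1 ≤ 1 + ‖x‖ := by linarith [norm_nonneg x]
  set s := 1 + ‖x‖
  by_cases hw : ‖w‖ ≤ s
  · calc ‖w‖ ≤ 1 * s := by rwa [one_mul]
      _ ≤ _ := by
        gcongr
        exact le_add_of_nonneg_right (by positivity)
  · have hw' : s < ‖w‖ := not_le.1 hw
    have hw1 : 1 ≤ ‖w‖ := hx.trans hw'.le
    have h1 : ‖P.eval x‖ ≤ A * s ^ (d + 1) :=
      norm_eval_le P hd.le hx (by linarith)
    have h2 : ‖P.eraseLead.eval w‖ ≤ A' * ‖w‖ ^ d :=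
      norm_eval_le _ ((eraseLead_natDegree_le P).trans (by omega)) hw1 le_rfl
    have h3 : P.leadingCoeff * w ^ (d + 1) = P.eval x - P.eraseLead.eval w := by
      have := congrArg (eval w) P.eraseLead_add_C_mul_X_pow
      rw [hd, eval_add, eval_mul, eval_C, eval_pow, eval_X] at this
      rw [← h, ← this, add_sub_cancel_left]
    have h4 : ‖P.leadingCoeff‖ * ‖w‖ * ‖w‖ ^ d ≤ (A + A') * s * ‖w‖ ^ d := by
      calc ‖P.leadingCoeff‖ * ‖w‖ * ‖w‖ ^ d = ‖P.leadingCoeff * w ^ (d + 1)‖ := by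
            rw [norm_mul, norm_pow]; ring
        _ ≤ ‖P.eval x‖ + ‖P.eraseLead.eval w‖ := by rw [h3]; exact norm_sub_le _ _
        _ ≤ A * s ^ (d + 1) + A' * ‖w‖ ^ d := add_le_add h1 h2
        _ ≤ A * (s * ‖w‖ ^ d) + A' * (s * ‖w‖ ^ d) := by
            have e1 : s ^ (d + 1) ≤ s * ‖w‖ ^ d := by
              rw [pow_succ']
              gcongr
            have e2 : ‖w‖ ^ d ≤ s * ‖w‖ ^ d := le_mul_of_one_le_left (by positivity) hx
            gcongr
        _ = (A + A') * s * ‖w‖ ^ d := by ring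
    have h5 : ‖P.leadingCoeff‖ * ‖w‖ ≤ (A + A') * s :=
      le_of_mul_le_mul_right h4 (by positivity)
    calc ‖w‖ ≤ (A + A') * s / ‖P.leadingCoeff‖ := by rwa [le_div_iff₀ hl, mul_comm]
      _ = (A + A') / ‖P.leadingCoeff‖ * s := by ring
      _ ≤ _ := by
        gcongr
        linarith

/-- An entire function of growth order less than `n` is a polynomial of degree less than `n`. -/
theorem exists_eq_eval_of_growth {T : ℂ → ℂ} (hT : Differentiable ℂ T) {C : ℝ} {m n : ℕ}
    (hmn : m < 2 * n) (hC : ∀ x, ‖T x‖ ^ 2 ≤ C * (1 + ‖x‖) ^ m) :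
    ∃ p : ℂ[X], p.degree < n ∧ ∀ x, T x = p.eval x := by
  have hC0 : 0 ≤ C := by
    have := (sq_nonneg _).trans (hC 0)
    simpa using this
  have key : ∀ k, n ≤ k → iteratedDeriv k T 0 = 0 := by
    intro k hk
    set D := ‖iteratedDeriv k T 0‖ with hD
    -- The Cauchy estimate, squared so that half-integral growth is allowed. Since `m + 1 ≤ 2k`, a
    -- factor `R` is left over and forces `D = 0`.
    have h1 : ∀ R : ℝ, 1 ≤ R → D ^ 2 * R ≤ (k.factorial : ℝ) ^ 2 * (C * 2 ^ m) := by
      intro R hR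
      have hR0 : 0 < R := by linarith
      have h2 : D ≤ k.factorial * √(C * (1 + R) ^ m) / R ^ k := by
        refine Complex.norm_iteratedDeriv_le_of_forall_mem_sphere_norm_le k hR0
          hT.diffContOnCl fun z hz => ?_
        rw [mem_sphere_zero_iff_norm] at hz
        refine Real.le_sqrt_of_sq_le ?_
        rw [← hz]
        exact hC z
      have h3 : D ^ 2 * (R ^ (2 * k)) ≤ (k.factorial : ℝ) ^ 2 * (C * (1 + R) ^ m) := by
        rw [le_div_iff₀ (by positivity)] at h2
        have h4 := pow_le_pow_left₀ (by positivity) h2 2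
        rwa [mul_pow, mul_pow, Real.sq_sqrt (by positivity), ← pow_mul, mul_comm k 2] at h4
      have h5 : R * R ^ m ≤ R ^ (2 * k) := by
        rw [← pow_succ']
        exact pow_le_pow_right₀ hR (by omega)
      have h6 : (1 + R) ^ m ≤ 2 ^ m * R ^ m := by
        rw [← mul_pow]
        gcongr
        linarith
      refine le_of_mul_le_mul_right (a := R ^ m) ?_ (by positivity)
      calc D ^ 2 * R * R ^ m = D ^ 2 * (R * R ^ m) := by ring
        _ ≤ D ^ 2 * R ^ (2 * k) := by gcongr
        _ ≤ (k.factorial : ℝ) ^ 2 * (C * (1 + R) ^ m) := h3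
        _ ≤ (k.factorial : ℝ) ^ 2 * (C * (2 ^ m * R ^ m)) := by gcongr
        _ = _ := by ring
    by_contra hne
    have hpos : 0 < D ^ 2 := by positivity
    set B := (k.factorial : ℝ) ^ 2 * (C * 2 ^ m)
    have hB : 0 ≤ B := by positivity
    have h7 := h1 (B / D ^ 2 + 1) (le_add_of_nonneg_left (by positivity))
    rw [mul_add, mul_div_cancel₀ _ hpos.ne'] at h7
    linarith
  refine ⟨∑ i ∈ Finset.range n, Polynomial.C ((i.factorial : ℂ)⁻¹ * iteratedDeriv i T 0) * X ^ i, ?_, ?_⟩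
  · rw [← mem_degreeLT]
    refine Submodule.sum_mem _ fun i hi => mem_degreeLT.2 ((degree_C_mul_X_pow_le _ _).trans_lt ?_)
    exact_mod_cast Finset.mem_range.1 hi
  · intro x
    rw [← Complex.taylorSeries_eq_of_entire' (c := 0) (z := x) hT, tsum_eq_sum (s := Finset.range n)]
    · simp [eval_finsetSum]
    · intro i hi
      rw [key i (by simpa using hi)]
      simp

/-- A function continuous on the plane and holomorphic off a finite set is entire. -/
theorem differentiable_of_finite {T : ℂ → ℂ} (hT : Continuous T) {B : Set ℂ} (hB : B.Finite)
    (hd : ∀ x ∉ B, DifferentiableAt ℂ T x) : Differentiable ℂ T := by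
  intro c
  refine (Complex.analyticAt_of_differentiable_on_punctured_nhds_of_continuousAt ?_
    hT.continuousAt).differentiableAt
  have h : ∀ᶠ z in 𝓝 c, z ∉ B \ {c} :=
    (hB.subset Set.sdiff_subset).isClosed.isOpen_compl.mem_nhds (by simp)
  filter_upwards [h.filter_mono nhdsWithin_le_nhds, self_mem_nhdsWithin] with z h1 h2
  exact hd z fun h => h1 ⟨h, h2⟩

section Curve

variable {e₁ e₂ e₃ : ℂ}

/-! ### Functions on the affine part of a cubic curve -/

/-- Through each point of the affine curve passes a continuous section of `x`. At a zero of the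
cubic any square root will do, since `|s|² = |cubic|` tends to 0. -/
theorem exists_branch {x₀ y₀ : ℂ} (h : y₀ ^ 2 = cubic e₁ e₂ e₃ x₀) :
    ∃ s : ℂ → ℂ, ContinuousAt s x₀ ∧ s x₀ = y₀ ∧ (∀ t, s t ^ 2 = cubic e₁ e₂ e₃ t) ∧
      (cubic e₁ e₂ e₃ x₀ ≠ 0 → AnalyticAt ℂ s x₀) := by
  by_cases h0 : cubic e₁ e₂ e₃ x₀ = 0
  · let s : ℂ → ℂ := fun t => cubic e₁ e₂ e₃ t ^ ((2 : ℕ) : ℂ)⁻¹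
    have hs : ∀ t, s t ^ 2 = cubic e₁ e₂ e₃ t := fun t => Complex.cpow_nat_inv_pow _ two_ne_zero
    have hs0 : s x₀ = 0 := by
      rw [← sq_eq_zero_iff, hs, h0]
    refine ⟨s, ?_, ?_, hs, fun h' => absurd h0 h'⟩
    · rw [ContinuousAt, hs0, tendsto_zero_iff_norm_tendsto_zero]
      have h1 : ∀ t, ‖s t‖ = √‖cubic e₁ e₂ e₃ t‖ := fun t => by
        rw [← hs, norm_pow, Real.sqrt_sq (norm_nonneg _)]
      have h2 : ContinuousAt (fun t => √‖cubic e₁ e₂ e₃ t‖) x₀ :=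
        (analyticAt_cubic x₀).continuousAt.norm.sqrt
      have h3 := h2.tendsto
      simp only [h0, norm_zero, Real.sqrt_zero] at h3
      exact h3.congr fun t => (h1 t).symm
    · rw [hs0]
      rw [h0] at h
      exact (sq_eq_zero_iff.1 h).symm
  · obtain ⟨s, hs, hs1, hs2⟩ := exists_analytic_sqrt (z := x₀)
      (g := fun t => cubic e₁ e₂ e₃ t / cubic e₁ e₂ e₃ x₀)
      ((analyticAt_cubic x₀).div analyticAt_const h0) (div_self h0)
    have han : AnalyticAt ℂ (fun t => y₀ * s t) x₀ := analyticAt_const.mul hs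
    refine ⟨fun t => y₀ * s t, han.continuousAt, by simp [hs1], fun t => ?_, fun _ => han⟩
    rw [mul_pow, hs2, h, mul_div_cancel₀ _ h0]

/-- An even function on the curve is a function of `x`; if it is holomorphic off finitely many
fibres and of polynomial growth, it is a polynomial in `x`. -/
theorem exists_eq_eval_of_even {H : ℂ → ℂ → ℂ}
    (hH : ContinuousOn (fun p : ℂ × ℂ => H p.1 p.2) {p | p.2 ^ 2 = cubic e₁ e₂ e₃ p.1})
    (heven : ∀ x y, H x (-y) = H x y) {B : Set ℂ} (hB : B.Finite)
    (hd : ∀ s : ℂ → ℂ, (∀ t, s t ^ 2 = cubic e₁ e₂ e₃ t) → ∀ x ∉ B, AnalyticAt ℂ s x →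
      DifferentiableAt ℂ (fun t => H t (s t)) x)
    {C : ℝ} {m n : ℕ} (hmn : m < 2 * n)
    (hC : ∀ x y, y ^ 2 = cubic e₁ e₂ e₃ x → ‖H x y‖ ^ 2 ≤ C * (1 + ‖x‖) ^ m) :
    ∃ p : ℂ[X], p.degree < n ∧ ∀ x y, y ^ 2 = cubic e₁ e₂ e₃ x → H x y = p.eval x := by
  let s : ℂ → ℂ := fun t => cubic e₁ e₂ e₃ t ^ ((2 : ℕ) : ℂ)⁻¹
  have hs : ∀ t, s t ^ 2 = cubic e₁ e₂ e₃ t := fun t => Complex.cpow_nat_inv_pow _ two_ne_zero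
  have hHs : ∀ x y, y ^ 2 = cubic e₁ e₂ e₃ x → H x y = H x (s x) := by
    intro x y hy
    rcases sq_eq_sq_iff_eq_or_eq_neg.1 (hy.trans (hs x).symm) with h | h
    · rw [h]
    · rw [h, heven]
  -- The global root `s` may jump in sign. By evenness it may be replaced near each point by a
  -- continuous branch.
  have hcont : Continuous fun x => H x (s x) := by
    refine continuous_iff_continuousAt.2 fun x₀ => ?_
    obtain ⟨S, hS, hS0, hS2, -⟩ := exists_branch (hs x₀)
    have h1 : ContinuousAt (fun x => H x (S x)) x₀ := by
      have h2 := hH (x₀, S x₀) (hS2 x₀)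
      rw [← continuousWithinAt_univ]
      exact ContinuousWithinAt.comp (f := fun x => (x, S x)) h2
        ((continuousAt_id.prodMk hS).continuousWithinAt) fun x _ => hS2 x
    exact h1.congr (Eventually.of_forall fun x => hHs x _ (hS2 x))
  have hdiff : Differentiable ℂ fun x => H x (s x) := by
    refine differentiable_of_finite hcont (B := B ∪ {e₁, e₂, e₃})
      (hB.union (Set.toFinite _)) fun x hx => ?_
    rw [Set.mem_union, not_or] at hx
    obtain ⟨S, -, -, hS2, han⟩ := exists_branch (hs x)
    have h0 : cubic e₁ e₂ e₃ x ≠ 0 := by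
      intro h
      rw [cubic, mul_eq_zero, mul_eq_zero, sub_eq_zero, sub_eq_zero, sub_eq_zero] at h
      exact hx.2 (by simpa [or_assoc] using h)
    refine (hd S hS2 x hx.1 (han h0)).congr_of_eventuallyEq (Eventually.of_forall fun t => ?_)
    exact (hHs t _ (hS2 t)).symm
  obtain ⟨p, hp, hp'⟩ := exists_eq_eval_of_growth hdiff hmn fun x => hC x _ (hs x)
  exact ⟨p, hp, fun x y hy => (hHs x y hy).trans (hp' x)⟩

/-- A continuous solution `g` of `P(g(x)) = P(x)` is differentiable away from the critical values of `P`. -/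
theorem differentiableAt_of_eval_eq {P : ℂ[X]} {g : ℂ → ℂ} {x : ℂ} (hg : ContinuousAt g x)
    (h : ∀ t, P.eval (g t) = P.eval t) (hP : P.derivative.eval (g x) ≠ 0) :
    DifferentiableAt ℂ g x := by
  have hstrict : HasStrictDerivAt (fun z => P.eval z) (P.derivative.eval (g x)) (g x) :=
    P.hasStrictDerivAt _
  have hl : ∀ᶠ w in 𝓝 (g x), hstrict.localInverse _ _ _ hP (P.eval w) = w :=
    (hstrict.hasStrictFDerivAt_equiv hP).eventually_left_inverse
  have hd := (hstrict.to_localInverse hP).hasDerivAt.differentiableAt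
  rw [h] at hd
  refine (hd.comp x P.differentiableAt).congr_of_eventuallyEq ?_
  filter_upwards [hg.eventually hl] with t ht
  rw [h] at ht
  exact ht.symm

/-- `F(x, y) + F(x, -y)` depends only on `x` and grows linearly, so it is affine. `(F(x, y) - F(x,
-y)) y` grows like `|x|^(5/2)`, so it is a polynomial of degree at most 2; it vanishes at the three
branch points and is zero. -/
theorem exists_affine_of_eval_eq (h12 : e₁ ≠ e₂) (h13 : e₁ ≠ e₃) (h23 : e₂ ≠ e₃) {P : ℂ[X]}
    (hP : P.natDegree ≠ 0) {F : ℂ → ℂ → ℂ}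
    (hF : ContinuousOn (fun p : ℂ × ℂ => F p.1 p.2) {p | p.2 ^ 2 = cubic e₁ e₂ e₃ p.1})
    (h : ∀ x y, y ^ 2 = cubic e₁ e₂ e₃ x → P.eval (F x y) = P.eval x) :
    ∃ a b : ℂ, ∀ x y, y ^ 2 = cubic e₁ e₂ e₃ x → F x y = a * x + b := by
  obtain ⟨C, hC0, hC⟩ := exists_norm_le_of_eval_eq hP
  have hneg : ∀ x y : ℂ, y ^ 2 = cubic e₁ e₂ e₃ x → (-y) ^ 2 = cubic e₁ e₂ e₃ x :=
    fun x y hy => by rw [neg_sq, hy]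
  have hF' : ContinuousOn (fun p : ℂ × ℂ => F p.1 (-p.2)) {p | p.2 ^ 2 = cubic e₁ e₂ e₃ p.1} :=
    hF.comp (f := fun p : ℂ × ℂ => (p.1, -p.2)) (by fun_prop) fun p hp => hneg _ _ hp
  have hP' : P.derivative ≠ 0 := fun h0 => hP (derivative_eq_zero.1 h0)
  -- The fibres of `P` over its critical values; elsewhere `F` is locally an inverse branch of `P`
  -- applied to `P(x)`.
  let B : Set ℂ := ⋃ w ∈ P.derivative.roots.toFinset, {x | (P - Polynomial.C (P.eval w)).IsRoot x}
  have hB : B.Finite := by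
    refine Set.Finite.biUnion (Finset.finite_toSet _) fun w _ => ?_
    refine finite_setOfPred_isRoot fun h0 => hP ?_
    rw [sub_eq_zero.1 h0, natDegree_C]
  have hdF : ∀ s : ℂ → ℂ, (∀ t, s t ^ 2 = cubic e₁ e₂ e₃ t) → ∀ x ∉ B, AnalyticAt ℂ s x →
      DifferentiableAt ℂ (fun t => F t (s t)) x := by
    intro s hs x hx han
    have hcont : ContinuousAt (fun t => F t (s t)) x := by
      have h2 := hF (x, s x) (hs x)
      rw [← continuousWithinAt_univ]
      exact ContinuousWithinAt.comp (f := fun x => (x, s x)) h2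
        ((continuousAt_id.prodMk han.continuousAt).continuousWithinAt) fun x _ => hs x
    refine differentiableAt_of_eval_eq hcont (fun t => h t _ (hs t)) fun h0 => hx ?_
    simp only [B, Set.mem_iUnion]
    refine ⟨F x (s x), ?_, ?_⟩
    · rw [Multiset.mem_toFinset, mem_roots hP']
      exact h0
    · simp [h x _ (hs x)]
  have hdF' : ∀ s : ℂ → ℂ, (∀ t, s t ^ 2 = cubic e₁ e₂ e₃ t) → ∀ x ∉ B, AnalyticAt ℂ s x →
      DifferentiableAt ℂ (fun t => F t (-s t)) x := fun s hs x hx han =>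
    hdF (fun t => -s t) (fun t => hneg _ _ (hs t)) x hx han.neg
  obtain ⟨p, hp, hp'⟩ := exists_eq_eval_of_even (H := fun x y => F x y + F x (-y)) (hF.add hF')
    (fun x y => by rw [neg_neg, add_comm]) hB
    (fun s hs x hx han => (hdF s hs x hx han).add (hdF' s hs x hx han))
    (C := (2 * C) ^ 2) (m := 2) (n := 2) (by norm_num) (fun x y hy => by
      rw [← mul_pow]
      refine pow_le_pow_left₀ (norm_nonneg _) ((norm_add_le _ _).trans ?_) 2
      linarith [hC _ _ (h x y hy), hC _ _ (h x (-y) (hneg x y hy))])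
  obtain ⟨q, hq, hq'⟩ := exists_eq_eval_of_even (H := fun x y => (F x y - F x (-y)) * y)
    ((hF.sub hF').mul continuousOn_snd)
    (fun x y => by rw [neg_neg]; ring) hB
    (fun s hs x hx han =>
      ((hdF s hs x hx han).sub (hdF' s hs x hx han)).mul han.differentiableAt)
    (C := (2 * C) ^ 2 * ((1 + ‖e₁‖) * (1 + ‖e₂‖) * (1 + ‖e₃‖))) (m := 5) (n := 3) (by norm_num)
    (fun x y hy => by
      have h1 : ‖F x y - F x (-y)‖ ≤ 2 * C * (1 + ‖x‖) := (norm_sub_le _ _).trans (by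
        linarith [hC _ _ (h x y hy), hC _ _ (h x (-y) (hneg x y hy))])
      have h2 : ∀ e, ‖x - e‖ ≤ (1 + ‖e‖) * (1 + ‖x‖) := fun e => (norm_sub_le _ _).trans (by
        nlinarith [norm_nonneg x, norm_nonneg e])
      calc ‖(F x y - F x (-y)) * y‖ ^ 2
          = ‖F x y - F x (-y)‖ ^ 2 * (‖x - e₁‖ * ‖x - e₂‖ * ‖x - e₃‖) := by
            rw [norm_mul, mul_pow, ← norm_pow y, hy, cubic, norm_mul, norm_mul]
        _ ≤ (2 * C * (1 + ‖x‖)) ^ 2 * (((1 + ‖e₁‖) * (1 + ‖x‖)) * ((1 + ‖e₂‖) * (1 + ‖x‖)) *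
            ((1 + ‖e₃‖) * (1 + ‖x‖))) := by
            gcongr <;> apply h2
        _ = _ := by ring)
  have hq0 : q = 0 := by
    refine Polynomial.eq_zero_of_degree_lt_of_eval_finset_eq_zero {e₁, e₂, e₃} ?_ ?_
    · rw [Finset.card_eq_three.2 ⟨e₁, e₂, e₃, h12, h13, h23, rfl⟩]
      exact hq
    · have h0 : ∀ e, cubic e₁ e₂ e₃ e = 0 → q.eval e = 0 := fun e he => by
        rw [← hq' e 0 (by rw [he]; norm_num), mul_zero]
      intro e he
      apply h0
      simp only [Finset.mem_insert, Finset.mem_singleton] at he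
      rcases he with rfl | rfl | rfl <;> simp [cubic]
  obtain ⟨u, v, rfl⟩ := exists_eq_X_add_C_of_natDegree_le_one (p := p)
    (natDegree_le_of_degree_le (Order.le_of_lt_succ hp))
  refine ⟨u / 2, v / 2, fun x y hy => ?_⟩
  have h1 := hp' x y hy
  have h2 := hq' x y hy
  rw [hq0, eval_zero] at h2
  have h3 : F x y = F x (-y) := by
    by_cases hy0 : y = 0
    · rw [hy0, neg_zero]
    · exact sub_eq_zero.1 ((mul_eq_zero.1 h2).resolve_right hy0)
  simp only [← h3, eval_add, eval_mul, eval_C, eval_X] at h1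
  linear_combination h1 / 2

end Curve

/-! ### Affine symmetries -/

/-- If `P(f) = P(g)` for polynomials `f`, `g` of the same degree, then `f` is an affine function
of `g`. -/
theorem exists_eq_of_comp_eq {P f g : ℂ[X]} (hP : P.natDegree ≠ 0) (hf : f.natDegree ≠ 0)
    (hfg : g.natDegree = f.natDegree) (h : P.comp f = P.comp g) :
    ∃ l d : ℂ, f = Polynomial.C l * g + Polynomial.C d := by
  set n := f.natDegree with hn
  obtain ⟨N, hN⟩ := Nat.exists_eq_succ_of_ne_zero hP
  have hP0 : P.leadingCoeff ≠ 0 := leadingCoeff_ne_zero.2 (by rintro rfl; simp at hP)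
  have hf0 : f.leadingCoeff ≠ 0 := leadingCoeff_ne_zero.2 (by rintro rfl; simp [hn] at hf)
  have hg0 : g.leadingCoeff ≠ 0 := leadingCoeff_ne_zero.2 (by
    rintro rfl; rw [natDegree_zero] at hfg; exact hf hfg.symm)
  -- Comparing leading coefficients makes `l` a root of unity of order dividing `deg P`, so `f^(N+1)
  -- - (l g)^(N+1)` cancels the top terms.
  set l := f.leadingCoeff / g.leadingCoeff with hl
  have hlc := congrArg leadingCoeff h
  rw [leadingCoeff_comp (hn ▸ hf), leadingCoeff_comp (hfg ▸ hf)] at hlc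
  have hlN : l ^ (N + 1) = 1 := by
    rw [hl, div_pow, ← Nat.succ_eq_add_one, ← hN, mul_left_cancel₀ hP0 hlc,
      div_self (pow_ne_zero _ hg0)]
  set k := Polynomial.C l * g with hk
  have hkn : k.natDegree ≤ n := hfg ▸ natDegree_C_mul_le _ _
  have hkc : k.coeff n = f.coeff n := by
    rw [hk, coeff_C_mul, ← hfg, coeff_natDegree, hl, div_mul_cancel₀ _ hg0, hfg, hn,
      coeff_natDegree]
  set S := ∑ i ∈ Finset.range (N + 1), f ^ i * k ^ (N + 1 - 1 - i) with hS
  have hSc : S.coeff (N * n) = (N + 1 : ℂ) * f.leadingCoeff ^ N := by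
    rw [hS, finsetSum_coeff, Finset.sum_congr rfl (g := fun _ => f.leadingCoeff ^ N)]
    · simp
    · intro i hi
      have hi' : i ≤ N := Nat.lt_succ_iff.1 (Finset.mem_range.1 hi)
      rw [Nat.add_sub_cancel, show N * n = i * n + (N - i) * n by
        rw [← add_mul, Nat.add_sub_cancel' hi'],
        coeff_mul_add_eq_of_natDegree_le (natDegree_pow_le_of_le i le_rfl)
          (natDegree_pow_le_of_le (N - i) hkn),
        coeff_pow_of_natDegree_le le_rfl, coeff_pow_of_natDegree_le hkn, hkc, coeff_natDegree,
        ← pow_add, Nat.add_sub_cancel' hi']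
  have hSc0 : S.coeff (N * n) ≠ 0 := by
    rw [hSc]
    exact mul_ne_zero (Nat.cast_add_one_ne_zero N) (pow_ne_zero _ hf0)
  -- The right side has degree at most `N n`, and `S` has exact degree `N n`; therefore `f - k` is
  -- constant.
  have hfac : Polynomial.C P.leadingCoeff * (S * (f - k)) =
      P.eraseLead.comp g - P.eraseLead.comp f := by
    rw [hS, (Commute.all f k).geom_sum₂_mul, hk, mul_pow, ← C_pow, hlN, C_1, one_mul]
    have e : ∀ q : ℂ[X], P.comp q =
        P.eraseLead.comp q + Polynomial.C P.leadingCoeff * q ^ (N + 1) := fun q => by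
      conv_lhs => rw [← P.eraseLead_add_C_mul_X_pow]
      rw [hN, add_comp, mul_comp, C_comp, pow_comp, X_comp]
    rw [e, e] at h
    linear_combination h
  have hdeg : (P.eraseLead.comp g - P.eraseLead.comp f).natDegree ≤ N * n := by
    have hE : P.eraseLead.natDegree ≤ N := (eraseLead_natDegree_le P).trans (by omega)
    refine (natDegree_sub_le _ _).trans (max_le ?_ ?_) <;> rw [natDegree_comp]
    · rw [hfg]; gcongr
    · rw [← hn]; gcongr
  have hconst : (f - k).natDegree = 0 := by
    by_cases hfk : f - k = 0
    · rw [hfk, natDegree_zero]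
    · have hS0 : S ≠ 0 := by rintro h0; rw [h0] at hSc0; simp at hSc0
      rw [← hfac, natDegree_C_mul hP0, natDegree_mul hS0 hfk] at hdeg
      have := le_natDegree_of_ne_zero hSc0
      omega
  refine ⟨l, (f - k).coeff 0, ?_⟩
  rw [← eq_C_of_natDegree_eq_zero hconst, add_sub_cancel]

theorem belyiC_eq_comp : belyiC =
    (((betaPoly 1 1).comp (betaPoly 10 1)).map (algebraMap ℚ ℂ)).comp (f.map (algebraMap ℚ ℂ)) := by
  rw [belyiC, belyiPoly, ← Polynomial.map_comp, comp_assoc]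

/-- Write `P = A ∘ f`. Equality of `A ∘ f` and `A ∘ (f ∘ ℓ)` makes `f` affine in `f ∘ ℓ`;
differentiating, `ℓ` preserves `x^10 (x - 1)` up to a scalar. It permutes the zeros 0 and 1, and
their unequal multiplicities forbid an exchange. -/
theorem eq_one_of_eval_belyiC {u v : ℂ}
    (h : ∀ x, belyiC.eval (u * x + v) = belyiC.eval x) : u = 1 ∧ v = 0 := by
  have hu : u ≠ 0 := by
    rintro rfl
    have h1 : belyiC = Polynomial.C (belyiC.eval v) := Polynomial.funext fun x => by
      rw [eval_C, ← h x, zero_mul, zero_add]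
    apply natDegree_belyiC
    rw [h1, natDegree_C]
  set A := ((betaPoly 1 1).comp (betaPoly 10 1)).map (algebraMap ℚ ℂ)
  set F := f.map (algebraMap ℚ ℂ) with hF
  have hFdeg : F.natDegree = 12 := by rw [hF, natDegree_map, natDegree_f]
  have hlin : (Polynomial.C u * X + Polynomial.C v).natDegree = 1 := natDegree_linear hu
  have hA : A.natDegree ≠ 0 := by
    intro h0
    apply natDegree_belyiC
    rw [belyiC_eq_comp, natDegree_comp, h0, zero_mul]
  have hcomp : A.comp F = A.comp (F.comp (Polynomial.C u * X + Polynomial.C v)) := by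
    rw [← comp_assoc, ← belyiC_eq_comp]
    refine Polynomial.funext fun x => ?_
    rw [eval_comp, ← h x]
    simp
  obtain ⟨l, d, hld⟩ := exists_eq_of_comp_eq hA (by rw [hFdeg]; norm_num)
    (by rw [natDegree_comp, hlin, mul_one]) hcomp
  have hder : F.derivative = 12 * X ^ 10 * (X - 1) := by
    rw [hF, derivative_map, derivative_f]
    simp only [Polynomial.map_mul, Polynomial.map_pow, Polynomial.map_sub, Polynomial.map_one, map_X,
      map_ofNat, Polynomial.map_ofNat]
  have key : ∀ x, 12 * x ^ 10 * (x - 1) =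
      l * u * (12 * (u * x + v) ^ 10 * (u * x + v - 1)) := fun x => by
    have h1 := congrArg (eval x ∘ derivative) hld
    simp only [Function.comp, derivative_add, derivative_mul, derivative_C, derivative_comp, hder,
      derivative_X] at h1
    simp only [eval_mul, eval_add, eval_sub, eval_pow, eval_X, eval_C, eval_comp, eval_one,
      eval_zero, eval_ofNat] at h1
    linear_combination h1
  have hl : l ≠ 0 := by
    rintro rfl
    have := key 2
    norm_num at this
  have h0 : v = 0 ∨ v = 1 := by
    have := key 0
    simpa [hl, hu, sub_eq_zero] using this
  have h1 : u + v = 0 ∨ u + v = 1 := by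
    have := key 1
    simpa [hl, hu, sub_eq_zero] using this
  rcases h0 with rfl | rfl
  · exact ⟨by simpa [hu] using h1, rfl⟩
  · rcases h1 with h1 | h1
    · have hu' : u = -1 := by linear_combination h1
      subst hu'
      -- For the exchange `x ↦ 1 - x`, the values at 2 and -1 demand incompatible scalars `l`.
      have e1 := key 2
      have e2 := key (-1)
      norm_num at e1 e2
      exfalso
      have : (24 : ℂ) = 512 * 12288 := by linear_combination e2 - 512 * e1
      norm_num at this
    · exact absurd (by linear_combination h1) hu

/-! ### Isomorphisms of the dessins -/

section Curve

variable {e₁ e₂ e₃ e₁' e₂' e₃' : ℂ}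

theorem polyFun_eq_infty_iff {X : Set P2} {P : ℂ[X]} {p : X} :
    polyFun P p = infty ↔ (p : P2).rep 2 = 0 := by
  refine ⟨fun h => ?_, polyFun_of_eq P⟩
  by_contra hp
  rw [polyFun_of_ne P hp] at h
  exact fin_ne_infty _ h

theorem continuous_affinePoint : Continuous fun p : ℂ × ℂ => affinePoint p.1 p.2 := by
  refine continuous_iff_continuousAt.2 fun p => ?_
  refine continuousAt_mk (v := fun p : ℂ × ℂ => ![p.1, p.2, 1]) ?_ (affine_ne_zero _ _)
    (Eventually.of_forall fun q => ⟨affine_ne_zero _ _, rfl⟩)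
  refine continuousAt_pi.2 fun i => ?_
  fin_cases i
  · exact continuousAt_fst
  · exact continuousAt_snd
  · exact continuousAt_const

/-- The function `x ∘ h` satisfies the hypotheses of `exists_affine_of_eval_eq`. Since every `x` is
attained on the curve, the resulting affine map preserves `belyiC` and must be the identity. -/
theorem ratio_homeomorph (h12 : e₁ ≠ e₂) (h13 : e₁ ≠ e₃) (h23 : e₂ ≠ e₃)
    (h : curve e₁ e₂ e₃ ≃ₜ curve e₁' e₂' e₃') (hh : ∀ p, polyFun belyiC (h p) = polyFun belyiC p)
    (p : curve e₁ e₂ e₃) (hp : (p : P2).rep 2 ≠ 0) : ratio 0 2 (h p) = ratio 0 2 p := by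
  have hrep : ∀ q : curve e₁ e₂ e₃, (q : P2).rep 2 ≠ 0 → (h q : P2).rep 2 ≠ 0 := fun q hq => by
    rwa [Ne, ← polyFun_eq_infty_iff (P := belyiC), hh, polyFun_eq_infty_iff]
  have heval : ∀ q : curve e₁ e₂ e₃, (q : P2).rep 2 ≠ 0 →
      belyiC.eval (ratio 0 2 (h q)) = belyiC.eval (ratio 0 2 q) := fun q hq => by
    have := hh q
    rw [polyFun_of_ne _ hq, polyFun_of_ne _ (hrep q hq)] at this
    exact fin_injective this
  classical
  let F : ℂ → ℂ → ℂ := fun x y => if hy : y ^ 2 = cubic e₁ e₂ e₃ x then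
    ratio 0 2 (h ⟨affinePoint x y, affinePoint_mem_curve.2 hy⟩) else 0
  have hF : ∀ x y (hy : y ^ 2 = cubic e₁ e₂ e₃ x),
      F x y = ratio 0 2 (h ⟨affinePoint x y, affinePoint_mem_curve.2 hy⟩) :=
    fun x y hy => dif_pos hy
  have hcont : ContinuousOn (fun p : ℂ × ℂ => F p.1 p.2) {p | p.2 ^ 2 = cubic e₁ e₂ e₃ p.1} := by
    rw [continuousOn_iff_continuous_domRestrict]
    have h1 : Continuous fun q : {p : ℂ × ℂ | p.2 ^ 2 = cubic e₁ e₂ e₃ p.1} =>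
        h ⟨affinePoint q.1.1 q.1.2, affinePoint_mem_curve.2 q.2⟩ :=
      h.continuous.comp ((continuous_affinePoint.comp continuous_subtype_val).subtype_mk _)
    refine continuous_iff_continuousAt.2 fun q => ?_
    have h2 := ContinuousAt.comp (g := fun q : curve e₁' e₂' e₃' => ratio 0 2 q)
      (f := fun q : {p : ℂ × ℂ | p.2 ^ 2 = cubic e₁ e₂ e₃ p.1} =>
        h ⟨affinePoint q.1.1 q.1.2, affinePoint_mem_curve.2 q.2⟩)
      (continuousAt_ratio_val (hrep _ (rep_affinePoint q.1.1 q.1.2))) (h1.continuousAt (x := q))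
    exact h2.congr (Eventually.of_forall fun q' => (hF _ _ q'.2).symm)
  obtain ⟨u, v, huv⟩ := exists_affine_of_eval_eq h12 h13 h23 natDegree_belyiC hcont
    fun x y hy => by
      rw [hF x y hy, heval _ (rep_affinePoint x y), ratio_affinePoint_zero]
  obtain ⟨rfl, rfl⟩ := eq_one_of_eval_belyiC (u := u) (v := v) fun x => by
    obtain ⟨y, hy⟩ := IsAlgClosed.exists_pow_nat_eq (cubic e₁ e₂ e₃ x) two_pos
    rw [← huv x y hy, hF x y hy, heval _ (rep_affinePoint x y), ratio_affinePoint_zero]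
  have hy := sq_eq_cubic p.2 hp
  have h1 := huv _ _ hy
  rw [hF _ _ hy, one_mul, add_zero] at h1
  have h2 : (⟨affinePoint (ratio 0 2 p) (ratio 1 2 p), affinePoint_mem_curve.2 hy⟩ :
      curve e₁ e₂ e₃) = p := Subtype.ext (eq_affinePoint hp).symm
  rwa [h2] at h1

/-- A branch point is an `x` with a single point above it. The inverse homeomorphism preserves `x`
and sends both points `(x, ±y)` to `(x, 0)`, so injectivity gives `y = -y`. -/
theorem cubic_eq_zero_of_homeomorph (h12 : e₁' ≠ e₂') (h13 : e₁' ≠ e₃') (h23 : e₂' ≠ e₃')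
    (h : curve e₁ e₂ e₃ ≃ₜ curve e₁' e₂' e₃') (hh : ∀ p, polyFun belyiC (h p) = polyFun belyiC p)
    {x : ℂ} (hx : cubic e₁ e₂ e₃ x = 0) : cubic e₁' e₂' e₃' x = 0 := by
  have hh' : ∀ p, polyFun belyiC (h.symm p) = polyFun belyiC p := fun p => by
    rw [← hh, h.apply_symm_apply]
  obtain ⟨y, hy⟩ := IsAlgClosed.exists_pow_nat_eq (cubic e₁' e₂' e₃' x) two_pos
  have key : ∀ z (hz : z ^ 2 = cubic e₁' e₂' e₃' x),
      (h.symm ⟨affinePoint x z, affinePoint_mem_curve.2 hz⟩ : P2) = affinePoint x 0 := by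
    intro z hz
    set q : curve e₁' e₂' e₃' := ⟨affinePoint x z, affinePoint_mem_curve.2 hz⟩
    have hq2 : (q : P2).rep 2 ≠ 0 := rep_affinePoint x z
    have h2 : (h.symm q : P2).rep 2 ≠ 0 := by
      rwa [Ne, ← polyFun_eq_infty_iff (P := belyiC), hh', polyFun_eq_infty_iff]
    have h3 : ratio 0 2 (h.symm q) = x :=
      (ratio_homeomorph h12 h13 h23 h.symm hh' q hq2).trans (ratio_affinePoint_zero x z)
    have h4 := sq_eq_cubic (h.symm q).2 h2
    rw [h3, hx, sq_eq_zero_iff] at h4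
    rw [eq_affinePoint h2, h3, h4]
  have h1 := key y hy
  have h2 := key (-y) (by rw [neg_sq, hy])
  have h3 := h.symm.injective (Subtype.ext (h1.trans h2.symm))
  have h4 := congrArg (fun p : curve e₁' e₂' e₃' => ratio 1 2 p) h3
  simp only [ratio_affinePoint_one] at h4
  rw [← hy, self_eq_neg.1 h4]
  norm_num

end Curve

/-- The isomorphism class of the dessin attached to a set of labels. -/
def tripleClass (r : Labelling) (s : Finset (Fin 12)) : DessinClass :=
  (dessin {p | p.rep 1 ^ 2 * p.rep 2 = ∏ i ∈ s, (p.rep 0 - r i * p.rep 2)}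
    (polyFun belyiC)).toClass

theorem dessinClass_eq_tripleClass (r : Labelling) {i j k : Fin 12} (h : Distinct i j k) :
    dessinClass r i j k = tripleClass r {i, j, k} := by
  have h1 : {p : P2 | p.rep 1 ^ 2 * p.rep 2 =
      ∏ s ∈ ({i, j, k} : Finset (Fin 12)), (p.rep 0 - r s * p.rep 2)} = E r i j k := by
    ext p
    rw [Set.mem_ofPred_eq, Finset.prod_insert (by simp [h.1, h.2.1]), Finset.prod_insert (by simp [h.2.2]),
        Finset.prod_singleton, ← mul_assoc]
    rfl
  rw [tripleClass, dessinClass, funext (beta_eq_polyFun r i j k), h1]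

/-- Compatibility of the homeomorphism with the maps to the sphere is enough: it carries the roots
of one cubic to roots of the other. -/
theorem subset_of_dessinClass_eq (r : Labelling) {i j k i' j' k' : Fin 12}
    (hd' : Distinct i' j' k') (h : dessinClass r i j k = dessinClass r i' j' k') :
    ({i, j, k} : Finset (Fin 12)) ⊆ {i', j', k'} := by
  obtain ⟨g, hg, -⟩ := Quotient.exact h
  have hg' : ∀ p : E r i j k, polyFun belyiC (g p : E r i' j' k') = polyFun belyiC p := fun p => by
    rw [← beta_eq_polyFun r i j k p]
    exact (beta_eq_polyFun r i' j' k' (g p)).symm.trans (hg p)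
  intro m hm
  have hx : cubic (r i) (r j) (r k) (r m) = 0 := by
    simp only [Finset.mem_insert, Finset.mem_singleton] at hm
    rcases hm with rfl | rfl | rfl <;> simp [cubic]
  have h1 := cubic_eq_zero_of_homeomorph (labelling_ne r hd'.1) (labelling_ne r hd'.2.1)
    (labelling_ne r hd'.2.2) g hg' hx
  have h2 : ∀ {l}, (r m : ℂ) = r l → m = l := fun h => r.injective (Subtype.ext h)
  rw [cubic, mul_eq_zero, mul_eq_zero, sub_eq_zero, sub_eq_zero, sub_eq_zero] at h1
  rcases h1 with (h1 | h1) | h1 <;> simp [h2 h1]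

theorem card_of_distinct {i j k : Fin 12} (h : Distinct i j k) :
    ({i, j, k} : Finset (Fin 12)).card = 3 :=
  Finset.card_eq_three.2 ⟨i, j, k, h.1, h.2.1, h.2.2, rfl⟩

/-- This injectivity makes the action on isomorphism classes well defined and lets orbits of dessins
be counted as orbits of triples. -/
theorem injOn_tripleClass (r : Labelling) : Set.InjOn (tripleClass r) {s | s.card = 3} := by
  intro s hs t ht h
  obtain ⟨i, j, k, h1, h2, h3, rfl⟩ := Finset.card_eq_three.1 hs
  obtain ⟨i', j', k', h1', h2', h3', rfl⟩ := Finset.card_eq_three.1 ht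
  rw [← dessinClass_eq_tripleClass r ⟨h1, h2, h3⟩, ← dessinClass_eq_tripleClass r ⟨h1', h2', h3'⟩] at h
  exact Finset.eq_of_subset_of_card_le (subset_of_dessinClass_eq r ⟨h1', h2', h3'⟩ h)
    (ht.trans hs.symm).le

/-! ### The action of the Galois group on the family of dessins -/

theorem tripleClass_mem_family (r : Labelling) (s : {s : Finset (Fin 12) // s.card = 3}) :
    tripleClass r s ∈ family r := by
  obtain ⟨s, hs⟩ := s
  obtain ⟨i, j, k, h1, h2, h3, rfl⟩ := Finset.card_eq_three.1 hs
  exact ⟨i, j, k, ⟨h1, h2, h3⟩, (dessinClass_eq_tripleClass r ⟨h1, h2, h3⟩).symm⟩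

/-- The members of the family of dessins correspond to the unordered triples of labels. -/
def familyEquiv (r : Labelling) : {s : Finset (Fin 12) // s.card = 3} ≃ family r :=
  Equiv.ofBijective (fun s => ⟨tripleClass r s, tripleClass_mem_family r s⟩)
    ⟨fun s t h => Subtype.ext (injOn_tripleClass r s.2 t.2 (congrArg Subtype.val h)), by
      rintro ⟨_, i, j, k, h, rfl⟩
      exact ⟨⟨{i, j, k}, card_of_distinct h⟩,
        Subtype.ext (dessinClass_eq_tripleClass r h).symm⟩⟩

theorem familyEquiv_member (r : Labelling) {i j k : Fin 12} (h : Distinct i j k) :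
    (familyEquiv r).symm (member r i j k h) = ⟨{i, j, k}, card_of_distinct h⟩ := by
  rw [Equiv.symm_apply_eq]
  exact Subtype.ext (dessinClass_eq_tripleClass r h)

/-- The image of a triple of labels under a permutation. -/
def permTriple (g : Equiv.Perm (Fin 12)) (s : {s : Finset (Fin 12) // s.card = 3}) :
    {s : Finset (Fin 12) // s.card = 3} :=
  ⟨s.1.image g, by rw [Finset.card_image_of_injective _ g.injective, s.2]⟩

/-- The action of the Galois group on the family of dessins. -/
abbrev galAction (r : Labelling) : MulAction G (family r) where
  smul σ D := familyEquiv r (permTriple (galEquiv r σ) ((familyEquiv r).symm D))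
  one_smul D := by
    change familyEquiv r (permTriple (galEquiv r 1) ((familyEquiv r).symm D)) = D
    rw [← Equiv.eq_symm_apply]
    exact Subtype.ext (by simp [permTriple])
  mul_smul σ τ D := by
    change familyEquiv r _ = familyEquiv r (permTriple _ ((familyEquiv r).symm (familyEquiv r _)))
    rw [Equiv.symm_apply_apply]
    congr 1
    refine Subtype.ext ?_
    simp only [permTriple, map_mul, Finset.image_image]
    rfl

theorem galAction_smul (r : Labelling) (σ : G) (D : family r) :
    letI := galAction r
    ((σ • D : family r) : DessinClass) =
      tripleClass r (((familyEquiv r).symm D).1.image (galEquiv r σ)) := rfl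

theorem Distinct.map {i j k : Fin 12} (h : Distinct i j k) (g : Equiv.Perm (Fin 12)) :
    Distinct (g i) (g j) (g k) :=
  ⟨g.injective.ne h.1, g.injective.ne h.2.1, g.injective.ne h.2.2⟩

theorem galAction_smul_member (r : Labelling) (σ : G) {i j k : Fin 12} (h : Distinct i j k) :
    letI := galAction r
    ((σ • member r i j k h : family r) : DessinClass) =
      dessinClass r (galEquiv r σ i) (galEquiv r σ j) (galEquiv r σ k) := by
  rw [galAction_smul, familyEquiv_member, dessinClass_eq_tripleClass r (h.map _)]
  simp [Finset.image_insert]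

theorem dessinOrbit_eq (r : Labelling) (g : Equiv.Perm (Fin 12)) :
    letI := galAction r
    dessinOrbit r ((galEquiv r).symm g) = tripleClass r '' tripleOrbit g := by
  let _ := galAction r
  ext D
  constructor
  · rintro ⟨_, ⟨⟨σ, hσ⟩, rfl⟩, rfl⟩
    refine ⟨_, ⟨galEquiv r σ, ?_, rfl⟩, ?_⟩
    · obtain ⟨n, rfl⟩ := hσ
      exact ⟨n, by simp⟩
    · change _ = ((σ • member r 2 7 11 distinct_2_7_11 : family r) : DessinClass)
      rw [galAction_smul, familyEquiv_member]
  · rintro ⟨_, ⟨h, ⟨n, rfl⟩, rfl⟩, rfl⟩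
    refine ⟨_, ⟨⟨((galEquiv r).symm g) ^ n, n, rfl⟩, rfl⟩, ?_⟩
    change ((((galEquiv r).symm g) ^ n • member r 2 7 11 distinct_2_7_11 : family r) :
      DessinClass) = _
    rw [galAction_smul, familyEquiv_member]
    simp

theorem card_of_mem_tripleOrbit {g : Equiv.Perm (Fin 12)} {s : Finset (Fin 12)}
    (hs : s ∈ tripleOrbit g) : s.card = 3 := by
  obtain ⟨h, -, rfl⟩ := hs
  rw [Finset.card_image_of_injective _ h.injective]
  rfl

theorem ncard_dessinOrbit (r : Labelling) (g : Equiv.Perm (Fin 12)) :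
    letI := galAction r
    (dessinOrbit r ((galEquiv r).symm g)).ncard = (tripleOrbit g).ncard := by
  rw [dessinOrbit_eq]
  exact ((injOn_tripleClass r).mono fun s hs => card_of_mem_tripleOrbit hs).ncard_image

theorem ncard_tripleOrbit_a : (tripleOrbit a).ncard = 5 := by
  have h := Set.ncard_coe_finset ({{2, 7, 11}, {3, 7, 8}, {4, 8, 9}, {5, 9, 10}, {6, 10, 11}} :
    Finset (Finset (Fin 12)))
  rw [show Finset.card _ = 5 by decide] at h
  rw [tripleOrbit_a, ← h]
  simp

theorem ncard_tripleOrbit_b : (tripleOrbit b).ncard = 3 := by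
  have h := Set.ncard_coe_finset ({{2, 7, 11}, {3, 4, 8}, {1, 5, 6}} : Finset (Finset (Fin 12)))
  rw [show Finset.card _ = 3 by decide] at h
  rw [tripleOrbit_b, ← h]
  simp

theorem ncard_tripleOrbit_ab : (tripleOrbit ab).ncard = 2 := by
  have h := Set.ncard_coe_finset ({{2, 7, 11}, {1, 4, 5}} : Finset (Finset (Fin 12)))
  rw [show Finset.card _ = 2 by decide] at h
  rw [tripleOrbit_ab, ← h]
  simp

/-- The five-cycle sent to `a` moves the triple `{2, 7, 11}` to `{3, 7, 8}`. -/
theorem galAction_nontrivial (r : Labelling) :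
    letI := galAction r
    ∃ (τ : alternatingGroup (Fin 5)) (D : family r), (galEquiv r).symm (theta τ) • D ≠ D := by
  let _ := galAction r
  refine ⟨alpha, member r 2 7 11 distinct_2_7_11, fun h => ?_⟩
  have h1 := congrArg Subtype.val h
  rw [galAction_smul, familyEquiv_member, theta_alpha, MulEquiv.apply_symm_apply] at h1
  have h2 := injOn_tripleClass r
    (show (Finset.image a {2, 7, 11}).card = 3 by decide) (card_of_distinct distinct_2_7_11)
    (h1.trans (dessinClass_eq_tripleClass r distinct_2_7_11))
  exact absurd h2 (by decide)

end EllipticDessins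

end

/-! ### The main theorem -/

open EllipticDessins in
theorem mainTheorem1 :
    -- the polynomial `f`
    Irreducible f ∧ f.Separable ∧ (f.rootSet ℂ).ncard = 12 ∧
    -- the permutations `a`, `b` and `ab` and the orbits of `{2, 7, 11}`
    a ^ 5 = 1 ∧ b ^ 3 = 1 ∧ ab ^ 2 = 1 ∧ ab = b * a ∧
    tripleOrbit a = {{2, 7, 11}, {3, 7, 8}, {4, 8, 9}, {5, 9, 10}, {6, 10, 11}} ∧
    tripleOrbit b = {{2, 7, 11}, {3, 4, 8}, {1, 5, 6}} ∧
    tripleOrbit ab = {{2, 7, 11}, {1, 4, 5}} ∧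
    -- `A₅` as a permutation group on the faces of the dodecahedron
    ∃ θ : alternatingGroup (Fin 5) →* Equiv.Perm (Fin 12),
      Function.Injective θ ∧ θ.range = Subgroup.closure {a, b} ∧
      (∀ g : Equiv.Perm (Fin 12), g ∈ θ.range ↔ IsFaceRotation g) ∧
      ∀ r : Labelling,
        -- the Galois group of `f` is the full symmetric group on the roots
        ∃ ρ : G ≃* Equiv.Perm (Fin 12),
          (∀ (σ : G) (i : Fin 12), σ (root r i) = root r (ρ σ i)) ∧
          -- the curves are elliptic and the functions on them are clean Belyi functions
          (∀ i j k : Fin 12, Distinct i j k →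
            (∃ W : WeierstrassCurve K, W.IsElliptic ∧
              WeierstrassCurve.Projective.polynomial W = (pair r i j k).curve) ∧
            (pair r i j k).points = E r i j k ∧
            (∀ p : E r i j k, (pair r i j k).function p = beta r i j k p) ∧
            IsCleanBelyi (E r i j k) (beta r i j k)) ∧
          -- the Galois group acts on the pairs by permuting the indices
          (∀ (σ : G) (i j k : Fin 12), Distinct i j k →
            (pair r i j k).conj σ = pair r (ρ σ i) (ρ σ j) (ρ σ k)) ∧
          -- the induced action on the family of dessins
          ∃ _ : MulAction G (family r),
            (∀ (σ : G) (i j k : Fin 12) (h : Distinct i j k),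
              ((σ • member r i j k h : family r) : DessinClass) =
                  ((pair r i j k).conj σ).dessin.toClass ∧
              ((σ • member r i j k h : family r) : DessinClass) =
                  dessinClass r (ρ σ i) (ρ σ j) (ρ σ k)) ∧
            -- its restriction to `A₅` is not trivial
            (∃ (τ : alternatingGroup (Fin 5)) (D : family r), ρ.symm (θ τ) • D ≠ D) ∧
            -- the orbits of `𝒟(β^{2,7,11})`
            (dessinOrbit r (ρ.symm a) = {dessinClass r 2 7 11, dessinClass r 3 7 8,
                dessinClass r 4 8 9, dessinClass r 5 9 10, dessinClass r 6 10 11} ∧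
              (dessinOrbit r (ρ.symm a)).ncard = 5) ∧
            (dessinOrbit r (ρ.symm b) = {dessinClass r 2 7 11, dessinClass r 3 4 8,
                dessinClass r 1 5 6} ∧
              (dessinOrbit r (ρ.symm b)).ncard = 3) ∧
            (dessinOrbit r (ρ.symm ab) = {dessinClass r 2 7 11, dessinClass r 1 4 5} ∧
              (dessinOrbit r (ρ.symm ab)).ncard = 2) := by
  refine ⟨irreducible_f, separable_f, card_rootSet_f, a_pow_five, b_pow_three, ab_pow_two, ab_eq,
    tripleOrbit_a, tripleOrbit_b, tripleOrbit_ab, theta, theta_injective, range_theta,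
    fun g => by rw [range_theta, isFaceRotation_iff_mem_closure], fun r => ?_⟩
  refine ⟨galEquiv r, galEquiv_apply r, fun i j k h => ⟨exists_isElliptic r h, points_pair r i j k,
    function_pair r h, isCleanBelyi_beta r h⟩, fun σ i j k _ => conj_pair r σ i j k, galAction r,
    fun σ i j k h => ⟨?_, galAction_smul_member r σ h⟩, galAction_nontrivial r, ⟨?_, ?_⟩,
    ⟨?_, ?_⟩, ⟨?_, ?_⟩⟩
  -- The action transported from triples agrees with conjugation of coefficients, because the
  -- conjugate pair is the pair of the permuted indices.
  · rw [galAction_smul_member r σ h, conj_pair, toClass_dessin_pair r (h.map _)]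
  · rw [dessinOrbit_eq, tripleOrbit_a]
    simp only [Set.image_insert_eq, Set.image_singleton]
    rw [dessinClass_eq_tripleClass, dessinClass_eq_tripleClass, dessinClass_eq_tripleClass,
      dessinClass_eq_tripleClass, dessinClass_eq_tripleClass] <;>
      refine ⟨?_, ?_, ?_⟩ <;> decide
  · rw [ncard_dessinOrbit, ncard_tripleOrbit_a]
  · rw [dessinOrbit_eq, tripleOrbit_b]
    simp only [Set.image_insert_eq, Set.image_singleton]
    rw [dessinClass_eq_tripleClass, dessinClass_eq_tripleClass, dessinClass_eq_tripleClass] <;>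
      refine ⟨?_, ?_, ?_⟩ <;> decide
  · rw [ncard_dessinOrbit, ncard_tripleOrbit_b]
  · rw [dessinOrbit_eq, tripleOrbit_ab]
    simp only [Set.image_insert_eq, Set.image_singleton]
    rw [dessinClass_eq_tripleClass, dessinClass_eq_tripleClass] <;>
      refine ⟨?_, ?_, ?_⟩ <;> decide
  · rw [ncard_dessinOrbit, ncard_tripleOrbit_ab]
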